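/- **Setting.** Let $Q$ be a finite acyclic quiver with vertices $0,\dots,\rho$ ($\rho\ge 1$), unique source $0$, $n_{ij}$ arrows from $i$ to $j$ ($n_{ij}=0$ for $i\ge j$), and dimension vector $\mathbf r=(1,r_1,\dots,r_\rho)$. For $i\ge1$ put $s_i=\sum_{t(a)=i}r_{s(a)}$, $s_i'=\sum_{s(a)=i}r_{t(a)}$, $c_i=s_i-s_i'$, let $\tilde s_i$ be the number of paths from $0$ to $i$, and assume $0<r_i<s_i$. Suppose $Q$ is *Y-shaped*: vertex $1$ has at most two outgoing arrows, every other non-source vertex at most one; every vertex has at most one incoming arrow from a non-source vertex; and there is a path from $1$ to every $i\ge 1$. Suppose that the quiver flag variety $M_Q$, with $-K_{M_Q}=\sum_i c_i\,c_1(W_i)$ and ample cone the open positive orthant in the classes $c_1(W_i)$, is Fano, i.e. $c_i>0$ for all $i\geq 1$. If two arrows leave $1$, let $S_1'$ and $S_2'$ be the sets of vertices $i\ge 2$ such that the path from $1$ to $i$ contains the first, respectively the second, of them; if at most one arrow leaves $1$, let $S_1'=\emptyset$, $S_2'=\{2,\dots,\rho\}$. Put $S_j=S_j'\cup\{1\}$.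 **Ladder diagram.** For $i\ge 1$ let $p(i)$ be the non-source vertex with an arrow to $i$ if $i\ge 2$, and $p(1)=0$; put $w_0=0$ and $w_i=\tilde s_i-r_i$. The ladder diagram of the leg $S_j$ consists of all unit boxes in the rectangles $[w_{p(i)},w_i]\times[0,r_i]$, $i\in S_j$, with marked points: the origin, all lattice points all four of whose adjacent boxes belong to the diagram, the points $(w_i,r_i)$ for $i\in S_j$, and the points $(w_{p(i)},\min(r_{p(i)},r_i))$ for $i\in S_j'$. The ladder diagram of $Q$ is the union of the diagram of $S_2$ with the image of the diagram of $S_1$ under the rotation $q\mapsto (w_1,r_1)-q$. Let $O_2=(0,0)$, $O_1=(w_1,r_1)$; the external vertices are $v_i=(w_i,r_i)$ for $i\in S_2$ and $v_i=(w_1,r_1)-(w_i,r_i)$ for $i\in S_1'$. **Ladder quiver and $X(Q)$.** The ladder quiver $L(Q)$ has the marked points as vertices; its arrows are the lattice paths with unit steps to the right or upwards along sides of boxes that join two marked points and pass through no other marked point. Let $\mathbb L^\vee$ be the free abelian group on $e_x$, $x$ a vertex with $x\ne O_2$, and put $e_{O_2}=0$. An arrow $a:x\to y$ has weight $\omega_a=e_y-e_x$.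 With $w=\sum_a \omega_a$, let $$X(Q)=\operatorname{Proj}\bigoplus_{n\ge0}\mathbb C[x_a : a\in L(Q)_1]_{nw}$$ be the GIT quotient of $\mathbb C^{L(Q)_1}$ with these weights and stability condition $w$, and let $D_a$ be the toric prime divisor $\{x_a=0\}$ on $X(Q)$. For a path $\Pi$ in $L(Q)$ put $D_\Pi=\sum_{a\in\Pi}D_a$. For $i\in S_2$ let $D_i=D_\Pi$ for a path $\Pi$ from $O_2$ to $v_i$; for $i\in S_1'$ let $D_i=D_\Pi$ for a path $\Pi$ from $v_i$ to $O_1$. **Proposition.** $X(Q)$ is an integral, locally Noetherian scheme; such paths exist for every $i\ge1$; and 1. for every $i\ge 1$ and every choice of path, the Weil divisor $D_i$ on $X(Q)$ is Cartier; 2. for every choice of the paths, $-\sum_{i=1}^\rho c_iD_i$ is a canonical divisor of $X(Q)$, i.e. the divisor of a nonzero rational top differential form, so that $-K_{X(Q)}=\sum_i c_iD_i$; 3. $X(Q)$ is Gorenstein: it is normal and its canonical divisor is Cartier. -/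

import Mathlib

open AlgebraicGeometry CategoryTheory

noncomputable section

namespace LadderToric

/-! ## Cartier, canonical and Gorenstein on integral Noetherian schemes over `ℂ`

A Weil divisor is given by its multiplicities `z ↦ D z` at the points `z` of codimension one
(and `D z = 0` at all other points).  `Scheme.ord f z` is Mathlib's order of vanishing of a
rational function `f` at `z`; it is zero when `z` does not have codimension one. -/

/-- A Weil divisor is Cartier if it is locally the divisor of a nonzero rational function. -/
def IsCartier (X : Scheme.{0}) [AlgebraicGeometry.IsIntegral X] [IsLocallyNoetherian X]
    (D : X → ℤ) : Prop :=
  ∀ x : X, ∃ U : X.Opens, x ∈ U ∧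
    ∃ f : X.functionField, f ≠ 0 ∧ ∀ z ∈ U, D z = Scheme.ord f z

/-- The `ℂ`-algebra structure of the function field of a scheme over `ℂ`. -/
def scalarHom {X : Scheme.{0}} [AlgebraicGeometry.IsIntegral X] (π : X ⟶ Spec (.of ℂ)) :
    ℂ →+* X.functionField :=
  ((Scheme.ΓSpecIso (.of ℂ)).inv ≫ π.appTop ≫
    X.presheaf.germ ⊤ (genericPoint X) trivial).hom

/-- Top differential forms of a field `K` over `ℂ`: the exterior power of `Ω[K⁄ℂ]` in degree
`dim_K Ω[K⁄ℂ]` (which is the transcendence degree). -/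
abbrev TopForm (K : Type) [Field K] [Algebra ℂ K] : Type :=
  ⋀[K]^(Module.finrank K Ω[K⁄ℂ]) Ω[K⁄ℂ]

/-- The form `df₁ ∧ ⋯ ∧ df_d`. -/
def dForm (K : Type) [Field K] [Algebra ℂ K] (f : Fin (Module.finrank K Ω[K⁄ℂ]) → K) :
    TopForm K :=
  exteriorPower.ιMulti K (Module.finrank K Ω[K⁄ℂ]) fun i => KaehlerDifferential.D ℂ K (f i)

/-- For a subring `R → K`: the top forms that are regular over `R`, that is, the sums of forms
`g df₁ ∧ ⋯ ∧ df_d` with `g, f₁, …, f_d` in `R`. -/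
def regularTopForms (R K : Type) [CommRing R] [Field K] [Algebra R K] [Algebra ℂ K] :
    AddSubgroup (TopForm K) :=
  AddSubgroup.closure {θ | ∃ (g : R) (f : Fin (Module.finrank K Ω[K⁄ℂ]) → R),
    θ = algebraMap R K g • dForm K fun i => algebraMap R K (f i)}

/-- The form `η` is a basis of the `R`-module of regular top forms. -/
def GeneratesRegularForms (R : Type) {K : Type} [CommRing R] [Field K] [Algebra R K]
    [Algebra ℂ K] (η : TopForm K) : Prop :=
  η ≠ 0 ∧ ∀ θ : TopForm K, θ ∈ regularTopForms R K ↔ ∃ g : R, θ = algebraMap R K g • η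

/-- `D` is a canonical divisor: the divisor of some nonzero rational top form `ω`.  At a point `z`
of codimension one, the multiplicity is the order of vanishing of `g`, where `ω = g • η` and
`η` is a generator of the regular top forms over the local ring at `z`. -/
def IsCanonicalDivisor {X : Scheme.{0}} [AlgebraicGeometry.IsIntegral X] [IsLocallyNoetherian X]
    (π : X ⟶ Spec (.of ℂ)) (D : X → ℤ) : Prop :=
  letI : Algebra ℂ X.functionField := (scalarHom π).toAlgebra
  ∃ ω : TopForm X.functionField, ω ≠ 0 ∧
    ∀ z : X, (Order.coheight z ≠ 1 → D z = 0) ∧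
      (Order.coheight z = 1 → ∃ (η : TopForm X.functionField) (g : X.functionField),
        GeneratesRegularForms (X.presheaf.stalk z) η ∧ ω = g • η ∧ D z = Scheme.ord g z)

/-- Gorenstein in the sense of toric geometry: a normal variety whose canonical divisor is
Cartier. -/
structure IsGorenstein {X : Scheme.{0}} [AlgebraicGeometry.IsIntegral X] [IsLocallyNoetherian X]
    (π : X ⟶ Spec (.of ℂ)) : Prop where
  normal : ∀ z : X, IsIntegrallyClosed (X.presheaf.stalk z)
  cartier : ∃ K : X → ℤ, IsCanonicalDivisor π K ∧ IsCartier X K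

/-! ## Toric GIT quotients

The torus with character lattice `L` acts on `ℂ^ι` with weights `D i`; the stability
condition is `w`.  The GIT quotient is `Proj ⨁ₙ ℂ[x_i]_{n w}`. -/

section GIT

variable {ι L : Type} [AddCommGroup L]

/-- Pairs `(u, n)` such that the monomial `x^u` has weight `n w`. -/
def semiInvariants (D : ι → L) (w : L) : AddSubmonoid ((ι →₀ ℕ) × ℕ) where
  carrier := {s | (s.1.sum fun i k => k • D i) = s.2 • w}
  zero_mem' := by simp
  add_mem' := by
    classical
    intro a b ha hb
    simp only [Set.mem_ofPred_eq, Prod.fst_add, Prod.snd_add] at *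
    rw [Finsupp.sum_add_index' (by simp) (by intros; rw [add_smul]), ha, hb, add_smul]

/-- The ring of semi-invariants, with basis the monomials `x^u` for `(u, n)` as above. -/
abbrev SectionRing (D : ι → L) (w : L) : Type := AddMonoidAlgebra ℂ (semiInvariants D w)

/-- The degree `(u, n) ↦ n`. -/
def degHom (D : ι → L) (w : L) : semiInvariants D w →+ ℕ :=
  (AddMonoidHom.snd (ι →₀ ℕ) ℕ).comp (semiInvariants D w).subtype

/-- The grading of the ring of semi-invariants whose `n`-th piece is `ℂ[x_i]_{n w}`. -/
abbrev grading (D : ι → L) (w : L) : ℕ → Submodule ℂ (SectionRing D w) :=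
  AddMonoidAlgebra.gradeBy ℂ (degHom D w)

/-- The GIT quotient of `ℂ^ι` with stability condition `w`. -/
def gitQuotient (D : ι → L) (w : L) : Scheme.{0} := Proj (grading D w)

/-- The structure morphism of the GIT quotient. -/
def gitQuotientToSpec (D : ι → L) (w : L) : gitQuotient D w ⟶ Spec (.of ℂ) :=
  Proj.toSpecZero (grading D w) ≫
    Spec.map (CommRingCat.ofHom (algebraMap ℂ (grading D w 0)))

/-- The closed subset `{x_i = 0}` of the GIT quotient: the points at which every monomial
divisible by `x_i` vanishes. -/
def coordZeroLocus (D : ι → L) (w : L) (i : ι) : Set (gitQuotient D w) :=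
  {z | ∀ s : semiInvariants D w, 0 < s.1.1 i →
    AddMonoidAlgebra.single s (1 : ℂ) ∈
      (show ProjectiveSpectrum (grading D w) from z).asHomogeneousIdeal}

open Classical in
/-- The toric prime divisor `{x_i = 0}`. -/
def coordDivisor (D : ι → L) (w : L) (i : ι) : gitQuotient D w → ℤ :=
  fun z => if Order.coheight z = 1 ∧ z ∈ coordZeroLocus D w i then 1 else 0

end GIT

/-! ## Quivers with dimension vector -/

/-- A quiver with vertices `0, …, ρ` where `ρ = m + 1`, with `n i j` arrows from `i` to `j`,
and a dimension vector `r`. -/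
structure DimQuiver where
  m : ℕ
  n : Fin (m + 2) → Fin (m + 2) → ℕ
  r : Fin (m + 2) → ℕ

namespace DimQuiver

/-- Vertices of the quiver. -/
abbrev Vtx (Q : DimQuiver) : Type := Fin (Q.m + 2)

/-- Non-source vertices of the quiver. -/
abbrev NonSource (Q : DimQuiver) : Type := {i : Q.Vtx // i ≠ 0}

/-- `s_i`, the sum of `r_{s(a)}` over the arrows `a` into `i`. -/
def s (Q : DimQuiver) (i : Q.Vtx) : ℕ := ∑ j, Q.n j i * Q.r j

/-- `s'_i`, the sum of `r_{t(a)}` over the arrows `a` out of `i`. -/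
def s' (Q : DimQuiver) (i : Q.Vtx) : ℕ := ∑ j, Q.n i j * Q.r j

/-- The coefficient of `c₁(W_i)` in the anticanonical class of the quiver flag variety. -/
def c (Q : DimQuiver) (i : Q.Vtx) : ℤ := (Q.s i : ℤ) - Q.s' i

/-- `s̃_i`, the number of paths from `0` to `i` (for an acyclic quiver numbered so that arrows
go from smaller to larger vertices). -/
def numPaths (Q : DimQuiver) (i : Q.Vtx) : ℕ :=
  if i = 0 then 1 else ∑ j : {j : Q.Vtx // j < i}, Q.n j.1 i * Q.numPaths j.1
termination_by i.1
decreasing_by exact j.2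

/-- The data define a quiver flag variety: the quiver is acyclic (with arrows from smaller to
larger vertices) with unique source `0`, `r_0 = 1`, and `0 < r_i < s_i` at the other vertices. -/
structure IsQuiverFlag (Q : DimQuiver) : Prop where
  acyclic : ∀ i j, j ≤ i → Q.n i j = 0
  source : ∀ j, j ≠ 0 → ∃ i, 0 < Q.n i j
  r_zero : Q.r 0 = 1
  r_pos : ∀ i, i ≠ 0 → 0 < Q.r i
  r_lt : ∀ i, i ≠ 0 → Q.r i < Q.s i

/-- Y-shaped: at most two arrows out of `1`, at most one arrow out of each other non-source
vertex, at most one arrow from a non-source vertex into any vertex, and a path from `1` to every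
non-source vertex. -/
structure IsYShaped (Q : DimQuiver) : Prop where
  out_one : ∑ j, Q.n 1 j ≤ 2
  out_other : ∀ i, i ≠ 0 → i ≠ 1 → ∑ j, Q.n i j ≤ 1
  into : ∀ j, ∑ i : Q.NonSource, Q.n i.1 j ≤ 1
  reach : ∀ j, j ≠ 0 → Relation.ReflTransGen (fun a b => 0 < Q.n a b) 1 j

/-- The quiver flag variety is Fano: its anticanonical class `∑ c_i c₁(W_i)` lies in the interior
of the positive orthant spanned by the `c₁(W_i)`, the nef cone of a Y-shaped quiver flag
variety. -/
def IsFano (Q : DimQuiver) : Prop := ∀ i, i ≠ 0 → 0 < Q.c i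

/-- `S` is the set of vertices (other than `1`) on the first of the two legs of the quiver: those
`i` for which the path from `1` to `i` contains a chosen arrow `1 → k` when there are two
arrows out of `1`, and the empty set if there is at most one. -/
def IsFirstLeg (Q : DimQuiver) (S : Set Q.Vtx) : Prop :=
  (∑ j, Q.n 1 j ≤ 1 ∧ S = ∅) ∨
  (∑ j, Q.n 1 j = 2 ∧ ∃ k, 0 < Q.n 1 k ∧
    S = {i | Relation.ReflTransGen (fun a b => 0 < Q.n a b) k i})

/-- The largest vertex with an arrow to `i`.  For a Y-shaped quiver this is the unique non-source
vertex with an arrow to `i` if `i ≠ 0, 1`, and it is `0` if `i = 1`. -/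
def pred (Q : DimQuiver) (i : Q.Vtx) : Q.Vtx := (Finset.univ.filter fun j => 0 < Q.n j i).sup id

/-- `w_i = s̃_i - r_i`; in particular `w_0 = 0`. -/
def w (Q : DimQuiver) (i : Q.Vtx) : ℤ := (Q.numPaths i : ℤ) - Q.r i

end DimQuiver

/-! ## Ladder diagrams -/

/-- A set of unit boxes in the plane (given by their lower left corners) and a set of marked
lattice points. -/
structure Diagram where
  box : Set (ℤ × ℤ)
  mark : Set (ℤ × ℤ)

namespace Diagram

/-- Image under the rotation `p ↦ q - p` by 180 degrees. -/
def rotate (D : Diagram) (q : ℤ × ℤ) : Diagram where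
  box := {b | q - b - (1, 1) ∈ D.box}
  mark := {p | q - p ∈ D.mark}

/-- The union of two diagrams. -/
def union (D E : Diagram) : Diagram where
  box := D.box ∪ E.box
  mark := D.mark ∪ E.mark

/-- A unit step to the right or upwards along a side of a box. -/
def Step (D : Diagram) (p q : ℤ × ℤ) : Prop :=
  (q = p + (1, 0) ∧ (p ∈ D.box ∨ p - (0, 1) ∈ D.box)) ∨
  (q = p + (0, 1) ∧ (p ∈ D.box ∨ p - (1, 0) ∈ D.box))

/-- The vertices of the quiver of a diagram are the marked points. -/
def Vertex (D : Diagram) : Type := {p : ℤ × ℤ // p ∈ D.mark}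

/-- The arrows of the quiver of a diagram are the lattice paths (with steps up or to the right)
between marked points that do not pass through another marked point; `l` lists the points strictly
between the end points. -/
instance (D : Diagram) : Quiver D.Vertex where
  Hom u v := {l : List (ℤ × ℤ) //
    (u.1 :: (l ++ [v.1])).IsChain D.Step ∧ ∀ p ∈ l, p ∉ D.mark}

/-- All arrows of the quiver of a diagram. -/
abbrev Arrow (D : Diagram) : Type := Quiver.Total D.Vertex

theorem Step.lt {D : Diagram} {p q : ℤ × ℤ} (h : D.Step p q) : p.1 + p.2 < q.1 + q.2 := by
  rcases h with ⟨rfl, _⟩ | ⟨rfl, _⟩ <;> simp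

theorem finite_arrow (D : Diagram) (hb : D.box.Finite) (hm : D.mark.Finite) :
    Finite D.Arrow := by
  classical
  set T : Set (ℤ × ℤ) := D.box ∪ ((fun b => b + (0, 1)) '' D.box ∪ (fun b => b + (1, 0)) '' D.box)
    with hT
  have hTf : T.Finite := hb.union ((hb.image _).union (hb.image _))
  have hstep : ∀ p q, D.Step p q → p ∈ T := by
    rintro p q (⟨-, h | h⟩ | ⟨-, h | h⟩)
    · exact Or.inl h
    · exact Or.inr (Or.inl ⟨_, h, by simp⟩)
    · exact Or.inl h
    · exact Or.inr (Or.inr ⟨_, h, by simp⟩)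
  have hmem : ∀ (l : List (ℤ × ℤ)) (v : ℤ × ℤ), (l ++ [v]).IsChain D.Step → ∀ p ∈ l, p ∈ T := by
    intro l v
    induction l with
    | nil => simp
    | cons a l ih =>
      intro h p hp
      rw [List.cons_append] at h
      rcases List.mem_cons.1 hp with rfl | hp
      · cases l with
        | nil => exact hstep _ _ (by simpa using h)
        | cons b l => exact hstep _ b (by simp at h; exact h.1)
      · exact ih h.tail p hp
  have := hTf.to_subtype
  have := Fintype.ofFinite T
  let LS : Set (List (ℤ × ℤ)) := (List.map Subtype.val) '' {l : List T | l.length ≤ Fintype.card T}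
  have hLS : LS.Finite := (List.finite_length_le T _).image _
  have hin : ∀ (u v : D.Vertex) (a : u ⟶ v), a.1 ∈ LS := by
    intro u v a
    have hch : (a.1 ++ [v.1]).IsChain D.Step := a.2.1.tail
    have hT' := hmem _ _ hch
    have hnd : a.1.Nodup := by
      have h2 : (a.1 ++ [v.1]).IsChain (fun p q : ℤ × ℤ => p.1 + p.2 < q.1 + q.2) :=
        hch.imp fun _ _ h => h.lt
      have : IsTrans (ℤ × ℤ) (fun p q : ℤ × ℤ => p.1 + p.2 < q.1 + q.2) :=
        ⟨fun _ _ _ => lt_trans⟩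
      have h3 := List.isChain_iff_pairwise.1 h2
      have h4 := (List.pairwise_append.1 h3).1
      exact h4.imp fun {p q} h e => by subst e; exact lt_irrefl _ h
    have hval : (a.1.attachWith (· ∈ T) hT').map Subtype.val = a.1 := by
      simp [List.attachWith, List.map_pmap]
    refine ⟨a.1.attachWith (· ∈ T) hT', ?_, hval⟩
    refine List.Nodup.length_le_card ?_
    exact List.Nodup.of_map Subtype.val (by rw [hval]; exact hnd)
  have : Finite D.Vertex := hm.to_subtype
  have := hLS.to_subtype
  refine Finite.of_injective
    (fun a : D.Arrow => ((a.left, a.right, (⟨a.hom.1, hin _ _ a.hom⟩ : LS)) :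
      D.Vertex × D.Vertex × LS)) ?_
  rintro ⟨u, v, a⟩ ⟨u', v', a'⟩ h
  simp only [Prod.mk.injEq, Subtype.mk.injEq] at h
  obtain ⟨rfl, rfl, h⟩ := h
  have : a = a' := Subtype.ext h
  rw [this]

end Diagram

namespace DimQuiver

/-- The block of the ladder diagram belonging to the vertex `i`: columns from `w_{pred i}` to
`w_i`, rows from `0` to `r_i`. -/
def block (Q : DimQuiver) (i : Q.Vtx) : Set (ℤ × ℤ) :=
  {b | Q.w (Q.pred i) ≤ b.1 ∧ b.1 < Q.w i ∧ 0 ≤ b.2 ∧ b.2 < Q.r i}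

/-- The ladder diagram of one leg, with (non-source) vertices `I`.  The marked points are the
origin, the interior lattice points, the external vertices `(w_i, r_i)`, and the intersection
points `(w_{pred i}, min(r_{pred i}, r_i))` of consecutive blocks. -/
def legDiagram (Q : DimQuiver) (I : Set Q.Vtx) : Diagram where
  box := {b | ∃ i ∈ I, b ∈ Q.block i}
  mark := {p | p = (0, 0) ∨
    (∀ e ∈ ({(0, 0), (1, 0), (0, 1), (1, 1)} : Set (ℤ × ℤ)), ∃ i ∈ I, p - e ∈ Q.block i) ∨
    (∃ i ∈ I, p = (Q.w i, (Q.r i : ℤ))) ∨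
    (∃ i ∈ I, i ≠ 1 ∧ p = (Q.w (Q.pred i), ((min (Q.r (Q.pred i)) (Q.r i) : ℕ) : ℤ)))}

/-- The ladder diagram of a Y-shaped quiver whose first leg consists of `1` and the vertices in
`S`: the union of the diagram of the second leg (`1` and the vertices not in `S`) and the rotated
diagram of the first leg, in which the origin goes to `(w_1, r_1)`. -/
def ladder (Q : DimQuiver) (S : Set Q.Vtx) : Diagram :=
  (Q.legDiagram {i | i ≠ 0 ∧ i ∉ S}).union
    ((Q.legDiagram (insert 1 S)).rotate (Q.w 1, Q.r 1))

theorem finite_block (Q : DimQuiver) (i : Q.Vtx) : (Q.block i).Finite := by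
  refine ((Set.finite_Ico (Q.w (Q.pred i)) (Q.w i)).prod
    (Set.finite_Ico (0 : ℤ) (Q.r i))).subset ?_
  rintro ⟨x, y⟩ ⟨h1, h2, h3, h4⟩
  exact ⟨⟨h1, h2⟩, ⟨h3, h4⟩⟩

theorem finite_box_legDiagram (Q : DimQuiver) (I : Set Q.Vtx) : (Q.legDiagram I).box.Finite := by
  refine (Set.finite_iUnion fun i => Q.finite_block i).subset ?_
  rintro b ⟨i, -, hb⟩
  exact Set.mem_iUnion.2 ⟨i, hb⟩

theorem finite_mark_legDiagram (Q : DimQuiver) (I : Set Q.Vtx) :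
    (Q.legDiagram I).mark.Finite := by
  refine (((Set.finite_singleton ((0, 0) : ℤ × ℤ)).union (Q.finite_box_legDiagram I)).union
    ((Set.finite_range fun i => (Q.w i, (Q.r i : ℤ))).union
    (Set.finite_range fun i =>
      (Q.w (Q.pred i), ((min (Q.r (Q.pred i)) (Q.r i) : ℕ) : ℤ))))).subset ?_
  rintro p (h | h | ⟨i, -, h⟩ | ⟨i, -, -, h⟩)
  · exact Or.inl (Or.inl h)
  · refine Or.inl (Or.inr ?_)
    have := h (0, 0) (by simp)
    rwa [show p - (0, 0) = p from sub_zero p] at this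
  · exact Or.inr (Or.inl ⟨i, h.symm⟩)
  · exact Or.inr (Or.inr ⟨i, h.symm⟩)

instance (Q : DimQuiver) (S : Set Q.Vtx) : Finite (Q.ladder S).Arrow := by
  refine Diagram.finite_arrow _ ?_ ?_
  · refine (Q.finite_box_legDiagram _).union ?_
    refine (Q.finite_box_legDiagram (insert 1 S)).preimage (f := fun b => _ - b - (1, 1)) ?_
    intro a _ b _ h
    simpa using h
  · refine (Q.finite_mark_legDiagram _).union ?_
    refine (Q.finite_mark_legDiagram (insert 1 S)).preimage (f := fun b => _ - b) ?_
    intro a _ b _ h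
    simpa using h

instance (Q : DimQuiver) (S : Set Q.Vtx) : Fintype (Q.ladder S).Arrow := Fintype.ofFinite _

/-! ## The ladder quiver, its toric variety, and the divisors of paths -/

/-- The source `O₂ = x₀ = (0, 0)` of the ladder quiver. -/
def O₂ (Q : DimQuiver) (S : Set Q.Vtx) : (Q.ladder S).Vertex := ⟨(0, 0), Or.inl (Or.inl rfl)⟩

/-- The vertex `O₁ = (w_1, r_1)`, the image of the origin of the rotated leg. -/
def O₁ (Q : DimQuiver) (S : Set Q.Vtx) : (Q.ladder S).Vertex :=
  ⟨(Q.w 1, Q.r 1), Or.inr (Or.inl (sub_self _))⟩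

open Classical in
/-- The external vertex `v_i`. -/
def ext (Q : DimQuiver) (S : Set Q.Vtx) (i : Q.NonSource) : (Q.ladder S).Vertex :=
  if h : i.1 ∈ S then
    ⟨(Q.w 1, (Q.r 1 : ℤ)) - (Q.w i.1, (Q.r i.1 : ℤ)),
      Or.inr (Or.inr (Or.inr (Or.inl ⟨i.1, Or.inr h, sub_sub_cancel _ _⟩)))⟩
  else ⟨(Q.w i.1, (Q.r i.1 : ℤ)), Or.inl (Or.inr (Or.inr (Or.inl ⟨i.1, ⟨i.2, h⟩, rfl⟩)))⟩

open Classical in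
/-- Start of the paths between `O_j` and `v_i`. Steps go up or to the right, so the paths on the
first (rotated) leg run from `v_i` to `O₁`. -/
def pathStart (Q : DimQuiver) (S : Set Q.Vtx) (i : Q.NonSource) : (Q.ladder S).Vertex :=
  if i.1 ∈ S then Q.ext S i else Q.O₂ S

open Classical in
/-- End of the paths between `O_j` and `v_i`. -/
def pathEnd (Q : DimQuiver) (S : Set Q.Vtx) (i : Q.NonSource) : (Q.ladder S).Vertex :=
  if i.1 ∈ S then Q.O₁ S else Q.ext S i

/-- Paths in the ladder quiver between `O_j` and `v_i`, where `i` lies on leg `j`. -/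
abbrev LadderPath (Q : DimQuiver) (S : Set Q.Vtx) (i : Q.NonSource) : Type :=
  Quiver.Path (Q.pathStart S i) (Q.pathEnd S i)

/-- The character lattice of the torus: one copy of `ℤ` for each vertex other than `x₀`. -/
abbrev CharLattice (Q : DimQuiver) (S : Set Q.Vtx) : Type :=
  {v : (Q.ladder S).Vertex // v ≠ Q.O₂ S} → ℤ

open Classical in
/-- The weight `e_{t(a)} - e_{s(a)}` of an arrow `a`, where `e_{x₀} = 0`. -/
def weight (Q : DimQuiver) (S : Set Q.Vtx) (a : (Q.ladder S).Arrow) : Q.CharLattice S :=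
  fun v => (if v.1 = a.right then 1 else 0) - (if v.1 = a.left then 1 else 0)

/-- The stability condition: the sum of all weights. -/
def stability (Q : DimQuiver) (S : Set Q.Vtx) : Q.CharLattice S := ∑ a, Q.weight S a

/-- The toric variety `X(Q)`. -/
def X (Q : DimQuiver) (S : Set Q.Vtx) : Scheme.{0} := gitQuotient (Q.weight S) (Q.stability S)

/-- The structure morphism of `X(Q)`. -/
def XToSpec (Q : DimQuiver) (S : Set Q.Vtx) : Q.X S ⟶ Spec (.of ℂ) :=
  gitQuotientToSpec (Q.weight S) (Q.stability S)

/-- The toric prime divisor `D_a = {x_a = 0}` of an arrow. -/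
def arrowDivisor (Q : DimQuiver) (S : Set Q.Vtx) (a : (Q.ladder S).Arrow) : Q.X S → ℤ :=
  coordDivisor (Q.weight S) (Q.stability S) a

/-- The divisor of a path: the sum of `D_a` over the arrows `a` of the path. -/
def pathDivisor (Q : DimQuiver) (S : Set Q.Vtx) {u : (Q.ladder S).Vertex} :
    {v : (Q.ladder S).Vertex} → Quiver.Path u v → Q.X S → ℤ
  | _, .nil => 0
  | _, .cons p a => Q.pathDivisor S p + Q.arrowDivisor S ⟨_, _, a⟩

end DimQuiver

end LadderToric

end

open AlgebraicGeometry CategoryTheory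

noncomputable section

namespace LadderToric

/-! ## Monomials of the ring of semi-invariants -/

section Monomials

variable {ι L : Type} [AddCommGroup L] [Fintype ι]

/-! The proof splits into toric geometry for an arbitrary list of weights, and the combinatorics of
planar flows for the ladder quiver.

Toric part. Let M be the lattice of relations m with `∑ m_a ω_a = 0`. Dividing a semi-invariant of
degree n by the n-th power of the product of all variables turns monomials into characters `χ^m`, so
the function field is the fraction field of `ℂ[M]`. The local ring at z is a localization of the
span of the `χ^m` with `m_a ≥ 0` for every variable vanishing at z (`exists_eq_div_coneRing`). Such
a cone ring is integrally closed, hence the quotient is normal (`isIntegrallyClosed_stalk`). Suppose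
the coordinates of M are pairwise distinct and each takes the value 1 on M. Then at most one
variable vanishes at a point of codimension one, and there `χ^m` has order `m_a`; so `div χ^m = ∑
m_a D_a` (`ord_chi`). Two consequences carry the theorem. The divisor of `χ^m` times the wedge of
logarithmic differentials is `∑ (m_a - 1) D_a` (`isCanonicalDivisor_of_mem`). And `∑ d_a D_a` is
Cartier as soon as, for every monomial of positive degree, some m in M agrees with d on the
variables that do not divide the monomial (`isCartier_of_forall_monomial`).

Combinatorial part. Every arrow contains exactly one essential unit step, one that lies on no other
arrow. A divergence-free function on unit steps therefore restricts to an element of M. Circulations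
around single boxes give enough of these to verify both assumptions on M (`exists_loop_ne`,
`IsEssential.exists_loop`). An explicit flow with value 1 on all essential steps (`Profile.flow`)
has divergence only at the external vertices and at `O₁`, `O₂`, with amounts determined by the
`c_i`. Hence the sum of all weights equals `∑ c_i (e_end - e_start)` over the paths defining the
`D_i` (`IsSplit.sum_arrow`). So `1 - ∑ c_i Π_i` lies in M, where `Π_i` counts arrows, and `-∑ c_i
D_i` is canonical.

For the Cartier property, the exponents of a monomial of degree n > 0 form a nonnegative flow with n
times this boundary. If its support contains a path with the same ends as the given one for each i
(`reach_path`), the difference of the two paths lies in M, and the second path uses only variables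
invertible where the monomial does not vanish. A cut argument using `c_i > 0` connects each start to
some admissible end, possibly on the wrong leg. In that case planarity helps: the path must cross
the flow path from `O₂` to `O₁`, and switching at the crossing corrects its end
(`IsGood.reach_of_crossing`). The flow equal to 1 on all arrows shows that the paths exist at all.
-/

/-- The sum of all weights, the anticanonical stability condition. -/
abbrev totalWeight (D : ι → L) : L := ∑ i, D i

/-- The lattice of linear relations between the weights: the characters of the big torus of the
GIT quotient. -/
def relLattice (D : ι → L) : Submodule ℤ (ι → ℤ) := LinearMap.ker (Fintype.linearCombination ℤ D)

theorem mem_relLattice {D : ι → L} {m : ι → ℤ} : m ∈ relLattice D ↔ ∑ i, m i • D i = 0 := by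
  simp [relLattice, Fintype.linearCombination_apply]

theorem mem_semiInvariants {D : ι → L} {w : L} {s : (ι →₀ ℕ) × ℕ} :
    s ∈ semiInvariants D w ↔ ∑ i, s.1 i • D i = s.2 • w := by
  change (s.1.sum fun i k => k • D i) = _ ↔ _
  rw [Finsupp.sum_fintype _ _ (by simp)]

variable (D : ι → L)

/-- The monoid of monomials that are semi-invariant for the anticanonical stability condition. -/
abbrev Mon : Type := semiInvariants D (totalWeight D)

/-- The ring of semi-invariants for the anticanonical stability condition. -/
abbrev SRing : Type := SectionRing D (totalWeight D)

/-- The grading of the ring of semi-invariants. -/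
abbrev SGr : ℕ → Submodule ℂ (SRing D) := grading D (totalWeight D)

/-- The coordinate ring of the big torus. -/
abbrev TorusRing : Type := AddMonoidAlgebra ℂ (relLattice D)

/-- The quotient of the monomial `x ^ u` of degree `n` by `(∏ x_i) ^ n`. -/
def toLattice : Mon D →+ relLattice D where
  toFun s := ⟨fun i => (s.1.1 i : ℤ) - s.1.2, by
    rw [mem_relLattice]
    have := mem_semiInvariants.1 s.2
    simp only [sub_smul, Finset.sum_sub_distrib, natCast_zsmul]
    rw [this, Finset.smul_sum, sub_self]⟩
  map_zero' := by ext; simp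
  map_add' a b := by ext; simp; ring

@[simp] theorem toLattice_apply (s : Mon D) (i : ι) :
    (toLattice D s).1 i = (s.1.1 i : ℤ) - s.1.2 := rfl

theorem toLattice_injOn {s t : Mon D} (h : toLattice D s = toLattice D t) (hd : s.1.2 = t.1.2) :
    s = t := by
  refine Subtype.ext (Prod.ext (Finsupp.ext fun i => ?_) hd)
  have := congrArg (fun m => m.1 i) h
  simp only [toLattice_apply, hd] at this
  omega

/-- The monomial of degree `n` that corresponds to `m`, if `- n ≤ m i` for all `i`. -/
def ofLattice (m : relLattice D) (n : ℕ) (h : ∀ i, -(n : ℤ) ≤ m.1 i) : Mon D :=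
  ⟨(Finsupp.equivFunOnFinite.symm fun i => (m.1 i + n).toNat, n), by
    rw [mem_semiInvariants, Finset.smul_sum]
    have := mem_relLattice.1 m.2
    have h2 : ∑ i, (m.1 i + n) • D i = ∑ i, n • D i := by
      simp [add_smul, Finset.sum_add_distrib, this]
    rw [← h2]
    refine Finset.sum_congr rfl fun i _ => ?_
    have := h i
    rw [← natCast_zsmul]
    simp
    rw [max_eq_left (by omega)]⟩

@[simp] theorem ofLattice_snd (m : relLattice D) (n : ℕ) (h) : (ofLattice D m n h).1.2 = n := rfl

theorem ofLattice_fst (m : relLattice D) (n : ℕ) (h) (i : ι) :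
    ((ofLattice D m n h).1.1 i : ℤ) = m.1 i + n := by
  have := h i
  simp [ofLattice]
  omega

@[simp] theorem toLattice_ofLattice (m : relLattice D) (n : ℕ) (h) :
    toLattice D (ofLattice D m n h) = m := by
  refine Subtype.ext (funext fun i => ?_)
  rw [toLattice_apply, ofLattice_fst, ofLattice_snd]
  ring

theorem exists_bound (m : relLattice D) : ∃ n : ℕ, ∀ i, -(n : ℤ) ≤ m.1 i := by
  refine ⟨∑ i, (m.1 i).natAbs, fun i => ?_⟩
  have := Finset.single_le_sum (f := fun i => (m.1 i).natAbs) (fun _ _ => Nat.zero_le _)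
    (Finset.mem_univ i)
  omega

/-- The product of all variables. -/
def prodVar : Mon D := ofLattice D 0 1 (by simp)

@[simp] theorem prodVar_fst (i : ι) : (prodVar D).1.1 i = 1 := by
  have := ofLattice_fst D 0 1 (by simp) i
  simp only [ZeroMemClass.coe_zero, Pi.zero_apply, zero_add, Nat.cast_one] at this
  exact_mod_cast this

@[simp] theorem prodVar_snd : (prodVar D).1.2 = 1 := rfl

/-- Unique sums, inherited from `ℕ^ι × ℕ`, exclude zero divisors in the monoid algebra. -/
instance : TwoUniqueSums (Mon D) :=
  TwoUniqueSums.of_injective_addHom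
    (AddHom.mk (fun m : Mon D => ((m.1.1 : ι → ℕ), m.1.2)) (fun _ _ => rfl))
    (fun a b h => by
      have h' := Prod.mk.injEq _ _ _ _ ▸ h
      exact Subtype.ext (Prod.ext (DFunLike.coe_injective h'.1) h'.2)) inferInstance

instance : IsDomain (SRing D) := NoZeroDivisors.to_isDomain _

/-- The weights live in a group, so the difference of two semi-invariant exponents is semi-invariant
whenever it is nonnegative. Submonoids of `ℕ^k` with this cancellation property are finitely
generated, by Dickson's lemma. This is the source of all Noetherian statements. -/
instance : AddMonoid.FG (Mon D) := by
  rw [AddMonoid.fg_iff_addSubmonoid_fg]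
  have e : (ι →₀ ℕ) × ℕ ≃+ (ι → ℕ) × ℕ :=
    AddEquiv.prodCongr (Finsupp.linearEquivFunOnFinite ℕ ℕ ι).toAddEquiv (AddEquiv.refl _)
  have := AddSubmonoid.fg_of_subtractive (M := (ι → ℕ) × ℕ)
    (P := (semiInvariants D (totalWeight D)).map e.toAddMonoidHom) ?_
  · exact this.map_injective e.toAddMonoidHom e.injective
  · rintro _ ⟨x, hx, rfl⟩ y ⟨z, hz, h⟩
    refine ⟨e.symm y, ?_, by simp⟩
    have hz' : z = x + e.symm y := e.injective (by simpa using h)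
    rw [hz'] at hz
    have hx' := mem_semiInvariants.1 hx
    have hz'' := mem_semiInvariants.1 hz
    refine mem_semiInvariants.2 ?_
    simp only [Prod.fst_add, Finsupp.add_apply, add_smul, Finset.sum_add_distrib, Prod.snd_add] at hz''
    rw [hx'] at hz''
    exact add_left_cancel hz''

instance : Algebra.FiniteType ℂ (SRing D) := inferInstance

instance : IsNoetherianRing (SRing D) := Algebra.FiniteType.isNoetherianRing ℂ _

instance : IsScalarTower ℂ (SGr D 0) (SRing D) := ⟨fun c x y => smul_mul_assoc c x.1 y⟩

instance : Algebra.FiniteType (SGr D 0) (SRing D) :=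
  Algebra.FiniteType.of_restrictScalars_finiteType ℂ _ _

/-- The ring homomorphism that sets the product of all variables to `1`. -/
def dehom : SRing D →+* TorusRing D := AddMonoidAlgebra.mapDomainRingHom ℂ (toLattice D)

@[simp] theorem dehom_single (s : Mon D) (r : ℂ) :
    dehom D (AddMonoidAlgebra.single s r) = AddMonoidAlgebra.single (toLattice D s) r := by
  simp [dehom]

end Monomials

/-! ## Points of the GIT quotient and its function field -/

section Points

variable {ι L : Type} [AddCommGroup L] [Fintype ι] (D : ι → L)

/-- The anticanonical GIT quotient. -/
abbrev GX : Scheme.{0} := gitQuotient D (totalWeight D)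

/-- The structure morphism of the anticanonical GIT quotient. -/
abbrev GXToSpec : GX D ⟶ Spec (.of ℂ) := gitQuotientToSpec D (totalWeight D)

variable {D} in
/-- A point of the quotient as a point of the projective spectrum. -/
def pt (z : GX D) : ProjectiveSpectrum (SGr D) := z

variable {D} in
/-- The homogeneous prime ideal of a point. -/
def ptIdeal (z : GX D) : Ideal (SRing D) := (pt z).asHomogeneousIdeal.toIdeal

instance (z : GX D) : (ptIdeal z).IsPrime := (pt z).isPrime

theorem specializes_iff (z w : GX D) : z ⤳ w ↔ ptIdeal z ≤ ptIdeal w := by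
  rw [specializes_iff_mem_closure]
  exact (ProjectiveSpectrum.le_iff_mem_closure _ _ _).symm

instance : IsLocallyNoetherian (GX D) :=
  have : IsLocallyNoetherian (Proj (SGr D)) :=
    LocallyOfFiniteType.isLocallyNoetherian (Proj.toSpecZero (SGr D))
  this

theorem single_mem_SGr {s : Mon D} {n : ℕ} (h : s.1.2 = n) (r : ℂ) :
    (AddMonoidAlgebra.single s r : SRing D) ∈ SGr D n := by
  subst h
  exact AddMonoidAlgebra.single_mem_gradeBy _ _ _

theorem mem_SGr {F : SRing D} {n : ℕ} : F ∈ SGr D n ↔ ∀ s, F.coeff s ≠ 0 → s.1.2 = n := by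
  simp only [SGr, grading, AddMonoidAlgebra.mem_gradeBy_iff, Set.subset_def]
  simp [degHom]

/-- Each stalk is a degree-zero part of a localization of the domain of semi-invariants. -/
instance : IsReduced (GX D) := by
  have : ∀ z : GX D, _root_.IsReduced ((GX D).presheaf.stalk z) := fun z => by
    have : NoZeroDivisors (HomogeneousLocalization.AtPrime (SGr D)
        (pt z).asHomogeneousIdeal.toIdeal) :=
      have : NoZeroDivisors (Localization.AtPrime (ptIdeal z)) := inferInstance
      (HomogeneousLocalization.val_injective _).noZeroDivisors _
        HomogeneousLocalization.val_zero HomogeneousLocalization.val_mul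
    have : _root_.IsReduced (HomogeneousLocalization.AtPrime (SGr D)
        (pt z).asHomogeneousIdeal.toIdeal) := inferInstance
    exact isReduced_of_injective (Proj.stalkIso' (SGr D) (pt z)).toRingHom
      (Proj.stalkIso' (SGr D) (pt z)).injective
  exact isReduced_of_isReduced_stalk _

open Classical in
/-- The ring homomorphism that sets the variables in `A` to zero. -/
def faceProj (A : Set ι) : SRing D →ₐ[ℂ] SRing D :=
  AddMonoidAlgebra.lift ℂ (SRing D) (Mon D)
    { toFun := fun s => if ∀ a ∈ A, (Multiplicative.toAdd s).1.1 a = 0 then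
        AddMonoidAlgebra.single (Multiplicative.toAdd s) 1 else 0
      map_one' := by
        rw [if_pos (by simp)]; rfl
      map_mul' := fun s t => by
        by_cases hs : ∀ a ∈ A, (Multiplicative.toAdd s).1.1 a = 0
        · by_cases ht : ∀ a ∈ A, (Multiplicative.toAdd t).1.1 a = 0
          · rw [if_pos hs, if_pos ht, if_pos, AddMonoidAlgebra.single_mul_single, one_mul]
            · rfl
            · intro a ha
              simp [hs a ha, ht a ha]
          · rw [if_neg ht, if_neg, mul_zero]
            intro h
            refine ht fun a ha => ?_
            have := h a ha
            simp at this
            exact this.2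
        · rw [if_neg hs, if_neg, zero_mul]
          intro h
          refine hs fun a ha => ?_
          have := h a ha
          simp at this
          exact this.1 }

open Classical in
theorem coeff_faceProj (A : Set ι) (F : SRing D) (s : Mon D) :
    (faceProj D A F).coeff s = if ∀ a ∈ A, s.1.1 a = 0 then F.coeff s else 0 := by
  induction F using AddMonoidAlgebra.induction_linear with
  | zero => simp
  | add f g hf hg =>
    rw [map_add, AddMonoidAlgebra.coeff_add, AddMonoidAlgebra.coeff_add, Finsupp.add_apply,
      Finsupp.add_apply, hf, hg]
    split_ifs <;> simp
  | single t r =>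
    rw [faceProj, AddMonoidAlgebra.lift_single]
    simp only [MonoidHom.coe_mk, OneHom.coe_mk, toAdd_ofAdd]
    by_cases h : s = t
    · subst h
      split_ifs <;> simp
    · split_ifs <;> simp [AddMonoidAlgebra.coeff_single, Ne.symm h]

/-- The homogeneous prime ideal spanned by the monomials divisible by a variable in `A`. -/
def faceIdeal (A : Set ι) : Ideal (SRing D) := RingHom.ker (faceProj D A)

theorem mem_faceIdeal {A : Set ι} {F : SRing D} :
    F ∈ faceIdeal D A ↔ ∀ s, F.coeff s ≠ 0 → ∃ a ∈ A, s.1.1 a ≠ 0 := by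
  classical
  rw [faceIdeal, RingHom.mem_ker, AddMonoidAlgebra.ext_iff]
  simp only [DFunLike.ext_iff, coeff_faceProj]
  refine forall_congr' fun s => ?_
  by_cases h : ∀ a ∈ A, s.1.1 a = 0
  · rw [if_pos h]
    constructor
    · intro h1 h2
      exact absurd h1 h2
    · intro h1
      by_contra h2
      obtain ⟨a, ha, h3⟩ := h1 h2
      exact h3 (h a ha)
  · rw [if_neg h]
    push Not at h
    exact iff_of_true rfl fun _ => h

instance (A : Set ι) : (faceIdeal D A).IsPrime := RingHom.ker_isPrime _

theorem faceIdeal_empty : faceIdeal D ∅ = ⊥ := by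
  ext F
  rw [mem_faceIdeal, Ideal.mem_bot, AddMonoidAlgebra.ext_iff]
  simp [DFunLike.ext_iff]

theorem coeff_decompose (F : SRing D) (n : ℕ) (s : Mon D) :
    ((DirectSum.decompose (SGr D) F n : SGr D n) : SRing D).coeff s =
      if s.1.2 = n then F.coeff s else 0 := by
  induction F using AddMonoidAlgebra.induction_linear with
  | zero => simp
  | add f g hf hg =>
    rw [DirectSum.decompose_add, DirectSum.add_apply, Submodule.coe_add,
      AddMonoidAlgebra.coeff_add, AddMonoidAlgebra.coeff_add, Finsupp.add_apply,
      Finsupp.add_apply, hf, hg]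
    split_ifs <;> simp
  | single t r =>
    classical
    by_cases ht : t.1.2 = n
    · rw [DirectSum.decompose_of_mem_same _ (single_mem_SGr D ht r)]
      by_cases h : s = t
      · subst h
        simp [ht]
      · simp [AddMonoidAlgebra.coeff_single, Ne.symm h]
    · rw [DirectSum.decompose_of_mem_ne _ (single_mem_SGr D rfl r) ht]
      by_cases h : s = t
      · subst h
        simp [ht]
      · simp [AddMonoidAlgebra.coeff_single, Ne.symm h]

theorem isHomogeneous_faceIdeal (A : Set ι) : (faceIdeal D A).IsHomogeneous (SGr D) := by
  intro n F hF
  rw [mem_faceIdeal] at hF ⊢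
  intro s hs
  rw [coeff_decompose] at hs
  split_ifs at hs with h
  · exact hF s hs
  · exact absurd rfl hs

/-- The generic point of the closed subset where the variables in `A` vanish. -/
def facePoint (A : Set ι) (h : ∃ s : Mon D, 0 < s.1.2 ∧ ∀ a ∈ A, s.1.1 a = 0) : GX D :=
  show ProjectiveSpectrum (SGr D) from
  ⟨⟨faceIdeal D A, isHomogeneous_faceIdeal D A⟩, inferInstanceAs (faceIdeal D A).IsPrime, by
    obtain ⟨s, hs, hA⟩ := h
    intro hle
    have h1 : (AddMonoidAlgebra.single s 1 : SRing D) ∈ faceIdeal D A :=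
      hle (HomogeneousIdeal.mem_irrelevant_of_mem (SGr D) hs (single_mem_SGr D rfl 1))
    obtain ⟨a, ha, h⟩ := (mem_faceIdeal D).1 h1 s (by simp)
    exact h (hA a ha)⟩

@[simp] theorem ptIdeal_facePoint (A : Set ι) (h) :
    ptIdeal (facePoint D A h) = faceIdeal D A := rfl

/-- The generic point of the quotient. -/
def etaPoint : GX D := facePoint D ∅ ⟨prodVar D, by simp, by simp⟩

theorem isGenericPoint_etaPoint : IsGenericPoint (etaPoint D) Set.univ := by
  rw [isGenericPoint_iff_specializes]
  intro z
  simp only [Set.mem_univ, iff_true]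
  rw [specializes_iff, etaPoint, ptIdeal_facePoint, faceIdeal_empty]
  exact bot_le

instance : IrreducibleSpace (GX D) := by
  have : Nonempty (GX D) := ⟨etaPoint D⟩
  have h := (isGenericPoint_etaPoint D).isIrreducible
  have : PreirreducibleSpace (GX D) := ⟨h.2⟩
  exact { toNonempty := ‹_› }

instance : AlgebraicGeometry.IsIntegral (GX D) := isIntegral_of_irreducibleSpace_of_isReduced _

theorem genericPoint_eq : genericPoint (GX D) = etaPoint D :=
  (genericPoint_spec (GX D)).eq (isGenericPoint_etaPoint D)

theorem ptIdeal_genericPoint : ptIdeal (genericPoint (GX D)) = ⊥ := by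
  rw [genericPoint_eq, etaPoint, ptIdeal_facePoint, faceIdeal_empty]

/-- Every point has a monomial of positive degree that does not vanish there. -/
theorem exists_monomial_notMem (z : GX D) :
    ∃ s : Mon D, 0 < s.1.2 ∧ (AddMonoidAlgebra.single s 1 : SRing D) ∉ ptIdeal z := by
  by_contra! h
  -- A prime containing all monomials of positive degree would contain the irrelevant ideal, since
  -- elements of that ideal have no monomial of degree zero.
  refine (pt z).not_irrelevant_le fun F hF => ?_
  change F ∈ ptIdeal z
  rw [← AddMonoidAlgebra.sum_coeff_single F]
  refine Ideal.sum_mem _ fun s hs => ?_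
  have hs' : F.coeff s ≠ 0 := by simpa using hs
  have h0 : 0 < s.1.2 := by
    rcases Nat.eq_zero_or_pos s.1.2 with h0 | h0
    · exfalso
      rw [HomogeneousIdeal.mem_irrelevant_iff, GradedRing.proj_apply] at hF
      have := coeff_decompose D F 0 s
      rw [hF, if_pos h0] at this
      exact hs' (by simpa using this.symm)
    · exact h0
  have := (ptIdeal z).mul_mem_left (AddMonoidAlgebra.single 0 (F.coeff s)) (h s h0)
  rwa [AddMonoidAlgebra.single_mul_single, zero_add, mul_one] at this

end Points

/-! ## Fractions of homogeneous elements as elements of the local rings -/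

section Fractions

variable {ι L : Type} [AddCommGroup L] [Fintype ι] {D : ι → L}

variable (D) in
/-- The local ring at a point as a homogeneous localization. -/
def stalkEquiv (z : GX D) :
    HomogeneousLocalization.AtPrime (SGr D) (pt z).asHomogeneousIdeal.toIdeal ≃+*
      (GX D).presheaf.stalk z :=
  (Proj.stalkIso' (SGr D) (pt z)).symm

/-- The element `F / G` of the local ring at `z`, for `F` and `G` of the same degree with `G` not
vanishing at `z`. -/
def fracAt (z : GX D) {n : ℕ} (F G : SGr D n) (h : (G : SRing D) ∉ ptIdeal z) :
    (GX D).presheaf.stalk z :=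
  stalkEquiv D z (HomogeneousLocalization.mk ⟨n, F, G, h⟩)

theorem exists_eq_fracAt (z : GX D) (x : (GX D).presheaf.stalk z) :
    ∃ (n : ℕ) (F G : SGr D n) (h : (G : SRing D) ∉ ptIdeal z), x = fracAt z F G h := by
  obtain ⟨c, hc⟩ := HomogeneousLocalization.mk_surjective ((stalkEquiv D z).symm x)
  refine ⟨c.deg, c.num, c.den, c.den_mem, ?_⟩
  exact ((RingEquiv.symm_apply_eq _).1 hc.symm)

theorem fracAt_eq (z : GX D) {n n' : ℕ} {F G : SGr D n} {F' G' : SGr D n'} {h h'}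
    (e : (F : SRing D) * G' = F' * G) : fracAt z F G h = fracAt z F' G' h' := by
  refine congrArg (stalkEquiv D z) ?_
  rw [HomogeneousLocalization.ext_iff_val, HomogeneousLocalization.val_mk,
    HomogeneousLocalization.val_mk, Localization.mk_eq_mk_iff, Localization.r_iff_exists]
  refine ⟨1, ?_⟩
  simp only [OneMemClass.coe_one, one_mul]
  rw [mul_comm, e, mul_comm]

theorem fracAt_mul (z : GX D) {n n' : ℕ} {F G : SGr D n} {F' G' : SGr D n'} {h h'} :
    fracAt z F G h * fracAt z F' G' h' =
      fracAt z (n := n + n') ⟨F * F', SetLike.mul_mem_graded F.2 F'.2⟩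
        ⟨G * G', SetLike.mul_mem_graded G.2 G'.2⟩ (fun h'' => ((ptIdeal z).primeCompl.mul_mem h h') h'') := by
  rw [fracAt, fracAt, ← map_mul, ← HomogeneousLocalization.mk_mul]
  rfl

theorem fracAt_add (z : GX D) {n : ℕ} {F F' G : SGr D n} {h} :
    fracAt z F G h + fracAt z F' G h = fracAt z (F + F') G h := by
  have : fracAt z (F + F') G h = fracAt z (n := n + n)
     ⟨G * F' + G * F, add_mem (SetLike.mul_mem_graded G.2 F'.2) (SetLike.mul_mem_graded G.2 F.2)⟩
     ⟨G * G, SetLike.mul_mem_graded G.2 G.2⟩ (fun h'' => ((ptIdeal z).primeCompl.mul_mem h h) h'') := by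
    apply fracAt_eq
    simp
    ring
  rw [this, fracAt, fracAt, ← map_add, ← HomogeneousLocalization.mk_add]
  refine congrArg (stalkEquiv D z) ?_
  rw [HomogeneousLocalization.ext_iff_val, HomogeneousLocalization.val_mk,
    HomogeneousLocalization.val_mk, Localization.mk_eq_mk_iff, Localization.r_iff_exists]
  refine ⟨1, ?_⟩
  simp

theorem fracAt_self (z : GX D) {n : ℕ} {G : SGr D n} {h} : fracAt z G G h = 1 := by
  refine (congrArg (stalkEquiv D z) ?_).trans (map_one _)
  rw [HomogeneousLocalization.ext_iff_val, HomogeneousLocalization.val_mk]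
  rw [HomogeneousLocalization.val_one]
  exact Localization.mk_self (⟨G, h⟩ : (ptIdeal z).primeCompl)

theorem fracAt_zero (z : GX D) {n : ℕ} {G : SGr D n} {h} : fracAt z 0 G h = 0 := by
  refine (congrArg (stalkEquiv D z) ?_).trans (map_zero _)
  exact HomogeneousLocalization.mk_eq_zero_of_num _ rfl

theorem fracAt_eq_zero_iff (z : GX D) {n : ℕ} {F G : SGr D n} {h} :
    fracAt z F G h = 0 ↔ F = 0 := by
  refine ⟨fun h0 => ?_, ?_⟩
  · rw [fracAt, map_eq_zero_iff _ (RingEquiv.injective _), HomogeneousLocalization.ext_iff_val,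
      HomogeneousLocalization.val_mk, HomogeneousLocalization.val_zero, Localization.mk_eq_mk', 
      IsLocalization.mk'_eq_zero_iff] at h0
    obtain ⟨m, hm⟩ := h0
    have : (m : SRing D) ≠ 0 := fun h0 => m.2 (h0 ▸ Ideal.zero_mem _)
    exact Subtype.ext ((mul_eq_zero.1 hm).resolve_left this)
  · rintro rfl
    exact fracAt_zero z

theorem isUnit_fracAt_iff (z : GX D) {n : ℕ} {F G : SGr D n} {h} :
    IsUnit (fracAt z F G h) ↔ (F : SRing D) ∉ ptIdeal z := by
  refine ⟨fun hu hF => ?_, fun hF => ?_⟩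
  · rw [fracAt] at hu
    have hu' : IsUnit (HomogeneousLocalization.mk (⟨n, F, G, h⟩ : 
      HomogeneousLocalization.NumDenSameDeg (SGr D) (pt z).asHomogeneousIdeal.toIdeal.primeCompl)) := by
      exact (MulEquiv.isUnit_map _).1 hu
    have hv := (HomogeneousLocalization.isUnit_iff_isUnit_val _ _ _).2 hu'
    rw [HomogeneousLocalization.val_mk, Localization.mk_eq_mk',
      IsLocalization.AtPrime.isUnit_mk'_iff] at hv
    exact hv hF
  · refine IsUnit.of_mul_eq_one (fracAt z G F hF) ?_
    rw [fracAt_mul]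
    rw [← fracAt_self z (h := (h : (G : SRing D) ∉ ptIdeal z))]
    apply fracAt_eq
    simp; ring

/-- The open set where `G` does not vanish. -/
def openOf (G : SRing D) : (GX D).Opens := Proj.basicOpen (SGr D) G

/-- The section `F / G` over the open set where `G` does not vanish. -/
def secOf {n : ℕ} (F G : SGr D n) : Γ(GX D, openOf (G : SRing D)) :=
  ⟨fun y => HomogeneousLocalization.mk ⟨n, F, G, y.2⟩, fun y =>
    ⟨ProjectiveSpectrum.basicOpen (SGr D) G, y.2,
      ⟨𝟙 _, ⟨n, ⟨F, G, _, fun _ => rfl⟩⟩⟩⟩⟩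

/-- As germs of a single section, the values of a fraction at different points are compatible with
specialization; this compares stalks with the function field. -/
theorem fracAt_eq_germ (z : GX D) {n : ℕ} (F G : SGr D n) (h) :
    fracAt z F G h = (GX D).presheaf.germ (openOf (G : SRing D)) z h (secOf F G) := rfl

theorem algebraMap_fracAt (z : GX D) {n : ℕ} (F G : SGr D n) (h) (h') :
    algebraMap ((GX D).presheaf.stalk z) (GX D).functionField (fracAt z F G h) =
      fracAt (genericPoint (GX D)) F G h' := by
  rw [fracAt_eq_germ, fracAt_eq_germ]
  exact TopCat.Presheaf.germ_stalkSpecializes_apply (GX D).presheaf _ _ _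

/-- The map from Proj to the spectrum of the degree-zero part goes through the identification of the
basic open set of 1 with the whole space. This computes the effect of that identification on global
sections. -/
theorem appTop_topIso_isoOfEq {X : Scheme.{0}} {U : X.Opens} (e : U = ⊤) :
    U.topIso.inv ≫ (X.isoOfEq e).inv.appTop ≫ X.topIso.inv.appTop =
      X.presheaf.map (eqToHom e.symm).op := by
  subst e
  have h : X.topIso.inv ≫ (⊤ : X.Opens).ι = 𝟙 _ := X.topIso.inv_hom_id
  have h2 : (⊤ : X.Opens).ι.appTop ≫ X.topIso.inv.appTop = 𝟙 _ := by
    rw [← Scheme.Hom.comp_appTop, h]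
    simp
  have h3 : (⊤ : X.Opens).topIso.inv = (⊤ : X.Opens).ι.appTop := rfl
  have h4 : (Iso.refl ((⊤ : X.Opens) : Scheme)).inv.appTop = 𝟙 _ := by simp
  rw [Scheme.isoOfEq_rfl, h3, h4, Category.id_comp, h2]
  simp

/-- The structure morphism is unwound on global sections until only the section `c / 1` is left;
from here on scalars are ordinary fractions of degree zero. -/
theorem scalarHom_eq (c : ℂ) (h : ((1 : SGr D 0) : SRing D) ∉ ptIdeal (genericPoint (GX D))) :
    scalarHom (GXToSpec D) c = fracAt (genericPoint (GX D)) (algebraMap ℂ (SGr D 0) c) 1 h := by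
  have key : (Scheme.ΓSpecIso (.of (SGr D 0))).inv ≫ (Proj.toSpecZero (SGr D)).appTop =
      CommRingCat.ofHom (HomogeneousLocalization.fromZeroRingHom (SGr D) _) ≫
        Proj.awayToSection (SGr D) 1 ≫
          (Proj (SGr D)).presheaf.map (eqToHom (Proj.basicOpen_one (SGr D)).symm).op := by
    rw [← appTop_topIso_isoOfEq (Proj.basicOpen_one (SGr D)), Proj.toSpecZero, Iso.inv_comp_eq]
    simp only [Scheme.Hom.comp_appTop]
    simp only [Category.assoc]
    rw [← Scheme.ΓSpecIso_naturality_assoc]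
    have h1 := congrArg (fun g => g ≫ (Scheme.isoOfEq (Proj (SGr D)) (Proj.basicOpen_one (SGr D))).inv.appTop ≫
      (Proj (SGr D)).topIso.inv.appTop) (Proj.basicOpenToSpec_app_top (SGr D) 1)
    simp only [Category.assoc] at h1
    exact congrArg (fun g => (Spec.map (CommRingCat.ofHom (HomogeneousLocalization.fromZeroRingHom (SGr D) (.powers 1)))).appTop ≫ g) h1
  have key2 : (Scheme.ΓSpecIso (.of ℂ)).inv ≫ (GXToSpec D).appTop =
      CommRingCat.ofHom (algebraMap ℂ (SGr D 0)) ≫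
      CommRingCat.ofHom (HomogeneousLocalization.fromZeroRingHom (SGr D) _) ≫
        Proj.awayToSection (SGr D) 1 ≫
          (Proj (SGr D)).presheaf.map (eqToHom (Proj.basicOpen_one (SGr D)).symm).op := by
    rw [← key, Scheme.ΓSpecIso_inv_naturality_assoc]
    rfl
  have e1 : scalarHom (GXToSpec D) c = (GX D).presheaf.germ ⊤ (genericPoint (GX D)) trivial
    (((Scheme.ΓSpecIso (.of ℂ)).inv ≫ (GXToSpec D).appTop).hom c) := rfl
  rw [e1, key2, fracAt_eq_germ]
  refine (TopCat.Presheaf.germ_res_apply (Proj (SGr D)).presheaf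
    (eqToHom (Proj.basicOpen_one (SGr D)).symm) (genericPoint (GX D)) trivial
    ((Proj.awayToSection (SGr D) 1).hom (HomogeneousLocalization.fromZeroRingHom (SGr D) _ (algebraMap ℂ (SGr D 0) c)))).trans ?_
  refine congrArg ((Proj (SGr D)).presheaf.germ (Proj.basicOpen (SGr D) 1) (genericPoint (GX D)) h) ?_
  refine Subtype.ext (funext fun y => ?_)
  rfl

end Fractions

/-! ## Characters as rational functions -/

section Characters

variable {ι L : Type} [AddCommGroup L] [Fintype ι] (D : ι → L)

/-- The function field of the GIT quotient. -/
abbrev KX : Type := (GX D).functionField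

variable {D}

theorem notMem_genericPoint {G : SRing D} (h : G ≠ 0) : G ∉ ptIdeal (genericPoint (GX D)) := by
  rwa [ptIdeal_genericPoint, Ideal.mem_bot]

/-- The fraction `F / G` as a rational function. -/
def ratFrac {n : ℕ} (F G : SGr D n) (h : (G : SRing D) ≠ 0) : KX D :=
  fracAt (genericPoint (GX D)) F G (notMem_genericPoint h)

theorem algebraMap_fracAt' (z : GX D) {n : ℕ} (F G : SGr D n) (h) :
    algebraMap ((GX D).presheaf.stalk z) (KX D) (fracAt z F G h) =
      ratFrac F G (fun h0 => h (h0 ▸ Ideal.zero_mem _)) :=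
  algebraMap_fracAt z F G h _

/-- A monomial as an element of a graded piece. -/
def monOf (s : Mon D) (n : ℕ) (h : s.1.2 = n) : SGr D n :=
  ⟨AddMonoidAlgebra.single s 1, single_mem_SGr D h 1⟩

@[simp] theorem coe_monOf (s : Mon D) (n : ℕ) (h) :
    (monOf s n h : SRing D) = AddMonoidAlgebra.single s 1 := rfl

theorem monOf_ne_zero (s : Mon D) (n : ℕ) (h) : (monOf s n h : SRing D) ≠ 0 := by
  simp

/-- The character `χ^m` as a rational function. -/
def chi (m : relLattice D) : KX D :=
  ratFrac (monOf (ofLattice D m (exists_bound D m).choose (exists_bound D m).choose_spec) _ (ofLattice_snd _ _ _ _))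
    (monOf (ofLattice D 0 (exists_bound D m).choose (by simp)) _ (ofLattice_snd _ _ _ _)) (monOf_ne_zero _ _ _)

/-- Frees `χ^m` from the bound chosen in its definition: any two monomials of equal degree whose
exponents differ by m represent it. -/
theorem ratFrac_monOf {m : relLattice D} {n : ℕ} {s t : Mon D} (hs : s.1.2 = n) (ht : t.1.2 = n)
    (h : toLattice D s = m + toLattice D t) :
    ratFrac (monOf s n hs) (monOf t n ht) (monOf_ne_zero _ _ _) = chi m := by
  refine fracAt_eq _ ?_
  simp only [coe_monOf, AddMonoidAlgebra.single_mul_single, one_mul]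
  refine congrArg (fun x => (AddMonoidAlgebra.single x 1 : SRing D)) (toLattice_injOn D ?_ ?_)
  · simp [h, toLattice_ofLattice]
  · simp [hs, ht, add_comm]

theorem ratFrac_mul {n n' : ℕ} {F G : SGr D n} {F' G' : SGr D n'} {h h'} :
    ratFrac F G h * ratFrac F' G' h' =
      ratFrac (n := n + n') ⟨(F : SRing D) * (F' : SRing D), SetLike.mul_mem_graded F.2 F'.2⟩
        ⟨(G : SRing D) * (G' : SRing D), SetLike.mul_mem_graded G.2 G'.2⟩ (mul_ne_zero h h') :=
  fracAt_mul _

theorem chi_add (m m' : relLattice D) : chi (m + m') = chi m * chi m' := by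
  obtain ⟨n, hn⟩ := exists_bound D m
  obtain ⟨n', hn'⟩ := exists_bound D m'
  rw [← ratFrac_monOf (m := m) (s := ofLattice D m n hn) (t := ofLattice D 0 n (by simp))
    (n := n) (ofLattice_snd _ _ _ _) (ofLattice_snd _ _ _ _) (by simp), ← ratFrac_monOf (m := m') (s := ofLattice D m' n' hn')
    (t := ofLattice D 0 n' (by simp)) (n := n') (ofLattice_snd _ _ _ _) (ofLattice_snd _ _ _ _) (by simp), ratFrac_mul,
    ← ratFrac_monOf (m := m + m') (n := n + n') (s := ofLattice D m n hn + ofLattice D m' n' hn')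
    (t := ofLattice D 0 n (by simp) + ofLattice D 0 n' (by simp)) (by simp) (by simp) (by simp)]
  refine fracAt_eq _ ?_
  simp only [coe_monOf, AddMonoidAlgebra.single_mul_single, one_mul]
  rfl

theorem chi_zero : chi (0 : relLattice D) = 1 := by
  rw [← ratFrac_monOf (m := (0 : relLattice D)) (s := 0) (t := 0) (n := 0) rfl rfl (by simp)]
  exact fracAt_self _

theorem chi_ne_zero (m : relLattice D) : chi m ≠ 0 := by
  intro h
  have := chi_add m (-m)
  rw [h, add_neg_cancel, chi_zero, zero_mul] at this
  exact one_ne_zero this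

theorem chi_neg (m : relLattice D) : chi (-m) = (chi m)⁻¹ := by
  refine eq_inv_of_mul_eq_one_left ?_
  rw [← chi_add, neg_add_cancel, chi_zero]

instance instAlgebraComplexKX : Algebra ℂ (KX D) := (scalarHom (GXToSpec D)).toAlgebra

/-- The embedding of the coordinate ring of the big torus into the function field. -/
def torusMap : TorusRing D →ₐ[ℂ] KX D :=
  AddMonoidAlgebra.lift ℂ (KX D) (relLattice D)
    { toFun := fun m => chi (Multiplicative.toAdd m)
      map_one' := chi_zero
      map_mul' := fun _ _ => chi_add _ _ }

theorem torusMap_single (m : relLattice D) (r : ℂ) :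
    torusMap (AddMonoidAlgebra.single m r) = algebraMap ℂ (KX D) r * chi m := by
  rw [torusMap, AddMonoidAlgebra.lift_single, Algebra.smul_def]
  rfl

theorem algebraMap_KX (r : ℂ) {n : ℕ} (G : SGr D n) (h) :
    algebraMap ℂ (KX D) r = ratFrac (r • G) G h := by
  refine (scalarHom_eq r (notMem_genericPoint (by simp))).trans ?_
  refine fracAt_eq _ ?_
  simp [Algebra.smul_def]

theorem ratFrac_add {n : ℕ} {F F' G : SGr D n} {h} :
    ratFrac (F + F') G h = ratFrac F G h + ratFrac F' G h := (fracAt_add _).symm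

theorem smul_ratFrac (r : ℂ) {n : ℕ} (F G : SGr D n) (h) :
    algebraMap ℂ (KX D) r * ratFrac F G h = ratFrac (r • F) G h := by
  rw [algebraMap_KX r G h, ratFrac_mul]
  refine fracAt_eq _ ?_
  simp only [Submodule.coe_smul, smul_mul_assoc]
  congr 1
  ring

/-- The denominator `(∏ x_i) ^ n`. -/
def prodPow (n : ℕ) : SGr D n := monOf (ofLattice D 0 n (by simp)) n (ofLattice_snd _ _ _ _)

theorem prodPow_ne_zero (n : ℕ) : ((prodPow n : SGr D n) : SRing D) ≠ 0 := monOf_ne_zero _ _ _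

/-- The dictionary between homogeneous fractions and Laurent polynomials. Both sides are additive
within a fixed degree, so it suffices to check monomials, and the induction runs over finite sets of
monomials of degree n so as not to leave that degree. -/
theorem torusMap_dehom {n : ℕ} (F : SGr D n) :
    torusMap (dehom D F) = ratFrac F (prodPow n) (prodPow_ne_zero n) := by
  obtain ⟨F, hF⟩ := F
  have key : ∀ T : Finset (Mon D), (∀ s ∈ T, s.1.2 = n) → ∀ c : Mon D → ℂ, ∀ h,
      torusMap (dehom D (∑ s ∈ T, AddMonoidAlgebra.single s (c s))) =
        ratFrac ⟨∑ s ∈ T, AddMonoidAlgebra.single s (c s), h⟩ (prodPow n) (prodPow_ne_zero n) := by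
    classical
    intro T
    induction T using Finset.induction_on with
    | empty =>
      intro _ c h
      simp only [Finset.sum_empty, map_zero]
      exact (fracAt_zero _).symm
    | insert s T hs ih =>
      intro hT c h
      have hT' : ∀ t ∈ T, t.1.2 = n := fun t ht => hT t (Finset.mem_insert_of_mem ht)
      have hm : ∑ s ∈ T, AddMonoidAlgebra.single s (c s) ∈ SGr D n :=
        Submodule.sum_mem _ fun t ht => single_mem_SGr D (hT' t ht) _
      have hs' : s.1.2 = n := hT s (Finset.mem_insert_self _ _)
      have e : (⟨∑ s ∈ insert s T, AddMonoidAlgebra.single s (c s), h⟩ : SGr D n) =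
          c s • monOf s n hs' + ⟨∑ s ∈ T, AddMonoidAlgebra.single s (c s), hm⟩ := by
        refine Subtype.ext ?_
        simp [Finset.sum_insert hs, AddMonoidAlgebra.smul_single]
      rw [e, ratFrac_add, Finset.sum_insert hs, map_add, map_add, ih hT' c hm, dehom_single,
        torusMap_single, ← smul_ratFrac]
      congr 2
      exact (ratFrac_monOf hs' (ofLattice_snd _ _ _ _) (by simp)).symm
  have h1 : ∑ s ∈ F.coeff.support, AddMonoidAlgebra.single s (F.coeff s) = F :=
    AddMonoidAlgebra.sum_coeff_single F
  have h2 := key F.coeff.support (fun s hs => (mem_SGr D).1 hF s (by simpa using hs)) F.coeff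
    (by rw [h1]; exact hF)
  simpa only [h1] using h2

@[simp] theorem dehom_prodPow (n : ℕ) : dehom D ((prodPow n : SGr D n) : SRing D) = 1 := by
  simp [prodPow, AddMonoidAlgebra.one_def]

/-- A sum is brought to a common degree by multiplying with powers of the product of all variables,
which dehomogenize to 1. -/
theorem exists_dehom_eq (a : TorusRing D) : ∃ (n : ℕ) (F : SGr D n), dehom D F = a := by
  induction a using AddMonoidAlgebra.induction_linear with
  | zero => exact ⟨0, 0, by simp⟩
  | add f g hf hg =>
    obtain ⟨n, F, rfl⟩ := hf
    obtain ⟨k, G, rfl⟩ := hg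
    refine ⟨n + k, ⟨(F : SRing D) * (prodPow k : SGr D k), SetLike.mul_mem_graded F.2 (prodPow k).2⟩ +
      ⟨((prodPow n : SGr D n) : SRing D) * (G : SRing D), SetLike.mul_mem_graded (prodPow n).2 G.2⟩, ?_⟩
    simp
  | single m r =>
    obtain ⟨n, hn⟩ := exists_bound D m
    refine ⟨n, r • monOf (ofLattice D m n hn) n (ofLattice_snd _ _ _ _), ?_⟩
    rw [Submodule.coe_smul, coe_monOf, AddMonoidAlgebra.smul_single, dehom_single]
    simp

/-- Every Laurent polynomial is a homogeneous F over a power of the product of the variables, and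
such a fraction vanishes only if F does. -/
theorem torusMap_injective : Function.Injective (torusMap (D := D)) := by
  rw [injective_iff_map_eq_zero]
  intro a ha
  obtain ⟨n, F, rfl⟩ := exists_dehom_eq a
  rw [torusMap_dehom] at ha
  rw [(fracAt_eq_zero_iff _).1 ha]
  simp

theorem ratFrac_eq_div {n : ℕ} (F G : SGr D n) (h) :
    ratFrac F G h = torusMap (dehom D F) / torusMap (dehom D G) := by
  have h0 : torusMap (dehom D G) ≠ 0 := by
    rw [torusMap_dehom]
    intro h1
    refine h ?_
    rw [(fracAt_eq_zero_iff _).1 h1]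
    rfl
  rw [eq_div_iff h0, torusMap_dehom, torusMap_dehom, ratFrac_mul]
  refine fracAt_eq _ ?_
  simp
  ring

theorem exists_eq_div (k : KX D) : ∃ a b : TorusRing D, b ≠ 0 ∧ k = torusMap a / torusMap b := by
  obtain ⟨n, F, G, h, rfl⟩ := exists_eq_fracAt _ k
  refine ⟨_, _, ?_, ratFrac_eq_div F G (fun h0 => h (h0 ▸ Ideal.zero_mem _))⟩
  intro h0
  have h1 := torusMap_dehom G
  rw [h0, map_zero] at h1
  have h2 := (fracAt_eq_zero_iff _).1 h1.symm
  rw [h2] at h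
  exact h (Ideal.zero_mem _)

/-- The subring of rational functions that are regular at `z`. -/
abbrev localSubring (z : GX D) : Subring (KX D) :=
  (algebraMap ((GX D).presheaf.stalk z) (KX D)).range

theorem mem_localSubring {z : GX D} {k : KX D} : k ∈ localSubring z ↔
    ∃ (n : ℕ) (F G : SGr D n), (G : SRing D) ∉ ptIdeal z ∧
      k = torusMap (dehom D F) / torusMap (dehom D G) := by
  constructor
  · rintro ⟨x, rfl⟩
    obtain ⟨n, F, G, h, rfl⟩ := exists_eq_fracAt _ x
    exact ⟨n, F, G, h, by rw [algebraMap_fracAt', ratFrac_eq_div]⟩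
  · rintro ⟨n, F, G, h, rfl⟩
    exact ⟨fracAt z F G h, by rw [algebraMap_fracAt', ratFrac_eq_div]⟩

instance : Algebra (TorusRing D) (KX D) := torusMap.toRingHom.toAlgebra

end Characters

/-! ## The polynomial ring of a basis of the character lattice -/

section PolyMap

variable {M σ : Type} [AddCommGroup M] [Fintype σ] (b : Module.Basis σ ℤ M)

/-- The exponent of a monomial as an element of the lattice with basis `b`. -/
def expMap : (σ →₀ ℕ) →+ M where
  toFun s := ∑ i, s i • b i
  map_zero' := by simp
  map_add' s t := by simp [add_smul, Finset.sum_add_distrib]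

theorem expMap_apply (s : σ →₀ ℕ) : expMap b s = ∑ i, s i • b i := rfl

theorem expMap_injective : Function.Injective (expMap b) := by
  classical
  intro s t h
  ext i
  have := congrArg (fun m => b.repr m i) h
  simp only [expMap_apply, map_sum, Finsupp.finsetSum_apply, ← natCast_zsmul, map_smul,
    b.repr_self, Finsupp.smul_apply, Finsupp.single_apply] at this
  simpa using this

/-- The polynomial ring on a basis of a lattice inside its group algebra. -/
def polyMap : MvPolynomial σ ℂ →ₐ[ℂ] AddMonoidAlgebra ℂ M :=
  MvPolynomial.aeval fun i => AddMonoidAlgebra.single (b i) 1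

omit [Fintype σ] in
theorem polyMap_X (i : σ) : polyMap b (MvPolynomial.X i) = AddMonoidAlgebra.single (b i) 1 := by
  simp [polyMap]

theorem polyMap_monomial (s : σ →₀ ℕ) (c : ℂ) :
    polyMap b (MvPolynomial.monomial s c) = AddMonoidAlgebra.single (expMap b s) c := by
  have h : ∀ (T : Finset σ), ∏ i ∈ T, (AddMonoidAlgebra.single (b i) (1 : ℂ)) ^ s i =
      AddMonoidAlgebra.single (∑ i ∈ T, s i • b i) 1 := by
    classical
    intro T
    induction T using Finset.induction_on with
    | empty => simp [AddMonoidAlgebra.one_def]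
    | insert i T hi ih =>
      rw [Finset.prod_insert hi, Finset.sum_insert hi, ih, AddMonoidAlgebra.single_pow,
        AddMonoidAlgebra.single_mul_single]
      simp
  rw [polyMap, MvPolynomial.aeval_monomial, Finsupp.prod_fintype _ _ (by simp), h, expMap_apply,
    ← Algebra.smul_def, AddMonoidAlgebra.smul_single]
  simp

theorem coeff_polyMap (p : MvPolynomial σ ℂ) (s : σ →₀ ℕ) :
    (polyMap b p).coeff (expMap b s) = p.coeff s := by
  classical
  induction p using MvPolynomial.induction_on' with
  | monomial t c =>
    rw [polyMap_monomial, MvPolynomial.coeff_monomial, AddMonoidAlgebra.coeff_single,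
      Finsupp.single_apply]
    simp [(expMap_injective b).eq_iff]
  | add p q hp hq => simp [hp, hq]

theorem polyMap_injective : Function.Injective (polyMap b) := by
  intro p q h
  ext s
  rw [← coeff_polyMap b, ← coeff_polyMap b, h]

/-- A high power of the product of the basis characters clears all negative exponents. -/
theorem exists_polyMap_eq (a : AddMonoidAlgebra ℂ M) : ∃ (N : ℕ) (p : MvPolynomial σ ℂ),
    polyMap b p = a * AddMonoidAlgebra.single (N • ∑ i, b i) 1 := by
  induction a using AddMonoidAlgebra.induction_linear with
  | zero => exact ⟨0, 0, by simp⟩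
  | add f g hf hg =>
    obtain ⟨n, p, hp⟩ := hf
    obtain ⟨k, q, hq⟩ := hg
    have h (n : ℕ) : polyMap b (MvPolynomial.monomial (Finsupp.equivFunOnFinite.symm fun _ => n) 1)
        = AddMonoidAlgebra.single (n • ∑ i, b i) 1 := by
      rw [polyMap_monomial, expMap_apply]
      simp [Finset.smul_sum]
    refine ⟨n + k, p * MvPolynomial.monomial (Finsupp.equivFunOnFinite.symm fun _ => k) 1 +
      q * MvPolynomial.monomial (Finsupp.equivFunOnFinite.symm fun _ => n) 1, ?_⟩
    rw [map_add, map_mul, map_mul, hp, hq, h, h, mul_assoc, mul_assoc,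
      AddMonoidAlgebra.single_mul_single, AddMonoidAlgebra.single_mul_single, add_mul, add_smul,
      add_comm (k • _)]
    simp
  | single m r =>
    refine ⟨∑ i, (b.repr m i).natAbs, MvPolynomial.monomial (Finsupp.equivFunOnFinite.symm fun i =>
      (b.repr m i + ∑ i, (b.repr m i).natAbs).toNat) r, ?_⟩
    rw [polyMap_monomial, AddMonoidAlgebra.single_mul_single, mul_one]
    congr 1
    have h (i) : ((b.repr m i + ∑ i, ((b.repr m i).natAbs : ℕ)).toNat : ℤ) =
        b.repr m i + ∑ i, ((b.repr m i).natAbs : ℕ) := by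
      have := Finset.single_le_sum (f := fun i => (b.repr m i).natAbs) (fun _ _ => Nat.zero_le _)
        (Finset.mem_univ i)
      push_cast at this ⊢
      zify at this
      rw [Int.toNat_of_nonneg]
      have := neg_abs_le (b.repr m i)
      omega
    refine Eq.trans ?_ (congrArg (· + _) (b.sum_repr m))
    rw [expMap_apply, Finset.smul_sum, ← Finset.sum_add_distrib]
    refine Finset.sum_congr rfl fun i _ => ?_
    rw [← natCast_zsmul, ← natCast_zsmul, ← add_smul]
    simp only [Finsupp.equivFunOnFinite_symm_apply_apply]
    rw [h]

/-- Laurent polynomials arise from the polynomial ring by inverting the product of the variables.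
Integral closedness is then inherited from a unique factorization domain. -/
theorem isLocalization_polyMap :
    letI := (polyMap b).toRingHom.toAlgebra
    IsLocalization (Submonoid.powers (∏ i, MvPolynomial.X i : MvPolynomial σ ℂ))
      (AddMonoidAlgebra ℂ M) := by
  let _ := (polyMap b).toRingHom.toAlgebra
  have hX (N : ℕ) : polyMap b ((∏ i, MvPolynomial.X i) ^ N) =
      AddMonoidAlgebra.single (N • ∑ i, b i) 1 := by
    have : (∏ i, MvPolynomial.X i : MvPolynomial σ ℂ) =
        MvPolynomial.monomial (Finsupp.equivFunOnFinite.symm fun _ => 1) 1 := by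
      rw [MvPolynomial.monomial_eq, Finsupp.prod_fintype _ _ (by simp)]
      simp
    rw [map_pow, this, polyMap_monomial, AddMonoidAlgebra.single_pow, expMap_apply]
    simp
  rw [isLocalization_iff]
  refine ⟨?_, ?_, ?_⟩
  · rintro ⟨_, N, rfl⟩
    refine IsUnit.of_mul_eq_one (AddMonoidAlgebra.single (-(N • ∑ i, b i)) (1 : ℂ)) ?_
    refine (congrArg (· * _) (hX N)).trans ?_
    simp [AddMonoidAlgebra.single_mul_single, AddMonoidAlgebra.one_def]
  · intro a
    obtain ⟨N, p, hp⟩ := exists_polyMap_eq b a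
    exact ⟨⟨p, ⟨_, N, rfl⟩⟩, (congrArg (a * ·) (hX N)).trans hp.symm⟩
  · intro p q h
    exact ⟨1, by rw [polyMap_injective b h]⟩

end PolyMap

/-! ### Local rings as localizations of cone rings, and normality -/

section Normal

variable {ι L : Type} [AddCommGroup L] [Fintype ι] {D : ι → L}

/-- A basis of the character lattice of the big torus. -/
abbrev latticeBasis (D : ι → L) :
    Module.Basis (Fin (Module.finrank ℤ (relLattice D))) ℤ (relLattice D) :=
  Module.finBasis ℤ (relLattice D)

/-- The function field as an algebra over the polynomial ring on a basis of characters. -/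
abbrev polyAlgebra {σ : Type} [Fintype σ] (b : Module.Basis σ ℤ (relLattice D)) :
    Algebra (MvPolynomial σ ℂ) (KX D) :=
  (torusMap.comp (polyMap b)).toRingHom.toAlgebra

theorem torusMap_single_one (m : relLattice D) :
    torusMap (AddMonoidAlgebra.single m 1) = chi m := by
  simp [torusMap_single]

/-- The function field is a rational function field; this serves both integral closedness and the
computation of differentials. -/
theorem isFractionRing_poly {σ : Type} [Fintype σ] (b : Module.Basis σ ℤ (relLattice D)) :
    letI := polyAlgebra b
    IsFractionRing (MvPolynomial σ ℂ) (KX D) := by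
  let _ := polyAlgebra b
  have : FaithfulSMul (MvPolynomial σ ℂ) (KX D) :=
    (faithfulSMul_iff_algebraMap_injective _ _).2 (torusMap_injective.comp (polyMap_injective b))
  refine IsFractionRing.of_field _ _ fun k => ?_
  obtain ⟨x, y, h0, rfl⟩ := exists_eq_div k
  obtain ⟨N, p, hp⟩ := exists_polyMap_eq b x
  obtain ⟨N', q, hq⟩ := exists_polyMap_eq b y
  obtain ⟨N1, p1, hp1⟩ := exists_polyMap_eq b (AddMonoidAlgebra.single (N' • ∑ i, b i) (1 : ℂ))
  -- The powers that clear x and y differ, so each polynomial is multiplied by the power used for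
  -- the other one.
  refine ⟨p * MvPolynomial.monomial (Finsupp.equivFunOnFinite.symm fun _ => N') 1,
    q * MvPolynomial.monomial (Finsupp.equivFunOnFinite.symm fun _ => N) 1, ?_⟩
  change _ = torusMap (polyMap b _) / torusMap (polyMap b _)
  have h (n : ℕ) : polyMap b (MvPolynomial.monomial (Finsupp.equivFunOnFinite.symm fun _ => n) 1)
      = AddMonoidAlgebra.single (n • ∑ i, b i) 1 := by
    rw [polyMap_monomial, expMap_apply]
    simp [Finset.smul_sum]
  simp only [map_mul, hp, hq, h, torusMap_single_one]
  have h1 : torusMap y ≠ 0 := fun h => h0 (torusMap_injective (h.trans (map_zero _).symm))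
  have h2 := chi_ne_zero (N • ∑ i, b i)
  have h3 := chi_ne_zero (N' • ∑ i, b i)
  field_simp

/-- Rational functions integral over the ring of the big torus are regular on it. -/
theorem exists_torusMap_of_isIntegral {k : KX D} (h : IsIntegral (TorusRing D) k) :
    ∃ a, torusMap a = k := by
  let b := latticeBasis D
  let _ : Algebra (MvPolynomial _ ℂ) (TorusRing D) := (polyMap b).toRingHom.toAlgebra
  let _ := polyAlgebra b
  have := isFractionRing_poly b
  have := isLocalization_polyMap b
  have : IsScalarTower (MvPolynomial (Fin (Module.finrank ℤ (relLattice D))) ℂ) (TorusRing D)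
      (KX D) := IsScalarTower.of_algebraMap_eq fun _ => rfl
  -- A power of the product of the variables makes k integral over the polynomial ring, which is
  -- integrally closed; that power is a unit on the torus and can be divided out again.
  obtain ⟨⟨_, N, rfl⟩, hm⟩ := h.exists_multiple_integral_of_isLocalization
    (Submonoid.powers (∏ i, MvPolynomial.X i :
      MvPolynomial (Fin (Module.finrank ℤ (relLattice D))) ℂ))
  obtain ⟨p, hp⟩ := IsIntegrallyClosed.isIntegral_iff.1 hm
  obtain ⟨u, hu⟩ := IsLocalization.map_units (TorusRing D) (⟨_, N, rfl⟩ :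
    Submonoid.powers (∏ i, MvPolynomial.X i :
      MvPolynomial (Fin (Module.finrank ℤ (relLattice D))) ℂ))
  have hu' : torusMap (u : TorusRing D) * k = torusMap (polyMap b p) := by
    rw [hu]
    refine Eq.trans ?_ hp.symm
    rw [Submonoid.smul_def, Algebra.smul_def]
    rfl
  refine ⟨↑(u⁻¹) * polyMap b p, ?_⟩
  rw [map_mul, ← hu', ← mul_assoc, ← map_mul, Units.inv_mul, map_one, one_mul]

/-- The variables that vanish at a point. -/
def zeroSet (z : GX D) : Set ι := {a | z ∈ coordZeroLocus D (totalWeight D) a}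

theorem mem_zeroSet {z : GX D} {a : ι} : a ∈ zeroSet z ↔
    ∀ s : Mon D, 0 < s.1.1 a → (AddMonoidAlgebra.single s 1 : SRing D) ∈ ptIdeal z := Iff.rfl

/-- There is a monomial of positive degree that does not vanish at `z` and is divisible by all
variables that do not vanish there. -/
theorem exists_monomial_zeroSet (z : GX D) :
    ∃ s : Mon D, 0 < s.1.2 ∧ (AddMonoidAlgebra.single s 1 : SRing D) ∉ ptIdeal z ∧
      ∀ a, s.1.1 a = 0 ↔ a ∈ zeroSet z := by
  classical
  -- For each variable in A, multiply by a monomial that is divisible by it and does not vanish at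
  -- z; the ideal is prime.
  have h1 : ∀ A : Finset ι, (∀ a ∈ A, a ∉ zeroSet z) → ∃ s : Mon D, 0 < s.1.2 ∧
      (AddMonoidAlgebra.single s 1 : SRing D) ∉ ptIdeal z ∧ ∀ a ∈ A, s.1.1 a ≠ 0 := by
    intro A
    induction A using Finset.induction_on with
    | empty =>
      intro _
      obtain ⟨s, h1, h2⟩ := exists_monomial_notMem D z
      exact ⟨s, h1, h2, by simp⟩
    | insert a A ha ih =>
      intro hA
      obtain ⟨s, h1, h2, h3⟩ := ih fun b hb => hA b (Finset.mem_insert_of_mem hb)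
      have h4 := hA a (Finset.mem_insert_self _ _)
      rw [mem_zeroSet] at h4
      push Not at h4
      obtain ⟨t, h5, h6⟩ := h4
      refine ⟨s + t, ?_, ?_, ?_⟩
      · change 0 < s.1.2 + t.1.2
        omega
      · have := (ptIdeal z).primeCompl.mul_mem h2 h6
        rwa [AddMonoidAlgebra.single_mul_single, one_mul] at this
      · intro b hb
        change s.1.1 b + t.1.1 b ≠ 0
        rcases Finset.mem_insert.1 hb with rfl | hb
        · omega
        · have := h3 b hb
          omega
  obtain ⟨s, h2, h3, h4⟩ := h1 (Finset.univ.filter (· ∉ zeroSet z)) (by simp)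
  refine ⟨s, h2, h3, fun a => ⟨fun h => ?_, fun h => ?_⟩⟩
  · by_contra h5
    exact h4 a (by simpa using h5) h
  · by_contra h5
    exact h3 (mem_zeroSet.1 h s (by omega))

/-- The subring of the torus ring spanned by the characters that are nonnegative on `A`. -/
def coneRing (A : Set ι) : Subring (TorusRing D) where
  carrier := {f | ∀ m, f.coeff m ≠ 0 → ∀ a ∈ A, 0 ≤ m.1 a}
  zero_mem' := by simp
  one_mem' := by
    classical
    intro m hm a _
    rw [AddMonoidAlgebra.one_def, AddMonoidAlgebra.coeff_single, Finsupp.single_apply] at hm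
    split_ifs at hm with h
    · simp [← h]
    · exact absurd rfl hm
  add_mem' := by
    intro f g hf hg m hm a ha
    by_cases h : f.coeff m = 0
    · refine hg m (fun h' => hm ?_) a ha
      simp [h, h']
    · exact hf m h a ha
  neg_mem' := by
    intro f hf m hm a ha
    exact hf m (by simpa using hm) a ha
  mul_mem' := by
    classical
    intro f g hf hg m hm a ha
    obtain ⟨m1, h1, m2, h2, rfl⟩ := Finset.mem_add.1
      (AddMonoidAlgebra.support_coeff_mul_subset f g (Finsupp.mem_support_iff.2 hm))
    exact add_nonneg (hf m1 (Finsupp.mem_support_iff.1 h1) a ha)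
      (hg m2 (Finsupp.mem_support_iff.1 h2) a ha)

theorem single_mem_coneRing {A : Set ι} {m : relLattice D} {c : ℂ} (h : ∀ a ∈ A, 0 ≤ m.1 a) :
    AddMonoidAlgebra.single m c ∈ coneRing A := by
  classical
  intro m' hm' a ha
  rw [AddMonoidAlgebra.coeff_single, Finsupp.single_apply] at hm'
  split_ifs at hm' with h1
  · exact h1 ▸ h a ha
  · exact absurd rfl hm'

theorem torusMap_dehom_ne_zero {n : ℕ} {G : SGr D n} (h : (G : SRing D) ≠ 0) :
    torusMap (dehom D G) ≠ 0 := by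
  rw [torusMap_dehom]
  intro h1
  exact h (congrArg Subtype.val ((fracAt_eq_zero_iff _).1 h1))

open Polynomial in
/-- The homomorphism `χ^m ↦ χ^m T^{m a}`. -/
def ordMap (a : ι) : TorusRing D →+* FractionRing (KX D)[X] :=
  AddMonoidAlgebra.liftNCRingHom
    (((algebraMap (KX D)[X] (FractionRing (KX D)[X])).comp C).comp (algebraMap ℂ (KX D)))
    { toFun := fun m => algebraMap (KX D)[X] _ (C (chi (Multiplicative.toAdd m))) *
        (algebraMap (KX D)[X] (FractionRing (KX D)[X]) X) ^ ((Multiplicative.toAdd m).1 a)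
      map_one' := by simp [chi_zero]
      map_mul' := fun m m' => by
        have : algebraMap (KX D)[X] (FractionRing (KX D)[X]) X ≠ 0 := by simp
        simp only [toAdd_mul, chi_add, map_mul, Submodule.coe_add, Pi.add_apply, zpow_add₀ this]
        ring }
    (fun _ _ => Commute.all _ _)

open Polynomial in
theorem ordMap_single (a : ι) (m : relLattice D) (r : ℂ) :
    ordMap a (AddMonoidAlgebra.single m r) =
      algebraMap (KX D)[X] _ (C (torusMap (AddMonoidAlgebra.single m r))) *
        (algebraMap (KX D)[X] (FractionRing (KX D)[X]) X) ^ (m.1 a) := by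
  simp only [ordMap, AddMonoidAlgebra.liftNCRingHom, torusMap_single]
  simp [AddMonoidAlgebra.liftNC_single, mul_assoc]

open Polynomial in
-- Since f is a finite sum, a shift by `T^N` turns its image into an honest polynomial in T, whose
-- coefficients collect the terms of f with equal `m a`.
theorem ordMap_mul_pow (a : ι) (f : TorusRing D) (N : ℕ)
    (hN : ∀ m, f.coeff m ≠ 0 → -(N : ℤ) ≤ m.1 a) :
    ordMap a f * (algebraMap (KX D)[X] (FractionRing (KX D)[X]) X) ^ N =
      algebraMap (KX D)[X] _ (∑ m ∈ f.coeff.support,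
        C (torusMap (AddMonoidAlgebra.single m (f.coeff m))) * X ^ (m.1 a + N).toNat) := by
  conv_lhs => rw [← AddMonoidAlgebra.sum_coeff_single f, Finsupp.sum]
  rw [map_sum, map_sum, Finset.sum_mul]
  refine Finset.sum_congr rfl fun m hm => ?_
  have h := hN m (by simpa using hm)
  have : algebraMap (KX D)[X] (FractionRing (KX D)[X]) X ≠ 0 := by simp
  rw [ordMap_single, map_mul, map_pow, mul_assoc]
  congr 1
  rw [← zpow_natCast, ← zpow_natCast, ← zpow_add₀ this]
  congr 1
  omega

open Polynomial in
-- Grade by one coordinate a in A. The cone ring is sent into `K[T]`, which is integrally closed in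
-- its fraction field, so the image of f is a polynomial in T. Its coefficient at a negative power,
-- the part of f with that value of `m a`, must therefore be zero.
theorem isIntegral_mem_coneRing {A : Set ι} {f : TorusRing D}
    (h : IsIntegral (coneRing (D := D) A) f) : f ∈ coneRing A := by
  classical
  have bound (f : TorusRing D) (a : ι) : ∃ N : ℕ, ∀ m, f.coeff m ≠ 0 → -(N : ℤ) ≤ m.1 a := by
    refine ⟨∑ m ∈ f.coeff.support, (m.1 a).natAbs, fun m hm => ?_⟩
    have := Finset.single_le_sum (f := fun m : relLattice D => (m.1 a).natAbs)
      (fun _ _ => Nat.zero_le _) (Finsupp.mem_support_iff.2 hm)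
    omega
  intro m0 hm0 a ha
  by_contra hneg
  have h1 : IsIntegral (KX D)[X] (ordMap a f) := by
    -- No shift is needed here: elements of the cone ring have only nonnegative powers of T.
    have hr : ∀ g : coneRing (D := D) A, ∃ p : (KX D)[X], algebraMap _ _ p = ordMap a g.1 := by
      intro g
      have := ordMap_mul_pow a g.1 0 (fun m hm => by simpa using g.2 m hm a ha)
      exact ⟨_, by rw [← this, pow_zero, mul_one]⟩
    let e : (KX D)[X] ≃+* (algebraMap (KX D)[X] (FractionRing (KX D)[X])).range :=
      RingEquiv.ofBijective (algebraMap (KX D)[X] (FractionRing (KX D)[X])).rangeRestrict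
        ⟨fun p q h => IsFractionRing.injective _ _ (congrArg Subtype.val h),
          RingHom.rangeRestrict_surjective _⟩
    let φ : coneRing (D := D) A →+* (KX D)[X] :=
      e.symm.toRingHom.comp (((ordMap a).comp (coneRing A).subtype).codRestrict _ hr)
    refine IsIntegral.map_of_comp_eq φ (ordMap a) (RingHom.ext fun g => ?_) h
    exact congrArg Subtype.val (e.apply_symm_apply _)
  obtain ⟨p, hp⟩ := IsIntegrallyClosed.isIntegral_iff.1 h1
  obtain ⟨N, hN⟩ := bound f a
  have h3 := ordMap_mul_pow a f N hN
  rw [← hp, ← map_pow, ← map_mul] at h3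
  have h4 := congrArg (fun q => coeff q (m0.1 a + N).toNat) (IsFractionRing.injective _ _ h3)
  have h5 := hN m0 hm0
  simp only [finsetSum_coeff, coeff_C_mul, coeff_X_pow] at h4
  -- The exponent `m0 a + N` is smaller than N because `m0 a < 0`, so the coefficient of `p T^N`
  -- there is zero.
  rw [coeff_mul_X_pow', if_neg (by omega)] at h4
  have h6 : ∑ m ∈ f.coeff.support, torusMap (AddMonoidAlgebra.single m (f.coeff m)) *
      (if (m0.1 a + N).toNat = (m.1 a + N).toNat then 1 else 0) =
      torusMap (∑ m ∈ f.coeff.support with m0.1 a = m.1 a,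
        AddMonoidAlgebra.single m (f.coeff m)) := by
    rw [map_sum, Finset.sum_filter]
    refine Finset.sum_congr rfl fun m hm => ?_
    have := hN m (by simpa using hm)
    by_cases h7 : m0.1 a = m.1 a
    · rw [if_pos h7, h7]; simp
    · rw [if_neg h7, if_neg (by omega), mul_zero]
  rw [h6] at h4
  have h7 := torusMap_injective (h4.symm.trans (map_zero _).symm)
  have h8 := congrArg (fun q => AddMonoidAlgebra.coeff q m0) h7
  simp [AddMonoidAlgebra.coeff_single, Finsupp.single_apply] at h8
  exact hm0 h8

/-- Let s be a monomial nonvanishing at z and divisible by every variable nonvanishing there. For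
large k the product of `χ^m` and `s^k` has no negative exponents: k compensates m off the zero set,
and the hypothesis covers the rest. This exhibits `χ^m` as a fraction with denominator `s^k`. -/
theorem chi_mem_localSubring {z : GX D} {m : relLattice D} (h : ∀ a ∈ zeroSet z, 0 ≤ m.1 a) :
    chi m ∈ localSubring z := by
  obtain ⟨s, h1, h2, h3⟩ := exists_monomial_zeroSet z
  obtain ⟨k, hk⟩ := exists_bound D m
  have hb : ∀ a, -((k * s.1.2 : ℕ) : ℤ) ≤ (m + toLattice D (k • s)).1 a := by
    intro a
    have e1 : (k • s).1.1 a = k * s.1.1 a := by simp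
    have e2 : (k • s).1.2 = k * s.1.2 := by simp
    rw [Submodule.coe_add, Pi.add_apply, toLattice_apply, e1, e2]
    have h4 : 0 ≤ m.1 a + k * (s.1.1 a : ℤ) := by
      by_cases ha : a ∈ zeroSet z
      · rw [(h3 a).2 ha]
        simpa using h a ha
      · have h5 := hk a
        have h6 : 1 ≤ (s.1.1 a : ℤ) := by
          have := mt (h3 a).1 ha
          omega
        nlinarith
    push_cast
    nlinarith
  have h5 : (k • s).1.2 = k * s.1.2 := by simp
  refine mem_localSubring.2 ⟨k * s.1.2, monOf (ofLattice D _ _ hb) _ (ofLattice_snd _ _ _ _),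
    monOf (k • s) _ h5, ?_, ?_⟩
  · have := (ptIdeal z).primeCompl.pow_mem h2 k
    rwa [AddMonoidAlgebra.single_pow, one_pow] at this
  · rw [← ratFrac_eq_div _ _ (monOf_ne_zero _ _ _),
      ratFrac_monOf (m := m) (ofLattice_snd _ _ _ _) h5 (by simp)]

theorem torusMap_mem_localSubring {z : GX D} {f : TorusRing D} (h : f ∈ coneRing (zeroSet z)) :
    torusMap f ∈ localSubring z := by
  rw [← AddMonoidAlgebra.sum_coeff_single f, Finsupp.sum, map_sum]
  refine Subring.sum_mem _ fun m hm => ?_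
  rw [torusMap_single]
  refine Subring.mul_mem _ ?_ (chi_mem_localSubring (h m (by simpa using hm)))
  refine mem_localSubring.2 ⟨0, f.coeff m • 1, 1, ?_, ?_⟩
  swap
  · exact (algebraMap_KX (f.coeff m) (n := 0) 1 (one_ne_zero (α := SRing D))).trans
      (ratFrac_eq_div _ _ _)
  exact fun h => (inferInstance : (ptIdeal z).IsPrime).ne_top ((Ideal.eq_top_iff_one _).2 h)

/-- Raise a fraction `F / G` to a degree in which a power of a nonvanishing monomial s exists, then
divide both parts by that power. As s contains no variable vanishing at z, the quotients lie in the
cone ring, and the new denominator is a unit at z. -/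
theorem exists_eq_div_coneRing {z : GX D} {k : KX D} (h : k ∈ localSubring z) :
    ∃ f ∈ coneRing (D := D) (zeroSet z), ∃ g ∈ coneRing (zeroSet z), torusMap g ≠ 0 ∧
      (torusMap g)⁻¹ ∈ localSubring z ∧ k = torusMap f / torusMap g := by
  obtain ⟨n, F, G, hG, rfl⟩ := mem_localSubring.1 h
  obtain ⟨s, h1, h2, h3⟩ := exists_monomial_zeroSet z
  -- With s of degree `n0 + 1`, the elements `F G^n0`, `G^(n0 + 1)` and `s^n` all have degree `n (n0
  -- + 1)`.
  obtain ⟨n0, hn0⟩ : ∃ n0, s.1.2 = n0 + 1 := ⟨s.1.2 - 1, by omega⟩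
  have hG0 : (G : SRing D) ≠ 0 := fun h0 => hG (h0 ▸ Ideal.zero_mem _)
  have hs : (n • s).1.2 = n * (n0 + 1) := by simp [hn0]
  have hsz : (AddMonoidAlgebra.single (n • s) 1 : SRing D) ∉ ptIdeal z := by
    have := (ptIdeal z).primeCompl.pow_mem h2 n
    rwa [AddMonoidAlgebra.single_pow, one_pow] at this
  have key : ∀ H ∈ SGr D (n * (n0 + 1)),
      dehom D H * AddMonoidAlgebra.single (-toLattice D (n • s)) 1 ∈ coneRing (zeroSet z) := by
    intro H hH
    rw [← AddMonoidAlgebra.sum_coeff_single H, Finsupp.sum, map_sum, Finset.sum_mul]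
    refine Subring.sum_mem _ fun u hu => ?_
    rw [dehom_single, AddMonoidAlgebra.single_mul_single]
    refine single_mem_coneRing fun a ha => ?_
    have e1 : (n • s).1.1 a = n * s.1.1 a := by simp
    have e2 := (mem_SGr D).1 hH u (by simpa using hu)
    rw [Submodule.coe_add, Pi.add_apply, Submodule.coe_neg, Pi.neg_apply, toLattice_apply,
      toLattice_apply, e1, hs, e2, (h3 a).2 ha]
    simp
  have hG1 : (G : SRing D) ^ (n0 + 1) ∈ SGr D (n * (n0 + 1)) := by
    have := SetLike.pow_mem_graded (n0 + 1) G.2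
    rwa [smul_eq_mul, mul_comm] at this
  have hF1 : (F : SRing D) * (G : SRing D) ^ n0 ∈ SGr D (n * (n0 + 1)) := by
    have := SetLike.mul_mem_graded F.2 (SetLike.pow_mem_graded n0 G.2)
    rwa [smul_eq_mul, mul_comm n0, add_comm, ← Nat.mul_succ] at this
  have hd : torusMap (dehom D G) ≠ 0 := torusMap_dehom_ne_zero hG0
  have hc := chi_ne_zero (-toLattice D (n • s))
  refine ⟨_, key _ hF1, _, key _ hG1, ?_, ?_, ?_⟩
  · rw [map_mul, map_pow, map_pow, torusMap_single_one]
    exact mul_ne_zero (pow_ne_zero _ hd) hc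
  · refine mem_localSubring.2 ⟨n * (n0 + 1), monOf (n • s) _ hs, ⟨_, hG1⟩, ?_, ?_⟩
    · exact (ptIdeal z).primeCompl.pow_mem hG _
    · rw [map_mul, torusMap_single_one, chi_neg, mul_inv, inv_inv, coe_monOf, dehom_single,
        torusMap_single_one, div_eq_mul_inv, mul_comm]
  · simp only [map_mul, map_pow, torusMap_single_one]
    field_simp
    ring

/-- The stalk is the localization of the cone ring at the elements W that become units. An integral
element times some g in W is integral over the cone ring; it is regular on the torus because `ℂ[M]`
is integrally closed, and then lies in the cone ring. -/
theorem isIntegrallyClosed_stalk (z : GX D) :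
    IsIntegrallyClosed ((GX D).presheaf.stalk z) := by
  rw [isIntegrallyClosed_iff (KX D)]
  intro k hk
  let A := coneRing (D := D) (zeroSet z)
  let R := localSubring z
  have hle : ∀ f : A, (torusMap.toRingHom.comp A.subtype) f ∈ R :=
    fun f => torusMap_mem_localSubring f.2
  let _ : Algebra A R := ((torusMap.toRingHom.comp A.subtype).codRestrict R hle).toAlgebra
  let _ : Algebra A (KX D) := (torusMap.toRingHom.comp A.subtype).toAlgebra
  have : IsScalarTower A R (KX D) := IsScalarTower.of_algebraMap_eq fun _ => rfl
  have : IsScalarTower A (TorusRing D) (KX D) := IsScalarTower.of_algebraMap_eq fun _ => rfl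
  let W : Submonoid A :=
    { carrier := {g | torusMap g.1 ≠ 0 ∧ (torusMap g.1)⁻¹ ∈ R}
      one_mem' := by simp [R.one_mem]
      mul_mem' := by
        rintro g g' ⟨h1, h2⟩ ⟨h3, h4⟩
        refine ⟨by simpa using ⟨h1, h3⟩, ?_⟩
        simpa [mul_comm] using R.mul_mem h2 h4 }
  have : IsLocalization W R := by
    rw [isLocalization_iff]
    refine ⟨?_, ?_, ?_⟩
    · rintro ⟨g, h1, h2⟩
      exact IsUnit.of_mul_eq_one ⟨_, h2⟩ (Subtype.ext (mul_inv_cancel₀ h1))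
    · rintro ⟨k, hk⟩
      obtain ⟨f, hf, g, hg, h0, h1, rfl⟩ := exists_eq_div_coneRing hk
      exact ⟨⟨⟨f, hf⟩, ⟨⟨g, hg⟩, h0, h1⟩⟩, Subtype.ext (div_mul_cancel₀ _ h0)⟩
    · intro f g h
      exact ⟨1, congrArg (1 * ·) (Subtype.ext (torusMap_injective (congrArg Subtype.val h)))⟩
  have hk' : IsIntegral R k := by
    refine IsIntegral.map_of_comp_eq (algebraMap ((GX D).presheaf.stalk z) (KX D)).rangeRestrict
      (RingHom.id _) rfl hk
  obtain ⟨⟨g, hg0, hg⟩, hgk⟩ := hk'.exists_multiple_integral_of_isLocalization W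
  rw [Submonoid.smul_def, Algebra.smul_def] at hgk
  obtain ⟨f, hf⟩ := exists_torusMap_of_isIntegral (hgk.tower_top (A := TorusRing D))
  have hfA : f ∈ A := by
    refine isIntegral_mem_coneRing ?_
    have := (isIntegral_algHom_iff (IsScalarTower.toAlgHom A (TorusRing D) (KX D))
      torusMap_injective (x := f)).1
    exact this (by rw [← hf] at hgk; exact hgk)
  have h1 : k = torusMap f * (torusMap g.1)⁻¹ := by
    rw [hf, mul_comm]
    exact (inv_mul_cancel_left₀ hg0 k).symm
  rw [h1]
  exact R.mul_mem (torusMap_mem_localSubring hfA) hg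

end Normal

/-! ## Points of codimension one -/

section CodimOne

variable {ι L : Type} [AddCommGroup L] [Fintype ι] {D : ι → L}

theorem exists_monomial_of_notMem {z : GX D} {G : SRing D} (h : G ∉ ptIdeal z) :
    ∃ u, G.coeff u ≠ 0 ∧ (AddMonoidAlgebra.single u 1 : SRing D) ∉ ptIdeal z := by
  by_contra! h1
  refine h ?_
  rw [← AddMonoidAlgebra.sum_coeff_single G]
  refine Ideal.sum_mem _ fun s hs => ?_
  have := (ptIdeal z).mul_mem_left (AddMonoidAlgebra.single 0 (G.coeff s)) (h1 s (by simpa using hs))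
  rwa [AddMonoidAlgebra.single_mul_single, zero_add, mul_one] at this

theorem apply_eq_zero_of_notMem {z : GX D} {s : Mon D}
    (h : (AddMonoidAlgebra.single s 1 : SRing D) ∉ ptIdeal z) {a : ι} (ha : a ∈ zeroSet z) :
    s.1.1 a = 0 := by
  by_contra h1
  exact h (mem_zeroSet.1 ha s (by omega))

theorem coeff_dehom {n : ℕ} (F : SGr D n) {s : Mon D} (hs : s.1.2 = n) :
    (dehom D F).coeff (toLattice D s) = (F : SRing D).coeff s := by
  classical
  obtain ⟨F, hF⟩ := F
  change (AddMonoidAlgebra.mapDomain (toLattice D) F).coeff _ = _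
  rw [AddMonoidAlgebra.coeff_mapDomain, Finsupp.mapDomain, Finsupp.sum, Finsupp.finsetSum_apply]
  rw [Finset.sum_eq_single s]
  · simp
  · intro t ht hts
    rw [Finsupp.single_apply, if_neg]
    intro h
    exact hts (toLattice_injOn D h (((mem_SGr D).1 hF t (by simpa using ht)).trans hs.symm))
  · intro h
    have : F.coeff s = 0 := by simpa using h
    simp [this]

theorem exists_of_coeff_dehom {n : ℕ} (F : SGr D n) {m : relLattice D}
    (h : (dehom D F).coeff m ≠ 0) :
    ∃ s : Mon D, s.1.2 = n ∧ (F : SRing D).coeff s ≠ 0 ∧ toLattice D s = m := by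
  classical
  obtain ⟨F, hF⟩ := F
  change (AddMonoidAlgebra.mapDomain (toLattice D) F).coeff _ ≠ _ at h
  rw [AddMonoidAlgebra.coeff_mapDomain, Finsupp.mapDomain, Finsupp.sum, Finsupp.finsetSum_apply] at h
  obtain ⟨s, hs, h1⟩ := Finset.exists_ne_zero_of_sum_ne_zero h
  have hs' : F.coeff s ≠ 0 := by simpa using hs
  refine ⟨s, (mem_SGr D).1 hF s hs', hs', ?_⟩
  by_contra h2
  exact h1 (by rw [Finsupp.single_apply, if_neg h2])

/-- For the converse, write `χ^m = F / G` and pick a monomial u of G nonvanishing at z. Comparing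
coefficients, F contains a monomial s that differs from u by m. Since `u a = 0` for a vanishing
variable, `m a = s a ≥ 0`. -/
theorem chi_mem_localSubring_iff {z : GX D} {m : relLattice D} :
    chi m ∈ localSubring z ↔ ∀ a ∈ zeroSet z, 0 ≤ m.1 a := by
  refine ⟨fun h a ha => ?_, chi_mem_localSubring⟩
  obtain ⟨n, F, G, hG, h⟩ := mem_localSubring.1 h
  have hG0 : (G : SRing D) ≠ 0 := fun h0 => hG (h0 ▸ Ideal.zero_mem _)
  rw [eq_div_iff (torusMap_dehom_ne_zero hG0), ← torusMap_single_one, ← map_mul] at h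
  obtain ⟨u, hu, hu'⟩ := exists_monomial_of_notMem hG
  have hun := (mem_SGr D).1 G.2 u hu
  have h1 := congrArg (fun f => AddMonoidAlgebra.coeff f (m + toLattice D u)) (torusMap_injective h)
  simp only [AddMonoidAlgebra.coeff_single_mul_add, one_mul, coeff_dehom G hun] at h1
  obtain ⟨s, hs, -, h2⟩ := exists_of_coeff_dehom F (by rw [← h1]; exact hu)
  have h3 := congrArg (fun m => m.1 a) h2
  simp only [toLattice_apply, Submodule.coe_add, Pi.add_apply, hs, hun,
    apply_eq_zero_of_notMem hu' ha] at h3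
  omega

theorem ringKrullDim_stalk {z : GX D} (h : Order.coheight z = 1) :
    ringKrullDim ((GX D).presheaf.stalk z) = 1 := by
  rw [ringKrullDim_stalk_eq_coheight, h]
  rfl

/-- A Noetherian normal local domain of dimension one. -/
theorem isDiscreteValuationRing_stalk {z : GX D} (h : Order.coheight z = 1) :
    IsDiscreteValuationRing ((GX D).presheaf.stalk z) := by
  have : Ring.KrullDimLE 1 ((GX D).presheaf.stalk z) := krullDimLE_of_coheight_le h.le
  have hf : ¬ IsField ((GX D).presheaf.stalk z) := by
    intro hf
    have h1 := ringKrullDim_stalk h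
    rw [ringKrullDim_eq_zero_of_isField hf] at h1
    exact zero_ne_one h1
  have h1 := (tfae_of_isNoetherianRing_of_isLocalRing_of_isDomain
    ((GX D).presheaf.stalk z)).out 3 1
  have h2 := h1.1 ⟨isIntegrallyClosed_stalk z, fun P hP hP' =>
    IsLocalRing.eq_maximalIdeal (Ring.krullDimLE_one_iff_of_noZeroDivisors.1 this P hP hP')⟩
  exact ((IsDiscreteValuationRing.TFAE _ hf).out 0 1).2 h2

theorem mem_localSubring_or_inv {z : GX D} (h : Order.coheight z = 1) (k : KX D) :
    k ∈ localSubring z ∨ k⁻¹ ∈ localSubring z := by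
  have := isDiscreteValuationRing_stalk h
  rcases ValuationRing.isInteger_or_isInteger ((GX D).presheaf.stalk z) k with h1 | h1
  · exact Or.inl h1
  · exact Or.inr h1

/-- If two variables a and b vanished, some character would have values of opposite signs at a and
b. Neither it nor its inverse would be regular, which is impossible in a valuation ring. -/
theorem zeroSet_subsingleton {z : GX D} (h : Order.coheight z = 1)
    (H1 : ∀ a b : ι, a ≠ b → ∃ m ∈ relLattice D, m a ≠ m b) : (zeroSet z).Subsingleton := by
  intro a ha b hb
  by_contra hab
  obtain ⟨m, hm, hmab⟩ := H1 a b hab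
  obtain ⟨s, h1, h2, h3⟩ := exists_monomial_zeroSet z
  -- On vanishing variables `toLattice D s` equals minus the degree d of s, so m' takes the opposite
  -- values `d (m a - m b)` and `d (m b - m a)` at a and b.
  let m' : relLattice D := (2 * (s.1.2 : ℤ)) • ⟨m, hm⟩ + (m a + m b) • toLattice D s
  have e (c) (hc : c ∈ zeroSet z) : m'.1 c = s.1.2 * (2 * m c - m a - m b) := by
    have : m'.1 c = (2 * (s.1.2 : ℤ)) * m c + (m a + m b) * (toLattice D s).1 c := rfl
    rw [this, toLattice_apply, (h3 c).2 hc]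
    push_cast
    ring
  have hp : (0 : ℤ) < s.1.2 := by exact_mod_cast h1
  rcases mem_localSubring_or_inv h (chi m') with h4 | h4
  · rw [chi_mem_localSubring_iff] at h4
    have h5 := h4 a ha
    have h6 := h4 b hb
    rw [e a ha, mul_nonneg_iff_of_pos_left hp] at h5
    rw [e b hb, mul_nonneg_iff_of_pos_left hp] at h6
    omega
  · rw [← chi_neg, chi_mem_localSubring_iff] at h4
    have h5 : 0 ≤ - m'.1 a := h4 a ha
    have h6 : 0 ≤ - m'.1 b := h4 b hb
    rw [e a ha, ← mul_neg, mul_nonneg_iff_of_pos_left hp] at h5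
    rw [e b hb, ← mul_neg, mul_nonneg_iff_of_pos_left hp] at h6
    omega

/-- The face ideal of a is a point y that specializes to z and differs from the generic point.
Codimension one leaves no room between z and the generic point, so z equals y. -/
theorem ptIdeal_eq_faceIdeal {z : GX D} (h : Order.coheight z = 1) {a : ι} (ha : a ∈ zeroSet z) :
    ptIdeal z = faceIdeal D {a} := by
  obtain ⟨s, h1, h2, h3⟩ := exists_monomial_zeroSet z
  let y : GX D := facePoint D {a} ⟨s, h1, by simpa using (h3 a).2 ha⟩
  have hy : ptIdeal y = faceIdeal D {a} := rfl
  have hle : ptIdeal y ≤ ptIdeal z := by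
    intro F hF
    by_contra hF'
    obtain ⟨u, hu, hu'⟩ := exists_monomial_of_notMem hF'
    obtain ⟨b, hb, hub⟩ := (mem_faceIdeal D).1 (hy ▸ hF) u hu
    rw [Set.mem_singleton_iff] at hb
    subst hb
    exact hub (apply_eq_zero_of_notMem hu' ha)
  have hzy : z ≤ y := by
    rw [Scheme.le_iff_specializes, specializes_iff]
    exact hle
  have hyη : y < etaPoint D := by
    rw [lt_iff_le_not_ge, Scheme.le_iff_specializes, Scheme.le_iff_specializes, specializes_iff,
      specializes_iff, etaPoint, ptIdeal_facePoint, faceIdeal_empty]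
    refine ⟨bot_le, fun h => ?_⟩
    have : (AddMonoidAlgebra.single (prodVar D) 1 : SRing D) ∈ (⊥ : Ideal (SRing D)) :=
      h (by rw [hy, mem_faceIdeal]; intro s hs; refine ⟨a, rfl, ?_⟩; classical
            rw [AddMonoidAlgebra.coeff_single, Finsupp.single_apply] at hs
            split_ifs at hs with h
            · rw [← h]; simp
            · exact absurd rfl hs)
    simp at this
  have h4 := Order.coheight_add_one_le hyη
  refine le_antisymm ?_ (hy ▸ hle)
  by_contra h5
  have h6 : z < y := lt_of_le_not_ge hzy (by rw [Scheme.le_iff_specializes, specializes_iff]; exact h5)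
  have h7 := Order.coheight_add_one_le h6
  rw [h] at h7
  have h8 : (1 : ℕ∞) ≤ Order.coheight y := le_trans (by simp) h4
  have h9 : (1 : ℕ∞) + 1 ≤ 1 := le_trans (by gcongr) h7
  exact absurd h9 (by decide)

theorem chi_nsmul (n : ℕ) (m : relLattice D) : chi (n • m) = chi m ^ n := by
  induction n with
  | zero => simp [chi_zero]
  | succ n ih => rw [succ_nsmul, chi_add, ih, pow_succ]

theorem chi_zsmul (n : ℤ) (m : relLattice D) : chi (n • m) = chi m ^ n := by
  obtain ⟨k, rfl | rfl⟩ := n.eq_nat_or_neg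
  · rw [natCast_zsmul, chi_nsmul, zpow_natCast]
  · rw [neg_smul, chi_neg, natCast_zsmul, chi_nsmul, zpow_neg, zpow_natCast]

theorem ordHom_eq_one {z : GX D} (h : Order.coheight z = 1) {k : KX D} (hk : k ≠ 0)
    (h1 : k ∈ localSubring z) (h2 : k⁻¹ ∈ localSubring z) : Scheme.ordHom z h k = 1 := by
  have : Ring.KrullDimLE 1 ((GX D).presheaf.stalk z) := krullDimLE_of_coheight_le h.le
  obtain ⟨x, rfl⟩ := h1
  obtain ⟨y, hy⟩ := h2
  have hx : IsUnit x := by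
    refine IsUnit.of_mul_eq_one y (IsFractionRing.injective ((GX D).presheaf.stalk z) (KX D) ?_)
    rw [map_mul, hy, mul_inv_cancel₀ hk, map_one]
  exact Ring.ordFrac_of_isUnit hx

/-- At a point of codimension one where `x_a` vanishes, a function that vanishes is divisible by
any character with exponent `1` at `a`. -/
theorem div_chi_mem {z : GX D} (h : Order.coheight z = 1) 
    (H1 : ∀ a b : ι, a ≠ b → ∃ m ∈ relLattice D, m a ≠ m b) {a : ι} (ha : a ∈ zeroSet z)
    {t : relLattice D} (ht : t.1 a = 1) {n : ℕ} {F G : SGr D n} (hF : (F : SRing D) ∈ ptIdeal z)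
    (hG : (G : SRing D) ∉ ptIdeal z) :
    torusMap (dehom D F) / torusMap (dehom D G) / chi t ∈ localSubring z := by
  have hG0 : (G : SRing D) ≠ 0 := fun h0 => hG (h0 ▸ Ideal.zero_mem _)
  obtain ⟨u, hu, hu'⟩ := exists_monomial_of_notMem hG
  have hun := (mem_SGr D).1 G.2 u hu
  have hF' := hF
  rw [ptIdeal_eq_faceIdeal h ha, mem_faceIdeal] at hF'
  rw [div_div, mul_comm, ← div_div, div_eq_mul_inv, div_eq_mul_inv, mul_assoc]
  -- The factor `x^u / G` is regular at z. Every monomial s of F is divisible by `x_a` while u is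
  -- not, so dividing by `χ^(t + u)` leaves the exponent `s a - 1 ≥ 0` at a.
  have e : (chi t : KX D)⁻¹ * (torusMap (dehom D G))⁻¹ =
      chi (-(t + toLattice D u)) * (torusMap (dehom D (monOf u n hun)) / torusMap (dehom D G)) := by
    rw [neg_add, chi_add, coe_monOf, dehom_single, torusMap_single_one, chi_neg, chi_neg]
    have := chi_ne_zero (toLattice D u)
    field_simp
  rw [e, ← mul_assoc]
  refine Subring.mul_mem _ ?_ (mem_localSubring.2 ⟨n, _, _, hG, rfl⟩)
  rw [← torusMap_single_one, ← map_mul, ← AddMonoidAlgebra.sum_coeff_single (F : SRing D),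
    Finsupp.sum, map_sum, Finset.sum_mul]
  refine torusMap_mem_localSubring (Subring.sum_mem _ fun s hs => ?_)
  have hs0 : (F : SRing D).coeff s ≠ 0 := by simpa using hs
  rw [dehom_single, AddMonoidAlgebra.single_mul_single]
  refine single_mem_coneRing fun b hb => ?_
  obtain rfl := zeroSet_subsingleton h H1 ha hb
  obtain ⟨b, hb, hsb⟩ := hF' s hs0
  rw [Set.mem_singleton_iff] at hb
  subst hb
  simp only [Submodule.coe_add, Submodule.coe_neg, Pi.add_apply, Pi.neg_apply, toLattice_apply, ht,
    (mem_SGr D).1 F.2 s hs0, hun, apply_eq_zero_of_notMem hu' ha]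
  omega

/-- The character `χ^t` is a nonunit that divides a uniformizer, hence is a uniformizer itself. -/
theorem ordHom_chi_eq_exp {z : GX D} (h : Order.coheight z = 1) 
    (H1 : ∀ a b : ι, a ≠ b → ∃ m ∈ relLattice D, m a ≠ m b) {a : ι} (ha : a ∈ zeroSet z)
    {t : relLattice D} (ht : t.1 a = 1) : Scheme.ordHom z h (chi t) = WithZero.exp 1 := by
  have := isDiscreteValuationRing_stalk h
  have : Ring.KrullDimLE 1 ((GX D).presheaf.stalk z) := krullDimLE_of_coheight_le h.le
  have hz := zeroSet_subsingleton h H1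
  obtain ⟨x, hx⟩ : chi t ∈ localSubring z := chi_mem_localSubring fun b hb => by
    obtain rfl := hz ha hb
    omega
  have hxu : ¬ IsUnit x := by
    intro hu
    obtain ⟨u, rfl⟩ := hu
    have : chi (-t) ∈ localSubring z := by
      refine ⟨↑(u⁻¹), ?_⟩
      rw [chi_neg, ← hx]
      refine eq_inv_of_mul_eq_one_left ?_
      rw [← map_mul, Units.inv_mul, map_one]
    have := chi_mem_localSubring_iff.1 this a ha
    simp only [Submodule.coe_neg, Pi.neg_apply, ht] at this
    omega
  obtain ⟨p, hp⟩ := IsDiscreteValuationRing.exists_irreducible ((GX D).presheaf.stalk z)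
  obtain ⟨n, F, G, hG, hpF⟩ := exists_eq_fracAt z p
  have hF : (F : SRing D) ∈ ptIdeal z := by
    by_contra hF
    exact hp.not_isUnit (hpF ▸ (isUnit_fracAt_iff z).2 hF)
  obtain ⟨r, hr⟩ := div_chi_mem h H1 ha ht hF hG
  have hpr : p = x * r := by
    apply IsFractionRing.injective ((GX D).presheaf.stalk z) (KX D)
    rw [map_mul, hr, hx, mul_div_cancel₀ _ (chi_ne_zero t), hpF, algebraMap_fracAt',
      ratFrac_eq_div]
  have hru : IsUnit r := (hp.isUnit_or_isUnit hpr).resolve_left hxu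
  have hxi : Irreducible x := by
    rw [hpr] at hp
    exact (irreducible_mul_isUnit hru).1 hp
  rw [← hx]
  exact Ring.ordFrac_irreducible hxi

/-- Split m into `m a` copies of a relation t with `t a = 1` and a remainder vanishing at a, whose
character is a unit. -/
theorem ordHom_chi {z : GX D} (h : Order.coheight z = 1) 
    (H1 : ∀ a b : ι, a ≠ b → ∃ m ∈ relLattice D, m a ≠ m b) 
    (H2 : ∀ a : ι, ∃ m ∈ relLattice D, m a = 1) {a : ι} (ha : a ∈ zeroSet z) (m : relLattice D) :
    Scheme.ordHom z h (chi m) = WithZero.exp (m.1 a) := by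
  obtain ⟨t, ht, hta⟩ := H2 a
  let u := m - m.1 a • (⟨t, ht⟩ : relLattice D)
  have hu : u.1 a = 0 := by
    change m.1 a - m.1 a * t a = 0
    rw [hta, mul_one, sub_self]
  have hm : m = m.1 a • (⟨t, ht⟩ : relLattice D) + u := by simp [u]
  have h1 : Scheme.ordHom z h (chi u) = 1 := by
    refine ordHom_eq_one h (chi_ne_zero u) (chi_mem_localSubring fun b hb => ?_) ?_
    · rw [← zeroSet_subsingleton h H1 ha hb, hu]
    · rw [← chi_neg]
      refine chi_mem_localSubring fun b hb => ?_
      rw [← zeroSet_subsingleton h H1 ha hb, Submodule.coe_neg, Pi.neg_apply, hu, neg_zero]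
  conv_lhs => rw [hm]
  rw [chi_add, chi_zsmul, map_mul, map_zpow₀, h1, mul_one,
    ordHom_chi_eq_exp h H1 ha (t := ⟨t, ht⟩) hta, ← WithZero.exp_zsmul]
  simp

/-- At a point of codimension one either exactly one variable vanishes, and its coordinate is the
order, or none does, and all characters are units. -/
theorem ord_chi (H1 : ∀ a b : ι, a ≠ b → ∃ m ∈ relLattice D, m a ≠ m b) 
    (H2 : ∀ a : ι, ∃ m ∈ relLattice D, m a = 1) (m : relLattice D) (z : GX D) :
    Scheme.ord (chi m) z = ∑ a, m.1 a * coordDivisor D (totalWeight D) a z := by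
  classical
  by_cases h : Order.coheight z = 1
  swap
  · simp [h, coordDivisor]
  by_cases hz : ∃ a, a ∈ zeroSet z
  · obtain ⟨a, ha⟩ := hz
    rw [Finset.sum_eq_single a]
    · rw [coordDivisor, if_pos ⟨h, ha⟩, mul_one, Scheme.ord_eq_iff h (chi_ne_zero m),
        ordHom_chi h H1 H2 ha]
      rfl
    · intro b _ hb
      rw [coordDivisor, if_neg, mul_zero]
      rintro ⟨-, h1⟩
      exact hb (zeroSet_subsingleton h H1 h1 ha)
    · simp
  · push Not at hz
    rw [Finset.sum_eq_zero, Scheme.ord_eq_iff h (chi_ne_zero m), ordHom_eq_one h (chi_ne_zero m)]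
    · rfl
    · exact chi_mem_localSubring fun a ha => absurd ha (hz a)
    · rw [← chi_neg]
      exact chi_mem_localSubring fun a ha => absurd ha (hz a)
    · intro a _
      rw [coordDivisor, if_neg fun h => hz a h.2, mul_zero]

end CodimOne

/-! ### Logarithmic differentials of characters -/

section Forms

open KaehlerDifferential

variable {ι L : Type} [AddCommGroup L] [Fintype ι] {D : ι → L}
variable {σ : Type} [Fintype σ]


/-- The basis `d χ^{b_i}` of the differential forms. -/
def kaehlerBasis (b : Module.Basis σ ℤ (relLattice D)) : Module.Basis σ (KX D) Ω[KX D⁄ℂ] :=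
  letI := polyAlgebra b
  haveI := isFractionRing_poly b
  haveI : IsScalarTower ℂ (MvPolynomial σ ℂ) (KX D) :=
    IsScalarTower.of_algebraMap_eq fun r => ((torusMap.comp (polyMap b)).commutes r).symm
  (mvPolynomialBasis ℂ σ).ofIsLocalizedModule (KX D) (nonZeroDivisors (MvPolynomial σ ℂ))
    (KaehlerDifferential.map ℂ ℂ (MvPolynomial σ ℂ) (KX D))

theorem kaehlerBasis_apply (b : Module.Basis σ ℤ (relLattice D)) (i : σ) :
    kaehlerBasis b i = KaehlerDifferential.D ℂ (KX D) (chi (b i)) := by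
  let _ := polyAlgebra b
  have := isFractionRing_poly b
  have : IsScalarTower ℂ (MvPolynomial σ ℂ) (KX D) :=
    IsScalarTower.of_algebraMap_eq fun r => ((torusMap.comp (polyMap b)).commutes r).symm
  rw [kaehlerBasis, Module.Basis.ofIsLocalizedModule_apply, mvPolynomialBasis_apply,
    KaehlerDifferential.map_D]
  congr 1
  change torusMap (polyMap b (MvPolynomial.X i)) = _
  rw [polyMap_X, torusMap_single_one]

/-- The logarithmic differential of a character. -/
def dlog : relLattice D →+ Ω[KX D⁄ℂ] where
  toFun m := (chi m)⁻¹ • KaehlerDifferential.D ℂ (KX D) (chi m)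
  map_zero' := by simp [chi_zero]
  map_add' m m' := by
    have h1 := chi_ne_zero m
    have h2 := chi_ne_zero m'
    rw [chi_add, Derivation.leibniz, smul_add, smul_smul, smul_smul, add_comm]
    congr 2 <;> field_simp

theorem D_chi (m : relLattice D) : KaehlerDifferential.D ℂ (KX D) (chi m) = chi m • dlog m := by
  change _ = chi m • (chi m)⁻¹ • KaehlerDifferential.D ℂ (KX D) (chi m)
  rw [smul_smul, mul_inv_cancel₀ (chi_ne_zero m), one_smul]

/-- The basis of logarithmic differentials, twisted by characters. -/
def dlogBasis (b : Module.Basis σ ℤ (relLattice D)) (u : σ → relLattice D) :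
    Module.Basis σ (KX D) Ω[KX D⁄ℂ] :=
  (kaehlerBasis b).isUnitSMul (w := fun i => chi (u i - b i)) fun _ =>
    (chi_ne_zero _).isUnit

theorem dlogBasis_apply (b : Module.Basis σ ℤ (relLattice D)) (u : σ → relLattice D) (i : σ) :
    dlogBasis b u i = chi (u i) • dlog (b i) := by
  rw [dlogBasis, Module.Basis.isUnitSMul_apply, kaehlerBasis_apply, D_chi, smul_smul, ← chi_add,
    sub_add_cancel]

/-- Logarithmic differentials are additive, so up to the twist the coordinates of `dlog m` are the
integer coordinates of m in b. -/
theorem dlogBasis_repr (b : Module.Basis σ ℤ (relLattice D)) (u : σ → relLattice D)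
    (m : relLattice D) (i : σ) :
    (dlogBasis b u).repr (dlog m) i = (b.repr m i : ℤ) * chi (-u i) := by
  have h : dlog m = ∑ i, ((b.repr m i : ℤ) * chi (-u i)) • dlogBasis b u i := by
    conv_lhs => rw [← b.sum_repr m]
    rw [map_sum]
    refine Finset.sum_congr rfl fun i _ => ?_
    rw [dlogBasis_apply, smul_smul, mul_assoc, ← chi_add, neg_add_cancel, chi_zero, mul_one,
      map_zsmul, Int.cast_smul_eq_zsmul]
  rw [h, map_sum, Finsupp.finsetSum_apply]
  simp only [map_smul, Module.Basis.repr_self, Finsupp.smul_apply]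
  classical
  simp [Finsupp.single_apply]

theorem finrank_kaehler :
    Module.finrank (KX D) Ω[KX D⁄ℂ] = Module.finrank ℤ (relLattice D) := by
  rw [Module.finrank_eq_card_basis (kaehlerBasis (latticeBasis D)), Fintype.card_fin]

end Forms

/-! ### Top exterior powers and determinants -/

section Exterior

variable {K V : Type} [Field K] [AddCommGroup V] [Module K V] {n : ℕ}

/-- Both sides are alternating in v and agree on permutations of the basis. -/
theorem ιMulti_eq_det_smul (e : Module.Basis (Fin n) K V) (v : Fin n → V) :
    exteriorPower.ιMulti K n v = e.det v • exteriorPower.ιMulti K n e := by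
  let f : V [⋀^Fin n]→ₗ[K] ⋀[K]^n V :=
    (LinearMap.toSpanSingleton K (⋀[K]^n V) (exteriorPower.ιMulti K n e)).compAlternatingMap e.det
  have : exteriorPower.ιMulti K n = f := by
    refine e.ext_alternating fun s hs => ?_
    let τ : Equiv.Perm (Fin n) := Equiv.ofBijective s (Finite.injective_iff_bijective.1 hs)
    have h1 := (exteriorPower.ιMulti K n).map_perm e τ
    have h2 := e.det.map_perm e τ
    refine h1.trans ?_
    change _ = e.det (e ∘ τ) • exteriorPower.ιMulti K n e
    rw [h2, e.det_self]
    rw [smul_assoc, one_smul]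
  exact congrArg (fun g => g v) this

/-- The determinant factors through the exterior power and takes the value 1 on the basis. -/
theorem ιMulti_basis_ne_zero (e : Module.Basis (Fin n) K V) :
    exteriorPower.ιMulti K n e ≠ 0 := by
  intro h
  have := exteriorPower.alternatingMapLinearEquiv_apply_ιMulti (R := K) e.det e
  rw [h, map_zero, e.det_self] at this
  exact zero_ne_one this

end Exterior

/-! ### Canonical and Cartier divisors on the quotient -/

section Canonical

variable {ι L : Type} [AddCommGroup L] [Fintype ι] {D : ι → L}

/-- The exterior product of a twisted basis of logarithmic differentials generates the regular top
forms, if the twisted basis generates the regular forms of degree one. -/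
theorem generatesRegularForms_dlogBasis (z : GX D)
    (b : Module.Basis (Fin (Module.finrank (KX D) Ω[KX D⁄ℂ])) ℤ (relLattice D))
    (u : Fin (Module.finrank (KX D) Ω[KX D⁄ℂ]) → relLattice D)
    (h1 : ∀ i, ∀ a ∈ zeroSet z, 0 ≤ (b i).1 a ∧ 0 ≤ (u i - b i).1 a)
    (h2 : ∀ m : relLattice D, (∀ a ∈ zeroSet z, 0 ≤ m.1 a) →
      ∀ i, b.repr m i = 0 ∨ ∀ a ∈ zeroSet z, 0 ≤ (m - u i).1 a) :
    GeneratesRegularForms ((GX D).presheaf.stalk z)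
      (exteriorPower.ιMulti (KX D) (Module.finrank (KX D) Ω[KX D⁄ℂ]) (dlogBasis b u)) := by
  set e := dlogBasis b u with he
  have hint (k : ℤ) : (k : KX D) ∈ localSubring z := intCast_mem _ k
  -- The i-th coordinate of `d χ^m` is the i-th coordinate of m times `χ^(m - u i)`, which is
  -- regular at z by `h2`.
  have hD0 : ∀ f ∈ coneRing (D := D) (zeroSet z), ∀ i,
      e.repr (KaehlerDifferential.D ℂ (KX D) (torusMap f)) i ∈ localSubring z := by
    intro f hf i
    rw [← AddMonoidAlgebra.sum_coeff_single f, Finsupp.sum, map_sum, map_sum, map_sum,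
      Finsupp.finsetSum_apply]
    refine Subring.sum_mem _ fun m hm => ?_
    have hm' := hf m (by simpa using hm)
    rw [torusMap_single, ← Algebra.smul_def, Derivation.map_smul, D_chi,
      ← algebraMap_smul (KX D) (f.coeff m), map_smul, map_smul, Finsupp.smul_apply,
      Finsupp.smul_apply, dlogBasis_repr, smul_eq_mul, smul_eq_mul]
    refine Subring.mul_mem _ ?_ ?_
    · have := torusMap_mem_localSubring (z := z) (single_mem_coneRing (m := 0) (c := f.coeff m)
        (fun a _ => le_rfl))
      rwa [torusMap_single, chi_zero, mul_one] at this
    · rcases h2 m hm' i with h3 | h3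
      · rw [h3]
        simp
      · rw [mul_left_comm, ← chi_add]
        exact Subring.mul_mem _ (hint _) (chi_mem_localSubring (by rwa [← sub_eq_add_neg]))
  -- The quotient rule extends this from the cone ring to its localization.
  have hD : ∀ k ∈ localSubring z, ∀ i,
      e.repr (KaehlerDifferential.D ℂ (KX D) k) i ∈ localSubring z := by
    intro k hk i
    obtain ⟨f, hf, g, hg, h0, hg', rfl⟩ := exists_eq_div_coneRing hk
    rw [Derivation.leibniz_div, map_smul, map_sub, map_smul, map_smul, Finsupp.smul_apply,
      Finsupp.sub_apply, Finsupp.smul_apply, Finsupp.smul_apply]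
    simp only [smul_eq_mul]
    refine Subring.mul_mem _ (by simpa using Subring.pow_mem _ hg' 2) (Subring.sub_mem _ ?_ ?_)
    · exact Subring.mul_mem _ (torusMap_mem_localSubring hg) (hD0 f hf i)
    · exact Subring.mul_mem _ (torusMap_mem_localSubring hf) (hD0 g hg i)
  refine ⟨ιMulti_basis_ne_zero e, fun θ => ⟨fun hθ => ?_, ?_⟩⟩
  · induction hθ using AddSubgroup.closure_induction with
    | mem θ h =>
      obtain ⟨g, f, rfl⟩ := h
      have hdet : e.det (fun i => KaehlerDifferential.D ℂ (KX D)
          (algebraMap ((GX D).presheaf.stalk z) (KX D) (f i))) ∈ localSubring z := by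
        rw [Module.Basis.det_apply, Matrix.det_apply]
        refine Subring.sum_mem _ fun τ _ => ?_
        rw [Units.smul_def, zsmul_eq_mul]
        refine Subring.mul_mem _ (hint _) (Subring.prod_mem _ fun i _ => ?_)
        exact hD _ ⟨_, rfl⟩ _
      obtain ⟨r, hr⟩ := hdet
      refine ⟨g * r, ?_⟩
      rw [dForm, ιMulti_eq_det_smul e, smul_smul, ← hr, map_mul]
    | zero => exact ⟨0, by simp⟩
    | add θ θ' _ _ h h' =>
      obtain ⟨g, rfl⟩ := h
      obtain ⟨g', rfl⟩ := h'
      exact ⟨g + g', by rw [map_add, add_smul]⟩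
    | neg θ _ h =>
      obtain ⟨g, rfl⟩ := h
      exact ⟨-g, by rw [map_neg]; exact (neg_smul _ _).symm⟩
  -- Each basis form is `χ^(u i - b i) d χ^(b i)`, a regular function times the differential of a
  -- regular function by `h1`.
  · rintro ⟨g, rfl⟩
    have hb (i) : chi (b i) ∈ localSubring z := chi_mem_localSubring fun a ha => (h1 i a ha).1
    have hu (i) : chi (u i - b i) ∈ localSubring z :=
      chi_mem_localSubring fun a ha => (h1 i a ha).2
    choose f hf using hb
    choose c hc using hu
    refine AddSubgroup.subset_closure ⟨g * ∏ i, c i, f, ?_⟩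
    have h3 : ⇑e = fun i => chi (u i - b i) • KaehlerDifferential.D ℂ (KX D) (chi (b i)) := by
      funext i
      rw [he, dlogBasis_apply, D_chi, smul_smul, ← chi_add, sub_add_cancel]
    rw [dForm, h3, map_mul, map_prod, ← smul_smul]
    congr 1
    simp only [hf, hc]
    exact (exteriorPower.ιMulti (KX D) _).toMultilinearMap.map_smul_univ _ _

/-- The a-th coordinate is surjective onto ℤ and hence splits: an element with coordinate 1 together
with a basis of the kernel. -/
theorem exists_adapted_basis {n : ℕ} (hn : n = Module.finrank ℤ (relLattice D)) {a : ι}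
    (h : ∃ m ∈ relLattice D, m a = 1) :
    ∃ (b : Module.Basis (Fin n) ℤ (relLattice D)) (i0 : Fin n),
      ∀ i, (b i).1 a = if i = i0 then 1 else 0 := by
  obtain ⟨t, ht, hta⟩ := h
  let φ : relLattice D →ₗ[ℤ] ℤ := (LinearMap.proj a).comp (relLattice D).subtype
  have hφ (m : relLattice D) : φ m = m.1 a := rfl
  let B := Module.finBasis ℤ (LinearMap.ker φ)
  let b0 := Module.Basis.mkFinCons (⟨t, ht⟩ : relLattice D) B
    (fun c x hx h => by
      have h1 := congrArg φ h
      rw [map_add, map_smul, LinearMap.mem_ker.1 hx, hφ] at h1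
      simpa [hta] using h1)
    (fun m => ⟨-m.1 a, by
      rw [LinearMap.mem_ker, map_add, map_smul, hφ, hφ]
      simp [hta]⟩)
  have hc : Module.finrank ℤ (LinearMap.ker φ) + 1 = n := by
    rw [hn, Module.finrank_eq_card_basis b0, Fintype.card_fin]
  subst hc
  refine ⟨b0, 0, fun i => ?_⟩
  rw [Module.Basis.coe_mkFinCons]
  refine Fin.cases ?_ (fun i => ?_) i
  · simpa using hta
  · rw [if_neg (Fin.succ_ne_zero i)]
    exact LinearMap.mem_ker.1 (B i).2

/-- Use the form `χ^m dlog χ^(e 1) ∧ ⋯ ∧ dlog χ^(e d)`. Where `x_a` vanishes, regular top forms are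
generated by the wedge of one ordinary differential, of a character with exponent 1 at a, and of
logarithmic differentials of units. The ordinary differential exceeds the logarithmic one by a
factor of order one, which lowers the order `m a` to `m a - 1`. -/
theorem isCanonicalDivisor_of_mem (H1 : ∀ a b : ι, a ≠ b → ∃ m ∈ relLattice D, m a ≠ m b)
    (H2 : ∀ a : ι, ∃ m ∈ relLattice D, m a = 1) (m : relLattice D) :
    IsCanonicalDivisor (GXToSpec D) (∑ a, (m.1 a - 1) • coordDivisor D (totalWeight D) a) := by
  classical
  have hr := finrank_kaehler (D := D)
  let e := (latticeBasis D).reindex (finCongr hr.symm)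
  refine ⟨chi m • exteriorPower.ιMulti (KX D) (Module.finrank (KX D) Ω[KX D⁄ℂ]) (dlogBasis e 0),
    smul_ne_zero (chi_ne_zero m) (ιMulti_basis_ne_zero _), fun z => ⟨fun hz => ?_, fun hz => ?_⟩⟩
  · simp [coordDivisor, hz]
  have key : ∃ (b : Module.Basis (Fin (Module.finrank (KX D) Ω[KX D⁄ℂ])) ℤ (relLattice D))
      (u : Fin (Module.finrank (KX D) Ω[KX D⁄ℂ]) → relLattice D),
      (∀ i, ∀ a ∈ zeroSet z, 0 ≤ (b i).1 a ∧ 0 ≤ (u i - b i).1 a) ∧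
      (∀ m : relLattice D, (∀ a ∈ zeroSet z, 0 ≤ m.1 a) →
        ∀ i, b.repr m i = 0 ∨ ∀ a ∈ zeroSet z, 0 ≤ (m - u i).1 a) ∧
      ∀ a ∈ zeroSet z, (∑ i, u i).1 a = 1 := by
    have hs := zeroSet_subsingleton hz H1
    by_cases hne : ∃ a, a ∈ zeroSet z
    · obtain ⟨a, ha⟩ := hne
      obtain ⟨b, i0, hb⟩ := exists_adapted_basis hr (H2 a)
      have hall : ∀ P : ι → Prop, P a → ∀ a' ∈ zeroSet z, P a' :=
        fun P hP a' ha' => hs ha ha' ▸ hP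
      refine ⟨b, fun i => if i = i0 then b i else 0, fun i => hall _ ?_, fun m hm i => ?_,
        hall _ ?_⟩
      · beta_reduce
        by_cases h : i = i0
        · rw [if_pos h, hb, if_pos h]
          simp
        · rw [if_neg h, zero_sub, Submodule.coe_neg, Pi.neg_apply, hb, if_neg h]
          simp
      · beta_reduce
        by_cases h : i = i0
        · subst h
          have h3 : b.repr m i = m.1 a := by
            have := congrArg (fun m : relLattice D => m.1 a) (b.sum_repr m)
            simp only [Submodule.coe_sum, Finset.sum_apply, Submodule.coe_smul, Pi.smul_apply, hb,
              smul_eq_mul] at this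
            simpa using this
          by_cases h4 : m.1 a = 0
          · exact Or.inl (h3.trans h4)
          · refine Or.inr (hall _ ?_)
            have := hm a ha
            rw [if_pos rfl, Submodule.coe_sub, Pi.sub_apply, hb, if_pos rfl]
            omega
        · refine Or.inr (hall _ ?_)
          rw [if_neg h, sub_zero]
          exact hm a ha
      · simp [hb]
    -- No variable vanishes at z, so all characters are units and the untwisted logarithmic basis
    -- works.
    · push Not at hne
      exact ⟨e, 0, fun i a ha => absurd ha (hne a), fun m _ i => Or.inr fun a ha =>
        absurd ha (hne a), fun a ha => absurd ha (hne a)⟩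
  obtain ⟨b, u, h1, h2, h3⟩ := key
  -- Two bases of the lattice differ by a determinant of ±1, which does not affect orders.
  obtain ⟨ε, hε⟩ : ∃ ε : ℤˣ, ε = b.det e := (b.isUnit_det e)
  have hdet : (dlogBasis b u).det (dlogBasis e 0) = (ε : ℤ) * chi (-∑ i, u i) := by
    have : (dlogBasis b u).toMatrix (dlogBasis e 0) =
        Matrix.diagonal (fun i => chi (-u i)) * (b.toMatrix e).map (Int.cast : ℤ → KX D) := by
      ext i j
      rw [Matrix.diagonal_mul, Module.Basis.toMatrix_apply, dlogBasis_apply, Pi.zero_apply,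
        chi_zero, one_smul, dlogBasis_repr, mul_comm]
      rfl
    rw [Module.Basis.det_apply, this, Matrix.det_mul, Matrix.det_diagonal, hε,
      Module.Basis.det_apply, mul_comm]
    congr 1
    · exact (RingHom.map_det (Int.castRingHom (KX D)) _).symm
    · have : ∀ s : Finset (Fin (Module.finrank (KX D) Ω[KX D⁄ℂ])),
          ∏ i ∈ s, chi (-u i) = chi (-∑ i ∈ s, u i) := by
        intro s
        induction s using Finset.induction_on with
        | empty => simp [chi_zero]
        | insert i s hi ih => rw [Finset.prod_insert hi, Finset.sum_insert hi, neg_add, chi_add, ih]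
      exact this _
  have hε0 : ((ε : ℤ) : KX D) * ((ε : ℤ) : KX D) = 1 := by
    rw [← Int.cast_mul, ← Units.val_mul, Int.units_mul_self]
    simp
  have hε1 : ((ε : ℤ) : KX D) ≠ 0 := fun h => by simp [h] at hε0
  refine ⟨_, (ε : ℤ) * chi (m - ∑ i, u i), generatesRegularForms_dlogBasis z b u h1 h2, ?_, ?_⟩
  · rw [ιMulti_eq_det_smul (dlogBasis b u) (dlogBasis e 0), hdet, smul_smul, mul_left_comm,
      ← chi_add, sub_eq_add_neg]
  · rw [Scheme.ord_mul hε1 (chi_ne_zero _), ord_chi H1 H2]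
    have h4 : Scheme.ord ((ε : ℤ) : KX D) z = 0 := by
      rw [Scheme.ord_eq_iff hz hε1, ordHom_eq_one hz hε1 (intCast_mem _ _)]
      · rfl
      · rw [inv_eq_of_mul_eq_one_right hε0]
        exact intCast_mem _ _
    rw [h4, zero_add, Finset.sum_apply]
    refine Finset.sum_congr rfl fun a _ => ?_
    rw [Pi.smul_apply, smul_eq_mul, coordDivisor]
    split_ifs with h
    · rw [Submodule.coe_sub, Pi.sub_apply, h3 a h.2]
    · simp

/-- On the open set where `x^s` does not vanish, only the `D_a` with `s a = 0` are visible. There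
the divisor agrees with that of one character. -/
theorem isCartier_of_forall_monomial (H1 : ∀ a b : ι, a ≠ b → ∃ m ∈ relLattice D, m a ≠ m b)
    (H2 : ∀ a : ι, ∃ m ∈ relLattice D, m a = 1) {d : ι → ℤ}
    (h : ∀ s : Mon D, 0 < s.1.2 → ∃ m ∈ relLattice D, ∀ a, s.1.1 a = 0 → d a = m a) :
    IsCartier (GX D) (∑ a, d a • coordDivisor D (totalWeight D) a) := by
  intro x
  obtain ⟨s, h1, h2⟩ := exists_monomial_notMem D x
  obtain ⟨m, hm, hd⟩ := h s h1
  refine ⟨openOf (AddMonoidAlgebra.single s 1), h2, chi ⟨m, hm⟩, chi_ne_zero _, fun z hz => ?_⟩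
  rw [ord_chi H1 H2, Finset.sum_apply]
  refine Finset.sum_congr rfl fun a _ => ?_
  rw [Pi.smul_apply, smul_eq_mul, coordDivisor]
  split_ifs with h3
  · rw [hd a (apply_eq_zero_of_notMem hz h3.2)]
  · simp

end Canonical

/-! ## Arrows and essential steps of a ladder diagram -/

namespace Diagram

/-- The local conditions on a diagram: which patterns of boxes around a lattice point force the
point to be marked or unmarked. -/
structure IsGood (D : Diagram) : Prop where
  finite_box : D.box.Finite
  ne_sw : ∀ x y, (x, y) ∈ D.box → (x - 1, y - 1) ∈ D.box → (x, y) ∈ D.mark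
  nw_se : ∀ x y, (x - 1, y) ∈ D.box → (x, y - 1) ∈ D.box → (x, y) ∈ D.mark
  ne_only : ∀ x y, (x, y) ∈ D.box → (x - 1, y) ∉ D.box → (x, y - 1) ∉ D.box → (x, y) ∈ D.mark
  sw_only : ∀ x y, (x - 1, y - 1) ∈ D.box → (x - 1, y) ∉ D.box → (x, y - 1) ∉ D.box →
    (x, y) ∈ D.mark
  nw_corner : ∀ x y, (x - 1, y) ∈ D.box → (x, y) ∉ D.box → (x - 1, y - 1) ∉ D.box →
    (x, y) ∉ D.mark
  se_corner : ∀ x y, (x, y - 1) ∈ D.box → (x, y) ∉ D.box → (x - 1, y - 1) ∉ D.box →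
    (x, y) ∉ D.mark

variable {D : Diagram}

theorem step_iff {x y x' y' : ℤ} : D.Step (x, y) (x', y') ↔
    (x' = x + 1 ∧ y' = y ∧ ((x, y) ∈ D.box ∨ (x, y - 1) ∈ D.box)) ∨
    (x' = x ∧ y' = y + 1 ∧ ((x, y) ∈ D.box ∨ (x - 1, y) ∈ D.box)) := by
  simp [Step, and_assoc]

/-- A step into an unmarked point with a box to its upper right starts at the lower left corner of
a box. -/
theorem IsGood.box_of_step (hD : D.IsGood) {p q : ℤ × ℤ} (h : D.Step p q) (hq : q ∉ D.mark)
    (hb : q ∈ D.box) : p ∈ D.box := by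
  obtain ⟨x, y⟩ := p
  obtain ⟨x', y'⟩ := q
  rcases step_iff.1 h with ⟨rfl, rfl, h | h⟩ | ⟨rfl, rfl, h | h⟩
  · exact h
  · exact absurd (hD.ne_sw _ _ hb (by simpa using h)) hq
  · exact h
  · exact absurd (hD.ne_sw _ _ hb (by simpa using h)) hq

/-- A step from an unmarked point without a box to its upper right ends at an unmarked point of the
same kind, or at a marked point. -/
theorem IsGood.notMem_box_of_step (hD : D.IsGood) {p q : ℤ × ℤ} (h : D.Step p q) (hp : p ∉ D.box)
    (hq : q ∉ D.mark) : q ∉ D.box := by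
  intro hb
  exact hp (hD.box_of_step h hq hb)

/-- Distinct predecessors would be the left and lower neighbours of q, both lower left corners of
boxes. Boxes in these two positions force q to be marked. -/
theorem IsGood.step_left_unique (hD : D.IsGood) {p p' q : ℤ × ℤ} (h : D.Step p q)
    (h' : D.Step p' q) (hq : q ∉ D.mark) (hb : q ∈ D.box) : p = p' := by
  have h1 := hD.box_of_step h hq hb
  have h1' := hD.box_of_step h' hq hb
  obtain ⟨x, y⟩ := p
  obtain ⟨x', y'⟩ := p'
  obtain ⟨u, v⟩ := q
  rcases step_iff.1 h with ⟨rfl, rfl, -⟩ | ⟨rfl, rfl, -⟩ <;>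
    rcases step_iff.1 h' with ⟨h2, h3, -⟩ | ⟨h2, h3, -⟩
  · simp at h2 ⊢; exact ⟨h2, h3⟩
  · subst h2 h3
    exact absurd (hD.nw_se _ _ (by simpa using h1) (by simpa using h1')) hq
  · subst h2 h3
    exact absurd (hD.nw_se _ _ (by simpa using h1') (by simpa using h1)) hq
  · simp at h3 ⊢; exact ⟨h2, h3⟩

/-- Without a box to the upper right of p, a step right needs the lower right box and a step up the
upper left one; both together would mark p. -/
theorem IsGood.step_right_unique (hD : D.IsGood) {p q q' : ℤ × ℤ} (h : D.Step p q)
    (h' : D.Step p q') (hp : p ∉ D.mark) (hb : p ∉ D.box) : q = q' := by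
  obtain ⟨x, y⟩ := p
  obtain ⟨x', y'⟩ := q
  obtain ⟨u, v⟩ := q'
  rcases step_iff.1 h with ⟨rfl, rfl, h1⟩ | ⟨rfl, rfl, h1⟩ <;>
    rcases step_iff.1 h' with ⟨rfl, rfl, h2⟩ | ⟨rfl, rfl, h2⟩
  · rfl
  · exact absurd (hD.nw_se _ _ (h2.resolve_left hb) (h1.resolve_left hb)) hp
  · exact absurd (hD.nw_se _ _ (h1.resolve_left hb) (h2.resolve_left hb)) hp
  · rfl

theorem IsGood.exists_step_left (hD : D.IsGood) {q : ℤ × ℤ} (hq : q ∉ D.mark) (hb : q ∈ D.box) :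
    ∃ p, D.Step p q := by
  obtain ⟨x, y⟩ := q
  by_cases h1 : (x - 1, y) ∈ D.box
  · exact ⟨(x - 1, y), step_iff.2 (Or.inl ⟨by ring, rfl, Or.inl h1⟩)⟩
  · by_cases h2 : (x, y - 1) ∈ D.box
    · exact ⟨(x, y - 1), step_iff.2 (Or.inr ⟨rfl, by ring, Or.inl h2⟩)⟩
    · exact absurd (hD.ne_only _ _ hb h1 h2) hq

/-- The point `p` is an end point of a side of a box to its left or below it. -/
def EndsStep (D : Diagram) (p : ℤ × ℤ) : Prop :=
  p - (1, 0) ∈ D.box ∨ p - (0, 1) ∈ D.box ∨ p - (1, 1) ∈ D.box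

theorem Step.endsStep_of_notMem {p q : ℤ × ℤ} (h : D.Step p q) : D.EndsStep q := by
  obtain ⟨x, y⟩ := p
  obtain ⟨x', y'⟩ := q
  rcases step_iff.1 h with ⟨rfl, rfl, h | h⟩ | ⟨rfl, rfl, h | h⟩ <;> simp [EndsStep, h]

theorem IsGood.exists_step_right (hD : D.IsGood) {p : ℤ × ℤ} (hp : p ∉ D.mark)
    (ht : D.EndsStep p) : ∃ q, D.Step p q := by
  obtain ⟨x, y⟩ := p
  by_cases h1 : (x - 1, y) ∈ D.box
  · exact ⟨(x, y + 1), step_iff.2 (Or.inr ⟨rfl, rfl, Or.inr h1⟩)⟩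
  · by_cases h2 : (x, y - 1) ∈ D.box
    · exact ⟨(x + 1, y), step_iff.2 (Or.inl ⟨rfl, rfl, Or.inr h2⟩)⟩
    · have h3 : (x - 1, y - 1) ∈ D.box := by simpa [EndsStep, h1, h2] using ht
      exact absurd (hD.sw_only _ _ h3 h1 h2) hp

/-- `Back L p`: the list `L` is the path from a marked point to `p` whose later points are unmarked
and are lower left corners of boxes. -/
inductive Back (D : Diagram) : List (ℤ × ℤ) → ℤ × ℤ → Prop
  | base (p) (h : p ∈ D.mark) : Back D [p] p
  | snoc (L q p) (h : Back D L q) (hs : D.Step q p) (hp : p ∉ D.mark) (hb : p ∈ D.box) :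
      Back D (L ++ [p]) p

/-- `Fwd p L`: the list `L` is the path from `p` to a marked point whose earlier points are
unmarked and are not lower left corners of boxes. -/
inductive Fwd (D : Diagram) : ℤ × ℤ → List (ℤ × ℤ) → Prop
  | base (p) (h : p ∈ D.mark) : Fwd D p [p]
  | cons (p q L) (h : Fwd D q L) (hs : D.Step p q) (hp : p ∉ D.mark) (hb : p ∉ D.box) :
      Fwd D p (p :: L)

theorem Back.unique (hD : D.IsGood) {L L' : List (ℤ × ℤ)} {p : ℤ × ℤ} (h : D.Back L p)
    (h' : D.Back L' p) : L = L' := by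
  induction h generalizing L' with
  | base p hp =>
    cases h' with
    | base => rfl
    | snoc _ _ _ _ _ hp' => exact absurd hp hp'
  | snoc L q p _ hs hp hb ih =>
    cases h' with
    | base _ hp' => exact absurd hp' hp
    | snoc L1 q1 _ h1 hs1 =>
      obtain rfl := hD.step_left_unique hs hs1 hp hb
      rw [ih h1]

theorem Fwd.unique (hD : D.IsGood) {L L' : List (ℤ × ℤ)} {p : ℤ × ℤ} (h : D.Fwd p L)
    (h' : D.Fwd p L') : L = L' := by
  induction h generalizing L' with
  | base p hp =>
    cases h' with
    | base => rfl
    | cons _ _ _ _ _ hp' => exact absurd hp hp'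
  | cons p q L _ hs hp hb ih =>
    cases h' with
    | base _ hp' => exact absurd hp' hp
    | cons _ q1 L1 h1 hs1 =>
      obtain rfl := hD.step_right_unique hs hs1 hp hb
      rw [ih h1]

theorem Back.exists_eq_cons {L : List (ℤ × ℤ)} {p : ℤ × ℤ} (h : D.Back L p) :
    ∃ x ∈ D.mark, ∃ l, L = x :: l ∧ ∀ z ∈ l, z ∉ D.mark ∧ z ∈ D.box := by
  induction h with
  | base p h => exact ⟨p, h, [], rfl, by simp⟩
  | snoc L q p _ _ hp hb ih =>
    obtain ⟨x, hx, l, rfl, h⟩ := ih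
    refine ⟨x, hx, l ++ [p], rfl, fun z hz => ?_⟩
    rcases List.mem_append.1 hz with hz | hz
    · exact h z hz
    · obtain rfl := List.mem_singleton.1 hz
      exact ⟨hp, hb⟩

theorem Fwd.exists_eq_snoc {L : List (ℤ × ℤ)} {p : ℤ × ℤ} (h : D.Fwd p L) :
    ∃ y ∈ D.mark, ∃ l, L = l ++ [y] ∧ ∀ z ∈ l, z ∉ D.mark ∧ z ∉ D.box := by
  induction h with
  | base p h => exact ⟨p, h, [], rfl, by simp⟩
  | cons p q L _ _ hp hb ih =>
    obtain ⟨x, hx, l, rfl, h⟩ := ih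
    refine ⟨x, hx, p :: l, rfl, fun z hz => ?_⟩
    rcases List.mem_cons.1 hz with rfl | hz
    · exact ⟨hp, hb⟩
    · exact h z hz

theorem Back.getLast? {L : List (ℤ × ℤ)} {p : ℤ × ℤ} (h : D.Back L p) : L.getLast? = some p := by
  cases h <;> simp

theorem Fwd.head? {L : List (ℤ × ℤ)} {p : ℤ × ℤ} (h : D.Fwd p L) : L.head? = some p := by
  cases h <;> simp

theorem Back.isChain {L : List (ℤ × ℤ)} {p : ℤ × ℤ} (h : D.Back L p) : L.IsChain D.Step := by
  induction h with
  | base => simp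
  | snoc L q p h hs _ _ ih =>
    rw [List.isChain_append]
    refine ⟨ih, by simp, ?_⟩
    simp [h.getLast?, hs]

theorem Fwd.isChain {L : List (ℤ × ℤ)} {p : ℤ × ℤ} (h : D.Fwd p L) : L.IsChain D.Step := by
  induction h with
  | base => simp
  | cons p q L h hs _ _ ih =>
    rw [List.isChain_cons]
    refine ⟨?_, ih⟩
    simp [h.head?, hs]

theorem IsGood.exists_bound (hD : D.IsGood) :
    ∃ N : ℤ, ∀ p ∈ D.box, -N ≤ p.1 + p.2 ∧ p.1 + p.2 ≤ N := by
  obtain ⟨s, hs⟩ := hD.finite_box.exists_finset_coe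
  refine ⟨∑ p ∈ s, |p.1 + p.2|, fun p hp => ?_⟩
  have hp' : p ∈ s := by rw [← Finset.mem_coe, hs]; exact hp
  have := Finset.single_le_sum (f := fun p : ℤ × ℤ => |p.1 + p.2|) (fun _ _ => abs_nonneg _) hp'
  exact abs_le.1 this

theorem Step.level {p q : ℤ × ℤ} (h : D.Step p q) : q.1 + q.2 = p.1 + p.2 + 1 := by
  rcases h with ⟨rfl, _⟩ | ⟨rfl, _⟩ <;> simp <;> ring

/-- Walk backwards: each step lowers the sum of the coordinates by one, and this sum is bounded on
the finite set of boxes. -/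
theorem IsGood.exists_back (hD : D.IsGood) {p : ℤ × ℤ} (hp : p ∈ D.mark ∨ p ∈ D.box) :
    ∃ L, D.Back L p := by
  obtain ⟨N, hN⟩ := hD.exists_bound
  have key : ∀ (n : ℕ) (p : ℤ × ℤ), p.1 + p.2 + N < n → p ∈ D.mark ∨ p ∈ D.box →
      ∃ L, D.Back L p := by
    intro n
    induction n with
    | zero =>
      intro p h hp
      rcases hp with hp | hp
      · exact ⟨_, .base p hp⟩
      · have := (hN p hp).1
        push_cast at h
        omega
    | succ n ih =>
      intro p h hp
      by_cases hm : p ∈ D.mark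
      · exact ⟨_, .base p hm⟩
      have hb := hp.resolve_left hm
      obtain ⟨q, hq⟩ := hD.exists_step_left hm hb
      obtain ⟨L, hL⟩ := ih q (by have := hq.level; push_cast at h; omega)
        (Or.inr (hD.box_of_step hq hm hb))
      exact ⟨_, .snoc L q p hL hq hm hb⟩
  exact key (p.1 + p.2 + N + 1).toNat p (by omega) hp

theorem IsGood.exists_fwd (hD : D.IsGood) {p : ℤ × ℤ}
    (hp : p ∈ D.mark ∨ p ∉ D.box ∧ D.EndsStep p) : ∃ L, D.Fwd p L := by
  obtain ⟨N, hN⟩ := hD.exists_bound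
  have hN' : ∀ p, D.EndsStep p → p.1 + p.2 ≤ N + 2 := by
    rintro p (h | h | h) <;> have := (hN _ h).2 <;> simp at this <;> omega
  have key : ∀ (n : ℕ) (p : ℤ × ℤ), N + 2 < p.1 + p.2 + n → p ∈ D.mark ∨ p ∉ D.box ∧ D.EndsStep p →
      ∃ L, D.Fwd p L := by
    intro n
    induction n with
    | zero =>
      intro p h hp
      rcases hp with hp | hp
      · exact ⟨_, .base p hp⟩
      · have := hN' p hp.2
        push_cast at h
        omega
    | succ n ih =>
      intro p h hp
      by_cases hm : p ∈ D.mark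
      · exact ⟨_, .base p hm⟩
      have hb := hp.resolve_left hm
      obtain ⟨q, hq⟩ := hD.exists_step_right hm hb.2
      obtain ⟨L, hL⟩ := ih q (by have := hq.level; push_cast at h; omega) (by
        by_cases hqm : q ∈ D.mark
        · exact Or.inl hqm
        · exact Or.inr ⟨hD.notMem_box_of_step hq hb.1 hqm, hq.endsStep_of_notMem⟩)
      exact ⟨_, .cons p q L hL hq hm hb.1⟩
  exact key (N + 3 - (p.1 + p.2)).toNat p (by omega) hp

end Diagram

/-! ### The bijection between arrows and essential steps -/

namespace Diagram

variable {D : Diagram}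

/-- The list of all points of an arrow. -/
def points (a : D.Arrow) : List (ℤ × ℤ) := a.left.1 :: (a.hom.1 ++ [a.right.1])

theorem points_injective : Function.Injective (points (D := D)) := by
  rintro ⟨⟨x, hx⟩, ⟨y, hy⟩, l, hl⟩ ⟨⟨x', hx'⟩, ⟨y', hy'⟩, l', hl'⟩ h
  simp only [points, List.cons.injEq] at h
  obtain ⟨rfl, h⟩ := h
  obtain ⟨rfl, h2⟩ := List.append_inj' h rfl
  obtain rfl := (List.cons.inj h2).1
  rfl

/-- The end point of the unit step at `s.1` which goes up or to the right according to `s.2`. -/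
def tip (s : (ℤ × ℤ) × Bool) : ℤ × ℤ := s.1 + cond s.2 (0, 1) (1, 0)

theorem step_ext {s s' : (ℤ × ℤ) × Bool} (h : s.1 = s'.1) (h' : tip s = tip s') : s = s' := by
  obtain ⟨p, b⟩ := s
  obtain ⟨p', b'⟩ := s'
  obtain rfl : p = p' := h
  cases b <;> cases b' <;> simp_all [tip]

theorem exists_step_eq {p q : ℤ × ℤ} (h : D.Step p q) : ∃ s : (ℤ × ℤ) × Bool, s.1 = p ∧ tip s = q := by
  rcases h with ⟨rfl, _⟩ | ⟨rfl, _⟩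
  · exact ⟨(p, false), rfl, rfl⟩
  · exact ⟨(p, true), rfl, rfl⟩

/-- A step is essential if it occurs in exactly one arrow. -/
def IsEssential (D : Diagram) (s : (ℤ × ℤ) × Bool) : Prop :=
  D.Step s.1 (tip s) ∧ (s.1 ∈ D.mark ∨ s.1 ∈ D.box) ∧ (tip s ∈ D.mark ∨ tip s ∉ D.box)

/-- The step `s` is the essential step of the arrow `a`. -/
def IsEss (a : D.Arrow) (s : (ℤ × ℤ) × Bool) : Prop :=
  ∃ L L', D.Back L s.1 ∧ D.Fwd (tip s) L' ∧ D.Step s.1 (tip s) ∧ L ++ L' = points a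

theorem Back.mem_or {L : List (ℤ × ℤ)} {p : ℤ × ℤ} (h : D.Back L p) : p ∈ D.mark ∨ p ∈ D.box := by
  cases h with
  | base _ h => exact Or.inl h
  | snoc _ _ _ _ _ _ hb => exact Or.inr hb

theorem Fwd.mem_or {L : List (ℤ × ℤ)} {p : ℤ × ℤ} (h : D.Fwd p L) : p ∈ D.mark ∨ p ∉ D.box := by
  cases h with
  | base _ h => exact Or.inl h
  | cons _ _ _ _ _ _ hb => exact Or.inr hb

theorem IsEss.isEssential {a : D.Arrow} {s : (ℤ × ℤ) × Bool} (h : IsEss a s) : D.IsEssential s := by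
  obtain ⟨L, L', h1, h2, h3, -⟩ := h
  exact ⟨h3, h1.mem_or, h2.mem_or⟩

theorem IsGood.fwd_of_isChain (hD : D.IsGood) (l : List (ℤ × ℤ)) {z y : ℤ × ℤ}
    (h : (z :: (l ++ [y])).IsChain D.Step) (hl : ∀ p ∈ l, p ∉ D.mark) (hz : z ∉ D.mark)
    (hz' : z ∉ D.box) (hy : y ∈ D.mark) : D.Fwd z (z :: (l ++ [y])) := by
  induction l generalizing z with
  | nil => exact .cons _ _ _ (.base y hy) (by simpa using h) hz hz'
  | cons t l ih =>
    rw [List.cons_append, List.isChain_cons_cons] at h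
    exact .cons _ t _ (ih h.2 (fun p hp => hl p (List.mem_cons_of_mem _ hp)) (hl t (by simp))
      (hD.notMem_box_of_step h.1 hz' (hl t (by simp)))) h.1 hz hz'

/-- Along an arrow, the unmarked points first are lower left corners of boxes; once this fails it
fails until the end. The step at which it changes is the essential one. -/
theorem IsGood.exists_split (hD : D.IsGood) (l : List (ℤ × ℤ)) {L : List (ℤ × ℤ)} {p y : ℤ × ℤ}
    (hL : D.Back L p) (h : (p :: (l ++ [y])).IsChain D.Step) (hl : ∀ p ∈ l, p ∉ D.mark)
    (hy : y ∈ D.mark) :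
    ∃ L1 L2 p q, D.Back L1 p ∧ D.Fwd q L2 ∧ D.Step p q ∧ L1 ++ L2 = L ++ (l ++ [y]) := by
  induction l generalizing L p with
  | nil => exact ⟨L, [y], p, y, hL, .base y hy, by simpa using h, rfl⟩
  | cons z l ih =>
    rw [List.cons_append, List.isChain_cons_cons] at h
    by_cases hz : z ∈ D.box
    · obtain ⟨L1, L2, p1, q1, h1, h2, h3, h4⟩ := ih (.snoc L p z hL h.1 (hl z (by simp)) hz) h.2
        fun p hp => hl p (List.mem_cons_of_mem _ hp)
      exact ⟨L1, L2, p1, q1, h1, h2, h3, by rw [h4]; simp⟩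
    · exact ⟨L, z :: (l ++ [y]), p, z, hL, hD.fwd_of_isChain l h.2
        (fun p hp => hl p (List.mem_cons_of_mem _ hp)) (hl z (by simp)) hz hy, h.1, rfl⟩

theorem IsGood.exists_isEss (hD : D.IsGood) (a : D.Arrow) : ∃ s, IsEss a s := by
  obtain ⟨L1, L2, p, q, h1, h2, h3, h4⟩ := hD.exists_split a.hom.1 (.base a.left.1 a.left.2)
    a.hom.2.1 a.hom.2.2 a.right.2
  obtain ⟨s, rfl, rfl⟩ := exists_step_eq h3
  exact ⟨s, L1, L2, h1, h2, h3, h4⟩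

theorem IsEss.eq_arrow (hD : D.IsGood) {a b : D.Arrow} {s : (ℤ × ℤ) × Bool} (ha : IsEss a s)
    (hb : IsEss b s) : a = b := by
  obtain ⟨L, L', h1, h2, -, h4⟩ := ha
  obtain ⟨M, M', k1, k2, -, k4⟩ := hb
  exact points_injective (by rw [← h4, ← k4, h1.unique hD k1, h2.unique hD k2])

/-- If the two decompositions overlapped in a nonempty t, its first point would be on the forward
part of one and on the backward part of the other, where the conditions on boxes exclude each other.
-/
theorem split_unique {L L' M M' : List (ℤ × ℤ)} {p q p' q' : ℤ × ℤ} (hL : D.Back L p)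
    (hL' : D.Fwd q L') (hM : D.Back M p') (hM' : D.Fwd q' M') {t : List (ℤ × ℤ)} (h : M = L ++ t)
    (h' : L' = t ++ M') : p = p' ∧ q = q' := by
  cases t with
  | nil =>
    simp only [List.append_nil, List.nil_append] at h h'
    subst h h'
    exact ⟨by simpa using hL.getLast?.symm.trans hM.getLast?,
      by simpa using hL'.head?.symm.trans hM'.head?⟩
  | cons z t =>
    have h1 := hL'.head?
    rw [h'] at h1
    simp only [List.cons_append, List.head?_cons, Option.some.injEq] at h1
    subst h1
    obtain ⟨x, -, l, rfl, -⟩ := hL.exists_eq_cons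
    obtain ⟨x', -, l', h2, h3⟩ := hM.exists_eq_cons
    rw [h2, List.cons_append, List.cons.injEq] at h
    have := h3 z (by rw [h.2]; simp)
    exact absurd hL'.mem_or (by simp [this])

theorem IsEss.unique {a : D.Arrow} {s s' : (ℤ × ℤ) × Bool} (h : IsEss a s)
    (h' : IsEss a s') : s = s' := by
  obtain ⟨L, L', h1, h2, -, h4⟩ := h
  obtain ⟨M, M', k1, k2, -, k4⟩ := h'
  rw [← k4] at h4
  rcases List.append_eq_append_iff.1 h4 with ⟨t, e1, e2⟩ | ⟨t, e1, e2⟩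
  · have := split_unique h1 h2 k1 k2 e1 e2
    exact step_ext this.1 this.2
  · have := split_unique k1 k2 h1 h2 e1 e2
    exact (step_ext this.1 this.2).symm

/-- Concatenate the backward path from the start of the step with the forward path from its tip. -/
theorem IsGood.exists_arrow (hD : D.IsGood) {s : (ℤ × ℤ) × Bool} (hs : D.IsEssential s) :
    ∃ a : D.Arrow, IsEss a s := by
  obtain ⟨h1, h2, h3⟩ := hs
  obtain ⟨L, hL⟩ := hD.exists_back h2
  obtain ⟨L', hL'⟩ := hD.exists_fwd (h3.imp_right fun h => ⟨h, h1.endsStep_of_notMem⟩)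
  obtain ⟨x, hx, l, rfl, hl⟩ := hL.exists_eq_cons
  obtain ⟨y, hy, l', rfl, hl'⟩ := hL'.exists_eq_snoc
  refine ⟨⟨⟨x, hx⟩, ⟨y, hy⟩, ⟨l ++ l', ?_, ?_⟩⟩, x :: l, l' ++ [y], hL, hL', h1, ?_⟩
  · have : ((x :: l) ++ (l' ++ [y])).IsChain D.Step := by
      rw [List.isChain_append]
      refine ⟨hL.isChain, hL'.isChain, ?_⟩
      rw [hL.getLast?, hL'.head?]
      simpa using h1
    simpa using this
  · intro p hp
    rcases List.mem_append.1 hp with hp | hp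
    · exact (hl p hp).1
    · exact (hl' p hp).1
  · simp [points]

/-- The essential step of an arrow. -/
def IsGood.ess (hD : D.IsGood) (a : D.Arrow) : (ℤ × ℤ) × Bool := (hD.exists_isEss a).choose

theorem IsGood.isEss_ess (hD : D.IsGood) (a : D.Arrow) : IsEss a (hD.ess a) :=
  (hD.exists_isEss a).choose_spec

theorem IsGood.ess_injective (hD : D.IsGood) : Function.Injective hD.ess := by
  intro a b h
  exact (hD.isEss_ess a).eq_arrow hD (h ▸ hD.isEss_ess b)

theorem IsGood.mem_range_ess (hD : D.IsGood) {s : (ℤ × ℤ) × Bool} (hs : D.IsEssential s) :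
    s ∈ Set.range hD.ess := by
  obtain ⟨a, ha⟩ := hD.exists_arrow hs
  exact ⟨a, (hD.isEss_ess a).unique ha⟩

/-- At an unmarked lower left corner of a box, all arrows have the same source. -/
theorem IsGood.left_of_mem (hD : D.IsGood) {L : List (ℤ × ℤ)} {x z : ℤ × ℤ} (h : D.Back (x :: L) z)
    (a : D.Arrow) (hz : z ∈ a.hom.1) (hb : z ∈ D.box) : a.left.1 = x := by
  have key : ∀ (l : List (ℤ × ℤ)) (x' y : ℤ × ℤ) (M : List (ℤ × ℤ)) (p : ℤ × ℤ), D.Back (x' :: M) p →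
      (p :: (l ++ [y])).IsChain D.Step → (∀ p ∈ l, p ∉ D.mark) → z ∈ l → x' = x := by
    intro l
    induction l with
    | nil => simp
    | cons t l ih =>
      intro x' y M p hM hc hl hz
      rw [List.cons_append, List.isChain_cons_cons] at hc
      by_cases ht : t ∈ D.box
      · have h1 := Back.snoc _ _ _ hM hc.1 (hl t (by simp)) ht
        rcases List.mem_cons.1 hz with rfl | hz
        · have := h1.unique hD h
          simp only [List.cons_append, List.cons.injEq] at this
          exact this.1
        · exact ih x' y (M ++ [t]) t h1 hc.2 (fun p hp => hl p (List.mem_cons_of_mem _ hp)) hz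
      · exfalso
        have : ∀ (l : List (ℤ × ℤ)) (t : ℤ × ℤ), t ∉ D.box → (t :: (l ++ [y])).IsChain D.Step →
            (∀ p ∈ t :: l, p ∉ D.mark) → z ∉ t :: l := by
          intro l
          induction l with
          | nil => intro t ht _ _ hz; simp at hz; exact ht (hz ▸ hb)
          | cons r l ih =>
            intro t ht hc hl hz
            rw [List.cons_append, List.isChain_cons_cons] at hc
            rcases List.mem_cons.1 hz with rfl | hz
            · exact ht hb
            · exact ih r (hD.notMem_box_of_step hc.1 ht (hl r (by simp))) hc.2
                (fun p hp => hl p (List.mem_cons_of_mem _ hp)) hz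
        exact this l t ht hc.2 hl hz
  exact key a.hom.1 a.left.1 a.right.1 [] a.left.1 (.base _ a.left.2) a.hom.2.1 a.hom.2.2 hz

/-- At an unmarked point which is not a lower left corner of a box, all arrows have the same
target. -/
theorem IsGood.right_of_mem (hD : D.IsGood) {L : List (ℤ × ℤ)} {y z : ℤ × ℤ}
    (h : D.Fwd z (L ++ [y])) (a : D.Arrow) (hz : z ∈ a.hom.1) (hb : z ∉ D.box) :
    a.right.1 = y := by
  have h1 := a.hom.2.1
  obtain ⟨l1, l2, e⟩ := List.append_of_mem hz
  have h2 : (z :: (l2 ++ [a.right.1])).IsChain D.Step := by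
    rw [e] at h1
    simp only [List.append_assoc, List.cons_append] at h1
    rw [← List.cons_append, List.isChain_append] at h1
    exact h1.2.1
  have h3 := hD.fwd_of_isChain l2 h2 (fun p hp => a.hom.2.2 p (by rw [e]; simp [hp]))
    (a.hom.2.2 z hz) hb a.right.2
  have := h3.unique hD h
  rw [← List.cons_append] at this
  exact (List.cons.inj (List.append_inj' this rfl).2).1

/-- Two arrows that meet at an unmarked point have the same source or the same target. -/
theorem IsGood.left_eq_or_right_eq (hD : D.IsGood) {a b : D.Arrow} {z : ℤ × ℤ} (ha : z ∈ a.hom.1)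
    (hb : z ∈ b.hom.1) : a.left = b.left ∨ a.right = b.right := by
  by_cases hz : z ∈ D.box
  · left
    obtain ⟨L, hL⟩ := hD.exists_back (Or.inr hz)
    obtain ⟨x, -, l, rfl, -⟩ := hL.exists_eq_cons
    exact Subtype.ext ((hD.left_of_mem hL a ha hz).trans (hD.left_of_mem hL b hb hz).symm)
  · right
    obtain ⟨l1, l2, e⟩ := List.append_of_mem ha
    have h1 := a.hom.2.1
    have h2 : (z :: (l2 ++ [a.right.1])).IsChain D.Step := by
      rw [e] at h1
      simp only [List.append_assoc, List.cons_append] at h1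
      rw [← List.cons_append, List.isChain_append] at h1
      exact h1.2.1
    have h3 := hD.fwd_of_isChain l2 h2 (fun p hp => a.hom.2.2 p (by rw [e]; simp [hp]))
      (a.hom.2.2 z ha) hz a.right.2
    exact Subtype.ext (hD.right_of_mem (L := z :: l2) h3 b hb hz).symm

end Diagram

/-! ### Flows on unit steps and circulations around boxes -/

namespace Diagram

variable {D : Diagram}

open Classical in
/-- The marked point attached to a point: the source of the arrows through it if it is the lower
left corner of a box, their target otherwise, and the point itself if it is marked. -/
def lab (D : Diagram) (p : ℤ × ℤ) : ℤ × ℤ :=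
  if h : ∃ x l, D.Back (x :: l) p then h.choose
  else if h : ∃ y l, D.Fwd p (l ++ [y]) then h.choose else p

theorem Back.lab_eq (hD : D.IsGood) {x : ℤ × ℤ} {l : List (ℤ × ℤ)} {p : ℤ × ℤ}
    (h : D.Back (x :: l) p) : D.lab p = x := by
  have h' : ∃ x l, D.Back (x :: l) p := ⟨x, l, h⟩
  rw [lab, dif_pos h']
  obtain ⟨l', hl'⟩ := h'.choose_spec
  exact (List.cons.inj (hl'.unique hD h)).1

theorem lab_of_mem (hD : D.IsGood) {p : ℤ × ℤ} (h : p ∈ D.mark) : D.lab p = p :=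
  (Back.base p h).lab_eq hD

theorem Fwd.lab_eq (hD : D.IsGood) {y : ℤ × ℤ} {l : List (ℤ × ℤ)} {p : ℤ × ℤ}
    (h : D.Fwd p (l ++ [y])) : D.lab p = y := by
  by_cases hp : p ∈ D.mark
  · rw [lab_of_mem hD hp]
    have := h.unique hD (.base p hp)
    have h2 := congrArg List.getLast? this
    simpa using h2.symm
  · have h' : ¬ ∃ x l, D.Back (x :: l) p := by
      rintro ⟨x, l', h'⟩
      exact h'.mem_or.resolve_left hp |> h.mem_or.resolve_left hp
    have h'' : ∃ y l, D.Fwd p (l ++ [y]) := ⟨y, l, h⟩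
    rw [lab, dif_neg h', dif_pos h'']
    obtain ⟨l', hl'⟩ := h''.choose_spec
    have := congrArg List.getLast? (hl'.unique hD h)
    simpa using this

theorem IsEss.lab_fst (hD : D.IsGood) {a : D.Arrow} {s : (ℤ × ℤ) × Bool} (h : IsEss a s) :
    D.lab s.1 = a.left.1 := by
  obtain ⟨L, L', h1, h2, -, h4⟩ := h
  obtain ⟨x, -, l, rfl, -⟩ := h1.exists_eq_cons
  rw [h1.lab_eq hD]
  exact (List.cons.inj h4).1

theorem IsEss.lab_tip (hD : D.IsGood) {a : D.Arrow} {s : (ℤ × ℤ) × Bool} (h : IsEss a s) :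
    D.lab (tip s) = a.right.1 := by
  obtain ⟨L, L', h1, h2, -, h4⟩ := h
  obtain ⟨y, -, l, rfl, -⟩ := h2.exists_eq_snoc
  rw [h2.lab_eq hD]
  have := congrArg List.getLast? h4
  rw [points, ← List.cons_append, ← List.append_assoc, List.getLast?_concat,
    List.getLast?_concat] at this
  exact Option.some.inj this

/-- A nonessential step prolongs either the backward path of its start or the forward path of its
tip, so both ends belong to the same marked point. -/
theorem IsGood.lab_eq_lab (hD : D.IsGood) {s : (ℤ × ℤ) × Bool} (h : D.Step s.1 (tip s))
    (hs : ¬ D.IsEssential s) : D.lab s.1 = D.lab (tip s) := by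
  by_cases h1 : s.1 ∈ D.mark ∨ s.1 ∈ D.box
  · have h2 : ¬ (tip s ∈ D.mark ∨ tip s ∉ D.box) := fun h2 => hs ⟨h, h1, h2⟩
    push Not at h2
    obtain ⟨L, hL⟩ := hD.exists_back h1
    have hL' := Back.snoc L _ _ hL h h2.1 h2.2
    obtain ⟨x, -, l, rfl, -⟩ := hL.exists_eq_cons
    rw [hL.lab_eq hD, Back.lab_eq hD (l := l ++ [tip s]) hL']
  · push Not at h1
    have h2 : tip s ∈ D.mark ∨ tip s ∉ D.box :=
      or_iff_not_imp_left.2 fun h3 => hD.notMem_box_of_step h h1.2 h3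
    obtain ⟨L, hL⟩ := hD.exists_fwd (h2.imp_right fun h' => ⟨h', h.endsStep_of_notMem⟩)
    have hL' := Fwd.cons s.1 _ L hL h h1.1 h1.2
    obtain ⟨y, -, l, rfl, -⟩ := hL.exists_eq_snoc
    rw [hL.lab_eq hD, Fwd.lab_eq hD (l := s.1 :: l) hL']

/-- The net amount of `g` entering a point. -/
def divergence (g : (ℤ × ℤ) × Bool → ℤ) (p : ℤ × ℤ) : ℤ :=
  g (p - (1, 0), false) + g (p - (0, 1), true) - g (p, false) - g (p, true)

/-- Summation by parts: collect the coefficient of `h p`, after shifting the index in the terms that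
involve the tips. -/
theorem finsum_mul_tip_sub (g : (ℤ × ℤ) × Bool → ℤ) (hg : g.support.Finite) (h : ℤ × ℤ → ℤ) :
    ∑ᶠ s, g s * (h (tip s) - h s.1) = ∑ᶠ p, divergence g p * h p := by
  have hb : ∀ b : Bool, (Function.support fun p => g (p, b)).Finite := by
    intro b
    exact (hg.preimage (f := fun p => (p, b)) (fun x _ y _ e => (Prod.mk.inj e).1))
  have e : ∀ (f : (ℤ × ℤ) × Bool → ℤ), f.support.Finite →
      ∑ᶠ s, f s = ∑ᶠ p, f (p, false) + ∑ᶠ p, f (p, true) := by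
    intro f hf
    have hb : ∀ b : Bool, (Function.support fun p => f (p, b)).Finite := by
      intro b
      exact (hf.preimage (f := fun p => (p, b)) (fun x _ y _ e => (Prod.mk.inj e).1))
    rw [← finsum_add_distrib (hb _) (hb _)]
    have : f.support ⊆ (hf.toFinset.image Prod.fst ×ˢ (Finset.univ : Finset Bool) : Finset _) := by
      intro s hs
      simp only [Finset.coe_product, Set.mem_prod, Finset.coe_univ, Set.mem_univ, and_true]
      exact Finset.mem_coe.2 (Finset.mem_image_of_mem _ (by simpa using hs))
    rw [finsum_eq_sum_of_support_subset _ this, Finset.sum_product,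
      finsum_eq_sum_of_support_subset (s := hf.toFinset.image Prod.fst)]
    · refine Finset.sum_congr rfl fun p _ => ?_
      simp [add_comm]
    · intro p hp
      by_contra hp'
      have : ∀ b, f (p, b) = 0 := by
        intro b
        by_contra hc
        exact hp' (Finset.mem_coe.2 (Finset.mem_image.2 ⟨(p, b), by simpa using hc, rfl⟩))
      simp [this] at hp
  have sh : ∀ (b : Bool) (v : ℤ × ℤ), (∑ᶠ p, g (p, b) * h (p + v)) = ∑ᶠ p, g (p - v, b) * h p := by
    intro b v
    rw [← finsum_comp_equiv (Equiv.addRight v) (f := fun p => g (p - v, b) * h p)]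
    simp
  have hm : ∀ (b : Bool) (k : ℤ × ℤ → ℤ), (Function.support fun p => g (p, b) * k p).Finite :=
    fun b k => (hb b).subset (Function.support_mul_subset_left _ _)
  have hm' : ∀ (b : Bool) (v : ℤ × ℤ), (Function.support fun p => g (p - v, b) * h p).Finite := by
    intro b v
    refine Set.Finite.subset ((hb b).preimage (f := fun p => p - v) ?_)
      (Function.support_mul_subset_left _ _)
    intro x _ y _ e
    simpa using e
  rw [e _ (hg.subset (Function.support_mul_subset_left _ _))]
  have e1 : ∀ (b : Bool) (v : ℤ × ℤ), cond b (0, 1) (1, 0) = v →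
      ∑ᶠ p, g (p, b) * (h (tip (p, b)) - h p) =
        ∑ᶠ p, (g (p - v, b) * h p - g (p, b) * h p) := by
    rintro b v rfl
    rw [finsum_sub_distrib (hm' _ _) (hm _ _), ← sh, ← finsum_sub_distrib (hm _ _) (hm _ _)]
    exact finsum_congr fun p => mul_sub _ _ _
  have hs : ∀ (b : Bool) (v : ℤ × ℤ),
      (Function.support fun p => g (p - v, b) * h p - g (p, b) * h p).Finite := fun b v =>
    ((hm' b v).union (hm b h)).subset (Function.support_sub _ _)
  rw [e1 false (1, 0) rfl, e1 true (0, 1) rfl, ← finsum_add_distrib (hs _ _) (hs _ _)]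
  exact finsum_congr fun p => by rw [divergence]; ring

/-- A function on the unit steps without divergence at the unmarked points: the divergence at a
marked point can be computed from the arrows of the ladder quiver. -/
theorem IsGood.sum_ess (hD : D.IsGood) [Fintype D.Arrow] (g : (ℤ × ℤ) × Bool → ℤ)
    (hg : ∀ s, g s ≠ 0 → D.Step s.1 (tip s)) (hg' : ∀ p, p ∉ D.mark → divergence g p = 0)
    (h : ℤ × ℤ → ℤ) :
    ∑ a, g (hD.ess a) * (h a.right.1 - h a.left.1) = ∑ᶠ p, divergence g p * h p := by
  have hfin : g.support.Finite := by
    have hb := hD.finite_box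
    have := ((hb.union (hb.preimage (f := fun p => p - (0, 1)) (by
      intro x _ y _ e; simpa using e))).union
      (hb.preimage (f := fun p => p - (1, 0)) (by intro x _ y _ e; simpa using e))).prod
      (Set.finite_univ : (Set.univ : Set Bool).Finite)
    refine this.subset fun s hs => ⟨?_, trivial⟩
    rcases hg s hs with ⟨-, h | h⟩ | ⟨-, h | h⟩
    · exact Or.inl (Or.inl h)
    · exact Or.inl (Or.inr h)
    · exact Or.inl (Or.inl h)
    · exact Or.inr h
  -- With h replaced by its value at the label, nonessential steps contribute nothing, so the sum
  -- over arrows extends to a sum over all steps.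
  have h1 : ∑ a, g (hD.ess a) * (h a.right.1 - h a.left.1) =
      ∑ᶠ s, g s * (h (D.lab (tip s)) - h (D.lab s.1)) := by
    have h2 : ∀ a, g (hD.ess a) * (h a.right.1 - h a.left.1) =
        (fun s => g s * (h (D.lab (tip s)) - h (D.lab s.1))) (hD.ess a) := by
      intro a
      simp only [(hD.isEss_ess a).lab_fst hD, (hD.isEss_ess a).lab_tip hD]
    rw [← finsum_eq_sum_of_fintype, finsum_congr h2]
    refine (finsum_mem_range (f := fun s => g s * (h (D.lab (tip s)) - h (D.lab s.1)))
      hD.ess_injective).symm.trans ?_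
    rw [finsum_mem_def, Set.indicator_eq_self.2]
    intro s hs
    apply hD.mem_range_ess
    by_contra hc
    apply hs
    by_cases h0 : g s = 0
    · simp [h0]
    · simp [hD.lab_eq_lab (hg s h0) hc]
  rw [h1, finsum_mul_tip_sub g hfin fun p => h (D.lab p)]
  refine finsum_congr fun p => ?_
  by_cases hp : p ∈ D.mark
  · rw [lab_of_mem hD hp]
  · rw [hg' p hp, zero_mul, zero_mul]

open Classical in
/-- The circulation around a box. -/
def loop (β : ℤ × ℤ) (s : (ℤ × ℤ) × Bool) : ℤ :=
  (if s = (β, false) then 1 else 0) - (if s = (β + (0, 1), false) then 1 else 0) -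
    (if s = (β, true) then 1 else 0) + (if s = (β + (1, 0), true) then 1 else 0)

theorem divergence_loop (β p : ℤ × ℤ) : divergence (loop β) p = 0 := by
  obtain ⟨x, y⟩ := β
  obtain ⟨u, v⟩ := p
  simp only [divergence, loop, Prod.mk.injEq, Prod.mk_sub_mk, Prod.mk_add_mk, and_true, and_false,
    reduceCtorEq, if_false]
  have a1 : (u - 1 = x ∧ v - 0 = y) ↔ (u = x + 1 ∧ v = y + 0) := by omega
  have a2 : (u - 1 = x + 0 ∧ v - 0 = y + 1) ↔ (u = x + 1 ∧ v = y + 1) := by omega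
  have a3 : (u - 0 = x ∧ v - 1 = y) ↔ (u = x + 0 ∧ v = y + 1) := by omega
  have a4 : (u - 0 = x + 1 ∧ v - 1 = y + 0) ↔ (u = x + 1 ∧ v = y + 1) := by omega
  have a5 : (u = x ∧ v = y) ↔ (u = x + 0 ∧ v = y + 0) := by omega
  simp only [a1, a2, a3, a4]
  ring

theorem step_of_loop {β : ℤ × ℤ} (hβ : β ∈ D.box) (s : (ℤ × ℤ) × Bool) (h : loop β s ≠ 0) :
    D.Step s.1 (tip s) := by
  have : s = (β, false) ∨ s = (β + (0, 1), false) ∨ s = (β, true) ∨ s = (β + (1, 0), true) := by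
    by_contra hc
    push Not at hc
    simp [loop, hc] at h
  rcases this with rfl | rfl | rfl | rfl
  · exact Or.inl ⟨rfl, Or.inl hβ⟩
  · exact Or.inl ⟨rfl, Or.inr (by simpa using hβ)⟩
  · exact Or.inr ⟨rfl, Or.inl hβ⟩
  · exact Or.inr ⟨rfl, Or.inr (by simpa using hβ)⟩

/-- Circulations around boxes give relations among the weights, that is, characters of the torus. -/
theorem IsGood.sum_loop (hD : D.IsGood) [Fintype D.Arrow] {β : ℤ × ℤ} (hβ : β ∈ D.box)
    (h : ℤ × ℤ → ℤ) : ∑ a, loop β (hD.ess a) * (h a.right.1 - h a.left.1) = 0 := by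
  rw [hD.sum_ess (loop β) (step_of_loop hβ) (fun p _ => divergence_loop β p)]
  simp [divergence_loop]

theorem loop_right (a b x y : ℤ) : loop (a, b) ((x, y), false) =
    (if x = a ∧ y = b then 1 else 0) - (if x = a ∧ y = b + 1 then 1 else 0) := by
  simp [loop]

theorem loop_up (a b x y : ℤ) : loop (a, b) ((x, y), true) =
    (if x = a + 1 ∧ y = b then 1 else 0) - (if x = a ∧ y = b then 1 else 0) := by
  simp [loop]
  ring

theorem IsEssential.exists_loop {s : (ℤ × ℤ) × Bool} (h : D.IsEssential s) :
    ∃ β ∈ D.box, loop β s = 1 ∨ loop β s = -1 := by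
  obtain ⟨h, -⟩ := h
  obtain ⟨⟨x, y⟩, b⟩ := s
  cases b
  · rcases step_iff.1 h with ⟨-, -, h | h⟩ | ⟨h, -⟩
    · exact ⟨_, h, by rw [loop_right]; split_ifs <;> omega⟩
    · exact ⟨_, h, by rw [loop_right]; split_ifs <;> omega⟩
    · simp at h
  · rcases step_iff.1 h with ⟨h, -⟩ | ⟨-, -, h | h⟩
    · simp at h
    · exact ⟨_, h, by rw [loop_up]; split_ifs <;> omega⟩
    · exact ⟨_, h, by rw [loop_up]; split_ifs <;> omega⟩

/-- Parallel steps with the same box values coincide. A horizontal and a vertical step can only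
agree if they border one common box and no other, as its bottom and right sides or as its top and
left sides. They then meet at a corner of the diagram that is unmarked and not the lower left corner
of a box, and the step starting there is not essential. -/
theorem IsGood.exists_loop_ne (hD : D.IsGood) {s t : (ℤ × ℤ) × Bool} (hs : D.IsEssential s)
    (ht : D.IsEssential t) (hst : s ≠ t) : ∃ β ∈ D.box, loop β s ≠ loop β t := by
  by_contra hc
  push Not at hc
  obtain ⟨hs1, hs2, -⟩ := hs
  obtain ⟨ht1, ht2, -⟩ := ht
  -- By symmetry, a mixed pair has s horizontal and t vertical.
  wlog hb : s.2 = false ∨ t.2 = true generalizing s t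
  · refine this hst.symm ?_ ht1 ht2 hs1 hs2 ?_
    · exact fun β hβ => (hc β hβ).symm
    · revert hb; cases s.2 <;> cases t.2 <;> simp
  obtain ⟨⟨x, y⟩, b⟩ := s
  obtain ⟨⟨u, v⟩, b'⟩ := t
  cases b <;> cases b' <;> simp at hb
  · simp only [ne_eq, Prod.mk.injEq, and_true] at hst
    rcases step_iff.1 hs1 with ⟨-, -, h | h⟩ | ⟨h, -⟩
    · have := hc _ h
      rw [loop_right, loop_right] at this
      split_ifs at this <;> omega
    · have := hc _ h
      rw [loop_right, loop_right] at this
      split_ifs at this <;> omega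
    · simp at h
  · by_cases h : (x, y) ∈ D.box
    · have h1 := hc _ h
      rw [loop_right, loop_up] at h1
      obtain ⟨rfl, rfl⟩ : u = x + 1 ∧ v = y := by split_ifs at h1 <;> omega
      have h2 : (x, v - 1) ∉ D.box := by
        intro h2
        have := hc _ h2
        rw [loop_right, loop_up] at this
        split_ifs at this <;> omega
      have h3 : (x + 1, v) ∉ D.box := by
        intro h2
        have := hc _ h2
        rw [loop_right, loop_up] at this
        split_ifs at this <;> omega
      exact ht2.elim (hD.nw_corner _ _ (by simpa using h) h3 (by simpa using h2)) h3
    · have h' : (x, y - 1) ∈ D.box := by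
        rcases step_iff.1 hs1 with ⟨-, -, h' | h'⟩ | ⟨h', -⟩
        · exact absurd h' h
        · exact h'
        · simp at h'
      have h1 := hc _ h'
      rw [loop_right, loop_up] at h1
      obtain ⟨rfl, rfl⟩ : u = x ∧ v = y - 1 := by split_ifs at h1 <;> omega
      have h2 : (u - 1, y - 1) ∉ D.box := by
        intro h2
        have := hc _ h2
        rw [loop_right, loop_up] at this
        split_ifs at this <;> omega
      exact hs2.elim (hD.se_corner _ _ h' h h2) h
  · simp only [ne_eq, Prod.mk.injEq, and_true] at hst
    rcases step_iff.1 hs1 with ⟨h, -⟩ | ⟨-, -, h | h⟩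
    · simp at h
    · have := hc _ h
      rw [loop_up, loop_up] at this
      split_ifs at this <;> omega
    · have := hc _ h
      rw [loop_up, loop_up] at this
      split_ifs at this <;> omega

end Diagram

/-! ### The flow with value one on all essential steps -/

/-- The shape of a ladder diagram: the boxes in column `x` are those between the heights `lo x`
and `hi x`, for `a ≤ x < b`; the upper boundary jumps at the points of `EU`, the lower boundary
at the points of `EL`.  The potentials `up` and `dn` are used to write down a flow on the boundary
of the diagram. -/
structure Profile where
  hi : ℤ → ℤ
  lo : ℤ → ℤ
  up : ℤ → ℤ
  dn : ℤ → ℤ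
  EU : Set ℤ
  EL : Set ℤ
  a : ℤ
  b : ℤ
  lt : ∀ x, a ≤ x → x < b → lo x < hi x
  out : ∀ x, x < a ∨ b ≤ x → hi x = lo x ∧ up x = dn x
  mem_EU : ∀ x ∈ EU, a < x ∧ x ≤ b
  mem_EL : ∀ x ∈ EL, a ≤ x ∧ x < b
  b_mem : b ∈ EU
  a_mem : a ∈ EL
  disj : ∀ x ∈ EL, x ∉ EU
  hi_eq : ∀ x, a < x → x < b → x ∉ EU → hi (x - 1) = hi x
  lo_eq : ∀ x, a < x → x < b → x ∉ EL → lo (x - 1) = lo x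
  up_eq : ∀ x, x ∉ EU → up (x - 1) = up x
  dn_eq : ∀ x, x ∉ EL → dn (x - 1) = dn x
  up_hi : ∀ x ∈ EU, x < b → up x = hi x - x
  up_a : up a = hi a - a
  dn_lo : ∀ x ∈ EL, a < x → dn (x - 1) = lo (x - 1) - x
  dn_b : dn (b - 1) = lo (b - 1) - b
  lo_lt : ∀ x, a < x → x < b → lo x < hi (x - 1) ∧ lo (x - 1) < hi x

namespace Profile

variable (π : Profile)

/-- The diagram `D` has the shape `π`. -/
structure IsShape (D : Diagram) : Prop where
  mem_box : ∀ x y, (x, y) ∈ D.box ↔ π.lo x ≤ y ∧ y < π.hi x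
  mem_mark : ∀ x y, (x, y) ∈ D.mark ↔
    ((x, y) ∈ D.box ∧ (x - 1, y) ∈ D.box ∧ (x, y - 1) ∈ D.box ∧ (x - 1, y - 1) ∈ D.box) ∨
    (x ∈ π.EU ∧ y = π.hi (x - 1)) ∨
    (x ∈ π.EU ∧ x < π.b ∧ y = min (π.hi (x - 1)) (π.hi x)) ∨
    (x ∈ π.EL ∧ y = π.lo x) ∨
    (x ∈ π.EL ∧ π.a < x ∧ y = max (π.lo (x - 1)) (π.lo x))

variable {π} {D : Diagram}

theorem range_of_lt {x y : ℤ} (h : π.lo x ≤ y ∧ y < π.hi x) : π.a ≤ x ∧ x < π.b := by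
  by_contra hc
  have := π.out x (by omega)
  omega

theorem eq_or_mem_EU (x : ℤ) (h1 : π.a < x) (h2 : x < π.b) : x ∈ π.EU ∨ π.hi (x - 1) = π.hi x :=
  or_iff_not_imp_left.2 (π.hi_eq x h1 h2)

theorem eq_or_mem_EL (x : ℤ) (h1 : π.a < x) (h2 : x < π.b) : x ∈ π.EL ∨ π.lo (x - 1) = π.lo x :=
  or_iff_not_imp_left.2 (π.lo_eq x h1 h2)

theorem IsShape.isGood (h : π.IsShape D) (hb : D.box.Finite) : D.IsGood where
  finite_box := hb
  ne_sw x y := by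
    rw [h.mem_mark]
    simp only [h.mem_box]
    intro h1 h2
    have a1 := range_of_lt h1
    have a2 := range_of_lt h2
    have a3 := eq_or_mem_EU x (π := π) (by omega) (by omega)
    have a4 := eq_or_mem_EL x (π := π) (by omega) (by omega)
    grind
  nw_se x y := by
    rw [h.mem_mark]
    simp only [h.mem_box]
    intro h1 h2
    have a1 := range_of_lt h1
    have a2 := range_of_lt h2
    have a3 := eq_or_mem_EU x (π := π) (by omega) (by omega)
    have a4 := eq_or_mem_EL x (π := π) (by omega) (by omega)
    grind
  ne_only x y := by
    rw [h.mem_mark]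
    simp only [h.mem_box]
    intro h1 h2 h3
    have a1 := range_of_lt h1
    rcases a1.1.eq_or_lt with rfl | hx
    · have := π.a_mem
      grind
    have a2 := π.lo_lt x hx a1.2
    have a4 := eq_or_mem_EL x (π := π) (by omega) (by omega)
    grind
  sw_only x y := by
    rw [h.mem_mark]
    simp only [h.mem_box]
    intro h1 h2 h3
    have a1 := range_of_lt h1
    rcases (show x ≤ π.b by omega).eq_or_lt with rfl | hx
    · have := π.b_mem
      grind
    have a2 := π.lo_lt x (by omega) hx
    have a4 := eq_or_mem_EU x (π := π) (by omega) (by omega)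
    grind
  nw_corner x y := by
    rw [h.mem_mark]
    simp only [h.mem_box]
    intro h1 h2 h3
    have a1 := range_of_lt h1
    have a5 := π.mem_EL x
    rcases (show x ≤ π.b by omega).eq_or_lt with rfl | hx
    · grind
    have a2 := π.lo_lt x (by omega) hx
    grind
  se_corner x y := by
    rw [h.mem_mark]
    simp only [h.mem_box]
    intro h1 h2 h3
    have a1 := range_of_lt h1
    have a5 := π.mem_EU x
    rcases a1.1.eq_or_lt with rfl | hx
    · grind
    have a2 := π.lo_lt x hx a1.2
    grind

open Classical in
/-- A piecewise linear function on the plane. -/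
def pot (π : Profile) (x y : ℤ) : ℤ :=
  if y < π.lo x then π.dn x else if π.hi x ≤ y then π.up x else y - x

/-- A flow on the unit steps of the diagram which takes the value one on the essential steps. -/
def flow (π : Profile) : (ℤ × ℤ) × Bool → ℤ
  | ((x, y), false) => π.pot x y - π.pot x (y - 1)
  | ((x, y), true) => π.pot (x - 1) y - π.pot x y -
      (if π.hi (x - 1) ≤ y then π.up (x - 1) - π.up x else 0) -
      (if y < π.lo x then π.dn (x - 1) - π.dn x else 0)

/-- The differences of the potential form a rotated gradient, whose divergence telescopes to zero.
What remains comes from the correction terms that cancel the flow outside the diagram, and these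
change only at the heights `hi (x - 1)` and `lo x`. -/
theorem divergence_flow (x y : ℤ) : Diagram.divergence π.flow (x, y) =
    (if y = π.hi (x - 1) then π.up (x - 1) - π.up x else 0) -
      (if y = π.lo x then π.dn (x - 1) - π.dn x else 0) := by
  simp only [Diagram.divergence, flow, Prod.mk_sub_mk, sub_zero]
  have : ∀ (c : ℤ) (u : ℤ), (if c ≤ y - 1 then u else 0) =
      (if c ≤ y then u else 0) - if y = c then u else 0 := by
    intro c u
    split_ifs <;> omega
  have h2 : ∀ (c : ℤ) (u : ℤ), (if y - 1 < c then u else 0) =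
      (if y < c then u else 0) + if y = c then u else 0 := by
    intro c u
    split_ifs <;> omega
  rw [this, h2]
  ring

theorem IsShape.divergence_flow (h : π.IsShape D) (p : ℤ × ℤ) (hp : p ∉ D.mark) :
    Diagram.divergence π.flow p = 0 := by
  obtain ⟨x, y⟩ := p
  rw [Profile.divergence_flow]
  rw [h.mem_mark] at hp
  have := π.up_eq x
  have := π.dn_eq x
  grind

theorem IsShape.step_of_flow (h : π.IsShape D) (s : (ℤ × ℤ) × Bool) (hs : π.flow s ≠ 0) :
    D.Step s.1 (Diagram.tip s) := by
  obtain ⟨⟨x, y⟩, b⟩ := s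
  by_contra hc
  apply hs
  cases b
  · simp only [Diagram.Step, Diagram.tip, cond_false, true_and, not_or, Prod.mk_sub_mk, sub_zero,
      h.mem_box] at hc
    have := π.out x
    have := π.lt x
    simp only [flow, pot]
    grind
  · simp only [Diagram.Step, Diagram.tip, cond_true, true_and, not_or, Prod.mk_sub_mk, sub_zero,
      h.mem_box] at hc
    have h1 := π.out x
    have h2 := π.lt x
    have h3 := π.out (x - 1)
    have h4 := π.lt (x - 1)
    have h5 := π.up_eq x
    have h6 := π.dn_eq x
    have h7 := π.mem_EU x
    have h8 := π.mem_EL x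
    have h9 := π.lo_lt x
    simp only [flow, pot]
    grind

/-- Between boxes the potential is `y - x`, which gives 1. On the upper boundary only the first step
after a jump is essential, on the lower boundary only the last step before one; `up_hi`, `dn_lo`
and, in the last column, `dn_b` fix the constants so that these also get 1. -/
theorem IsShape.flow_eq_one_right (h : π.IsShape D) {x y : ℤ}
    (hs : D.IsEssential ((x, y), false)) : π.flow ((x, y), false) = 1 := by
  obtain ⟨h1, h2, h3⟩ := hs
  simp only [Diagram.Step, Diagram.tip, cond_false, true_and, Prod.mk_sub_mk, sub_zero,
    h.mem_box, Prod.mk_add_mk, add_zero, h.mem_mark, add_sub_cancel_right] at h1 h2 h3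
  have h1 : (π.lo x ≤ y ∧ y < π.hi x) ∨ (π.lo x ≤ y - 1 ∧ y - 1 < π.hi x) := by simpa using h1
  have hx : π.a ≤ x ∧ x < π.b := by rcases h1 with h1 | h1 <;> exact range_of_lt h1
  have h4 := π.lt x hx.1 hx.2
  have h5 := π.lo_lt x
  have h6 := π.lo_lt (x + 1)
  have h8 := π.eq_or_mem_EL (x + 1)
  have h9 := π.up_hi x
  have h10 := π.dn_lo (x + 1)
  have h11 := π.dn_b
  have h12 := π.mem_EU (x + 1)
  have h13 := π.mem_EU x
  simp only [add_sub_cancel_right] at h6 h8 h10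
  simp only [flow, pot]
  grind

/-- Inside, the potential drops by 1 from one column to the next. On the left side of the diagram
only the topmost step is essential, on the right side only the lowest; the constants `up_a` and
`dn_b` are made for these. -/
theorem IsShape.flow_eq_one_up (h : π.IsShape D) {x y : ℤ}
    (hs : D.IsEssential ((x, y), true)) : π.flow ((x, y), true) = 1 := by
  obtain ⟨h1, h2, h3⟩ := hs
  simp only [Diagram.Step, Diagram.tip, cond_true, true_and, Prod.mk_sub_mk, sub_zero,
    h.mem_box, Prod.mk_add_mk, add_zero, h.mem_mark, add_sub_cancel_right] at h1 h2 h3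
  have h1 : (π.lo x ≤ y ∧ y < π.hi x) ∨ (π.lo (x - 1) ≤ y ∧ y < π.hi (x - 1)) := by
    simpa using h1
  have hx : π.a ≤ x ∧ x ≤ π.b := by
    rcases h1 with h1 | h1 <;> have := range_of_lt h1 <;> omega
  have h12 := π.mem_EU x
  have h13 := π.mem_EL x
  rcases hx.1.eq_or_lt with rfl | hx1
  · have h4 := π.lt π.a
    have h5 := π.out (π.a - 1)
    have h6 := π.up_eq π.a
    have h7 := π.up_a
    simp only [flow, pot]
    grind
  rcases hx.2.eq_or_lt with rfl | hx2
  · have h4 := π.out π.b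
    have h5 := π.lt (π.b - 1)
    simp only [flow, pot]
    grind
  have h5 := π.lo_lt x
  have h7 := π.eq_or_mem_EU x
  have h8 := π.eq_or_mem_EL x
  have h9 := π.up_hi x
  have h10 := π.dn_lo x
  have h11 := π.up_eq x
  have h14 := π.dn_eq x
  have h15 := π.disj x
  have h16 := π.lt x
  have h17 := π.lt (x - 1)
  simp only [flow, pot]
  grind

theorem IsShape.flow_eq_one (h : π.IsShape D) {s : (ℤ × ℤ) × Bool} (hs : D.IsEssential s) :
    π.flow s = 1 := by
  obtain ⟨⟨x, y⟩, b⟩ := s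
  cases b
  · exact h.flow_eq_one_right hs
  · exact h.flow_eq_one_up hs

end Profile

/-! ### Gluing a leg and a rotated leg -/

/-- The shape of the ladder diagram of one leg: `H` is the height of the columns, which jumps at
the points of `E`, the last of which is `len`. -/
structure LegShape (w r : ℤ) where
  H : ℤ → ℤ
  G : ℤ → ℤ
  E : Set ℤ
  len : ℤ
  pos : ∀ x, 0 ≤ x → x < len → 0 < H x
  beyond : ∀ x, len ≤ x → H x = 0 ∧ G x = -len
  mem_E : ∀ x ∈ E, w ≤ x ∧ x ≤ len
  len_mem : len ∈ E
  w_mem : w ∈ E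
  eq : ∀ x, 0 < x → x ∉ E → H (x - 1) = H x ∧ G (x - 1) = G x
  G_eq : ∀ x ∈ E, x < len → G x = H x - x
  first : ∀ x, 0 ≤ x → x < w → H x = r ∧ G x = r

namespace LegShape

variable {w r : ℤ}

/-- The diagram `D` has the shape `A`. -/
structure IsShape (A : LegShape w r) (D : Diagram) : Prop where
  mem_box : ∀ x y, (x, y) ∈ D.box ↔ 0 ≤ x ∧ 0 ≤ y ∧ y < A.H x
  mem_mark : ∀ x y, (x, y) ∈ D.mark ↔ (x = 0 ∧ y = 0) ∨
    ((x, y) ∈ D.box ∧ (x - 1, y) ∈ D.box ∧ (x, y - 1) ∈ D.box ∧ (x - 1, y - 1) ∈ D.box) ∨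
    (x ∈ A.E ∧ y = A.H (x - 1)) ∨
    (x ∈ A.E ∧ x < A.len ∧ y = min (A.H (x - 1)) (A.H x))

/-- The profile of the union of a leg `A` and a rotated leg `B`. -/
def profile (hw : 0 < w) (hr : 0 < r) (A B : LegShape w r) : Profile where
  hi x := if x < w then r else A.H x
  lo x := if 0 ≤ x then 0 else r - B.H (w - 1 - x)
  up x := if x < w then r + B.len - w else A.G x
  dn x := if 0 ≤ x then -A.len else r - w - B.G (w - 1 - x)
  EU := A.E
  EL := {x | w - x ∈ B.E}
  a := w - B.len
  b := A.len
  lt x h1 h2 := by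
    have := A.pos x
    have := B.pos (w - 1 - x)
    grind
  out x h := by
    have h1 := A.mem_E _ A.len_mem
    have h2 := B.mem_E _ B.len_mem
    have h3 := A.beyond x
    have h4 := B.beyond (w - 1 - x)
    grind
  mem_EU x hx := by
    have h1 := A.mem_E x hx
    have h2 := B.mem_E _ B.len_mem
    omega
  mem_EL x hx := by
    have h1 := B.mem_E _ hx
    have h2 := A.mem_E _ A.len_mem
    omega
  b_mem := A.len_mem
  a_mem := by simpa using B.len_mem
  disj x hx hx' := by
    have h1 := B.mem_E _ hx
    have h2 := A.mem_E _ hx'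
    omega
  hi_eq x h1 h2 h3 := by
    have h4 := A.eq x
    have h5 : x ≠ w := fun h => h3 (h ▸ A.w_mem)
    grind
  lo_eq x h1 h2 h3 := by
    have h4 := B.eq (w - x)
    have h5 : x ≠ 0 := fun h => h3 (by simpa [h] using B.w_mem)
    have h6 : w - 1 - (x - 1) = w - x := by ring
    have h7 : w - 1 - x = w - x - 1 := by ring
    rw [h6, h7]
    grind
  up_eq x h3 := by
    have h4 := A.eq x
    have h5 : x ≠ w := fun h => h3 (h ▸ A.w_mem)
    grind
  dn_eq x h3 := by
    have h4 := B.eq (w - x)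
    have h5 : x ≠ 0 := fun h => h3 (by simpa [h] using B.w_mem)
    have h6 : w - 1 - (x - 1) = w - x := by ring
    have h7 : w - 1 - x = w - x - 1 := by ring
    rw [h6, h7]
    grind
  up_hi x h1 h2 := by
    have h3 := A.G_eq x h1 h2
    have h4 := A.mem_E x h1
    grind
  up_a := by
    have h2 := B.mem_E _ B.len_mem
    grind
  dn_lo x h1 h2 := by
    have h4 := B.mem_E _ h1
    have h3 := B.G_eq _ h1 (by omega)
    have h6 : w - 1 - (x - 1) = w - x := by ring
    rw [h6]
    grind
  dn_b := by
    have h1 := A.mem_E _ A.len_mem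
    grind
  lo_lt x h1 h2 := by
    have h3 := A.pos (x - 1)
    have h4 := A.pos x
    have h5 := B.pos (w - 1 - x)
    have h6 := B.pos (w - x)
    have h7 : w - 1 - (x - 1) = w - x := by ring
    rw [h7]
    grind

theorem mem_box_union {A B : LegShape w r} {D D' : Diagram}
    (hD : A.IsShape D) (hD' : B.IsShape D') (x y : ℤ) :
    (x, y) ∈ (D.union (D'.rotate (w, r))).box ↔
      (0 ≤ x ∧ 0 ≤ y ∧ y < A.H x) ∨
      (0 ≤ w - 1 - x ∧ 0 ≤ r - 1 - y ∧ r - 1 - y < B.H (w - 1 - x)) := by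
  rw [← hD.mem_box, ← hD'.mem_box]
  simp only [Diagram.union, Diagram.rotate, Set.mem_union, Set.mem_ofPred_eq, Prod.mk_sub_mk]
  rw [show w - x - 1 = w - 1 - x by ring, show r - y - 1 = r - 1 - y by ring]

theorem mem_box_union_iff_profile (hw : 0 < w) (hr : 0 < r) {A B : LegShape w r} {D D' : Diagram}
    (hD : A.IsShape D) (hD' : B.IsShape D') (x y : ℤ) :
    (x, y) ∈ (D.union (D'.rotate (w, r))).box ↔
      (profile hw hr A B).lo x ≤ y ∧ y < (profile hw hr A B).hi x := by
  rw [mem_box_union hD hD']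
  have h1 := A.first x
  have h2 := B.first (w - 1 - x)
  have h3 := A.beyond x
  have h4 := B.beyond (w - 1 - x)
  have h5 := A.mem_E _ A.len_mem
  have h6 := B.mem_E _ B.len_mem
  have h7 := A.pos x
  have h8 := B.pos (w - 1 - x)
  simp only [profile]
  grind

/-- In the columns `0 ≤ x < w` both legs have the same boxes. The first leg contains the whole
diagram for `x ≥ 0` and the rotated one for `x < w`, and two adjacent columns always fall into one
of these ranges. -/
theorem interior_union (hw : 0 < w) {A B : LegShape w r} {D D' : Diagram}
    (hD : A.IsShape D) (hD' : B.IsShape D') (x y : ℤ) :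
    (((x, y) ∈ D.box ∧ (x - 1, y) ∈ D.box ∧ (x, y - 1) ∈ D.box ∧
      (x - 1, y - 1) ∈ D.box) ∨ ((w - x, r - y) ∈ D'.box ∧ (w - x - 1, r - y) ∈ D'.box ∧
      (w - x, r - y - 1) ∈ D'.box ∧ (w - x - 1, r - y - 1) ∈ D'.box)) ↔
      ((x, y) ∈ (D.union (D'.rotate (w, r))).box ∧ (x - 1, y) ∈ (D.union (D'.rotate (w, r))).box ∧
        (x, y - 1) ∈ (D.union (D'.rotate (w, r))).box ∧
        (x - 1, y - 1) ∈ (D.union (D'.rotate (w, r))).box) := by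
  have h1 := A.first x
  have h2 := A.first (x - 1)
  have h3 := B.first (w - x)
  have h4 := B.first (w - x - 1)
  have h6 : w - 1 - (x - 1) = w - x := by ring
  have h7 : w - 1 - x = w - x - 1 := by ring
  have h8 : r - 1 - (y - 1) = r - y := by ring
  have h9 : r - 1 - y = r - y - 1 := by ring
  simp only [mem_box_union hD hD', hD.mem_box, hD'.mem_box]
  rw [h6, h7, h8, h9]
  grind

/-- Bookkeeping for marked points: the origin of each leg is already a marked boundary point of the
other leg, so it can be absorbed. -/
theorem or_or_iff {p q i i' u u' l l' : Prop} (h : p → l) (h' : q → u) :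
    (p ∨ i ∨ u ∨ u') ∨ (q ∨ i' ∨ l ∨ l') ↔ (i ∨ i') ∨ u ∨ u' ∨ l ∨ l' := by
  tauto

theorem isShape_union (hw : 0 < w) (hr : 0 < r) {A B : LegShape w r} {D D' : Diagram}
    (hD : A.IsShape D) (hD' : B.IsShape D') :
    (profile hw hr A B).IsShape (D.union (D'.rotate (w, r))) := by
  refine ⟨mem_box_union_iff_profile hw hr hD hD', fun x y => ?_⟩
  have hm : (x, y) ∈ (D.union (D'.rotate (w, r))).mark ↔
      (x, y) ∈ D.mark ∨ (w - x, r - y) ∈ D'.mark := by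
    simp [Diagram.union, Diagram.rotate]
  have a1 := A.mem_E x
  have a2 := B.mem_E (w - x)
  have a3 := A.mem_E _ A.len_mem
  have a4 := B.mem_E _ B.len_mem
  have e1 : (x ∈ A.E ∧ y = A.H (x - 1)) ↔
      (x ∈ (profile hw hr A B).EU ∧ y = (profile hw hr A B).hi (x - 1)) := by
    have h1 := A.first (x - 1)
    simp only [profile]
    grind
  have e2 : (x ∈ A.E ∧ x < A.len ∧ y = min (A.H (x - 1)) (A.H x)) ↔
      (x ∈ (profile hw hr A B).EU ∧ x < (profile hw hr A B).b ∧
        y = min ((profile hw hr A B).hi (x - 1)) ((profile hw hr A B).hi x)) := by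
    have h1 := A.first (x - 1)
    simp only [profile]
    grind
  have e3 : (w - x ∈ B.E ∧ r - y = B.H (w - x - 1)) ↔
      (x ∈ (profile hw hr A B).EL ∧ y = (profile hw hr A B).lo x) := by
    have h1 := B.first (w - 1 - x)
    have h7 : w - x - 1 = w - 1 - x := by ring
    rw [h7]
    simp only [profile, Set.mem_ofPred_eq]
    grind
  have e4 : (w - x ∈ B.E ∧ w - x < B.len ∧ r - y = min (B.H (w - x - 1)) (B.H (w - x))) ↔
      (x ∈ (profile hw hr A B).EL ∧ (profile hw hr A B).a < x ∧
        y = max ((profile hw hr A B).lo (x - 1)) ((profile hw hr A B).lo x)) := by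
    have h1 := B.first (w - 1 - x)
    have h6 : w - 1 - (x - 1) = w - x := by ring
    have h7 : w - x - 1 = w - 1 - x := by ring
    refine and_congr_right fun hx => ?_
    have hx' := a2 hx
    have l1 : (profile hw hr A B).lo x = r - B.H (w - 1 - x) := by
      simp only [profile]
      grind
    have l2 : (profile hw hr A B).lo (x - 1) = r - B.H (w - x) := by
      simp only [profile]
      grind
    have l3 : (profile hw hr A B).a = w - B.len := rfl
    rw [h7, l1, l2, l3]
    omega
  have e5 : (x = 0 ∧ y = 0) →
      (x ∈ (profile hw hr A B).EL ∧ y = (profile hw hr A B).lo x) := by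
    have h1 := B.w_mem
    simp only [profile, Set.mem_ofPred_eq]
    rintro ⟨rfl, rfl⟩
    simpa using h1
  have e6 : (w - x = 0 ∧ r - y = 0) →
      (x ∈ (profile hw hr A B).EU ∧ y = (profile hw hr A B).hi (x - 1)) := by
    have h1 := A.w_mem
    simp only [profile]
    grind
  rw [hm, hD.mem_mark, hD'.mem_mark, ← interior_union hw hD hD', ← e1, ← e2, ← e3, ← e4]
  rw [← e3] at e5
  rw [← e1] at e6
  exact or_or_iff e5 e6

end LegShape

/-! ### The structure of Y-shaped quivers -/

namespace DimQuiver

variable {Q : DimQuiver}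

theorem IsQuiverFlag.lt_of_pos (hQ : Q.IsQuiverFlag) {i j : Q.Vtx} (h : 0 < Q.n i j) : i < j := by
  by_contra hc
  have := hQ.acyclic i j (not_lt.1 hc)
  omega

theorem IsQuiverFlag.le_of_reach (hQ : Q.IsQuiverFlag) {i j : Q.Vtx}
    (h : Relation.ReflTransGen (fun a b => 0 < Q.n a b) i j) : i ≤ j := by
  induction h with
  | refl => exact le_rfl
  | tail _ h ih => exact ih.trans (hQ.lt_of_pos h).le

theorem one_ne_zero' : (1 : Q.Vtx) ≠ 0 := by simp

theorem le_pred {i j : Q.Vtx} (h : 0 < Q.n j i) : j ≤ Q.pred i :=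
  Finset.le_sup (f := id) (Finset.mem_filter.2 ⟨Finset.mem_univ _, h⟩)

theorem n_pred_pos {i j : Q.Vtx} (h : 0 < Q.n j i) : 0 < Q.n (Q.pred i) i := by
  obtain ⟨k, hk, e⟩ := Finset.exists_mem_eq_sup (Finset.univ.filter fun j => 0 < Q.n j i)
    ⟨j, Finset.mem_filter.2 ⟨Finset.mem_univ _, h⟩⟩ id
  rw [pred, e]
  exact (Finset.mem_filter.1 hk).2

theorem IsQuiverFlag.n_pred_pos (hQ : Q.IsQuiverFlag) {i : Q.Vtx} (hi : i ≠ 0) :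
    0 < Q.n (Q.pred i) i := by
  obtain ⟨j, hj⟩ := hQ.source i hi
  exact DimQuiver.n_pred_pos hj

theorem IsQuiverFlag.pred_lt (hQ : Q.IsQuiverFlag) {i : Q.Vtx} (hi : i ≠ 0) : Q.pred i < i :=
  hQ.lt_of_pos (hQ.n_pred_pos hi)

theorem IsQuiverFlag.pred_one (hQ : Q.IsQuiverFlag) : Q.pred 1 = 0 := by
  have := hQ.pred_lt (i := 1) one_ne_zero'
  rw [Fin.lt_def, Fin.val_one] at this
  exact Fin.ext (by simpa using this)

theorem pred_ne_zero (hQ : Q.IsQuiverFlag) (hY : Q.IsYShaped) {i : Q.Vtx} (hi : i ≠ 0)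
    (hi' : i ≠ 1) : Q.pred i ≠ 0 := by
  rcases Relation.ReflTransGen.cases_tail (hY.reach i hi) with h | ⟨j, h1, h2⟩
  · exact absurd h hi'
  · have h3 := (hQ.le_of_reach h1).trans (le_pred h2)
    intro h4
    rw [h4] at h3
    simp at h3

theorem eq_pred (hY : Q.IsYShaped) {i j : Q.Vtx} (hj : j ≠ 0)
    (h : 0 < Q.n j i) : j = Q.pred i := by
  have hp := n_pred_pos h
  have hp0 : Q.pred i ≠ 0 := fun h0 => by
    have := le_pred h
    rw [h0] at this
    exact hj (le_antisymm this (Fin.zero_le _))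
  by_contra hc
  have h1 := hY.into i
  have h2 := Finset.sum_le_sum_of_subset (f := fun k : Q.NonSource => Q.n k.1 i)
    (Finset.subset_univ {(⟨j, hj⟩ : Q.NonSource), ⟨Q.pred i, hp0⟩})
  rw [Finset.sum_pair (by simpa using hc)] at h2
  dsimp only at h2
  omega

theorem n_pred (hQ : Q.IsQuiverFlag) (hY : Q.IsYShaped) {i : Q.Vtx} (hi : i ≠ 0)
    (hi' : i ≠ 1) : Q.n (Q.pred i) i = 1 := by
  have h1 := hY.into i
  have h2 := Finset.single_le_sum (f := fun k : Q.NonSource => Q.n k.1 i) (fun _ _ => Nat.zero_le _)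
    (Finset.mem_univ ⟨Q.pred i, pred_ne_zero hQ hY hi hi'⟩)
  have := hQ.n_pred_pos hi
  dsimp only at h2
  omega

/-- All arrows into i come from the source, apart from a single one from the predecessor. This turns
the sums for `s i` and for the number of paths into one-term recursions. -/
theorem n_eq (hQ : Q.IsQuiverFlag) (hY : Q.IsYShaped) {i : Q.Vtx} (hi : i ≠ 0) (j : Q.Vtx) :
    Q.n j i = (if j = 0 then Q.n 0 i else 0) + if i ≠ 1 ∧ j = Q.pred i then 1 else 0 := by
  by_cases hj : j = 0
  · subst hj
    rw [if_pos rfl, if_neg, add_zero]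
    rintro ⟨h1, h2⟩
    exact pred_ne_zero hQ hY hi h1 h2.symm
  · rw [if_neg hj, zero_add]
    split_ifs with h
    · rw [h.2, n_pred hQ hY hi h.1]
    · by_contra hc
      have h1 := eq_pred hY hj (Nat.pos_of_ne_zero hc)
      have h2 : i = 1 := by tauto
      rw [h2, hQ.pred_one] at h1
      exact hj h1

theorem s_eq (hQ : Q.IsQuiverFlag) (hY : Q.IsYShaped) {i : Q.Vtx} (hi : i ≠ 0) :
    Q.s i = Q.n 0 i + if i ≠ 1 then Q.r (Q.pred i) else 0 := by
  rw [s, Finset.sum_congr rfl fun j _ => by rw [n_eq hQ hY hi j]]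
  by_cases h1 : i = 1 <;> simp [add_mul, Finset.sum_add_distrib, h1, hQ.r_zero]

theorem numPaths_eq (hQ : Q.IsQuiverFlag) (hY : Q.IsYShaped) {i : Q.Vtx} (hi : i ≠ 0) :
    Q.numPaths i = Q.n 0 i + if i ≠ 1 then Q.numPaths (Q.pred i) else 0 := by
  rw [numPaths, if_neg hi]
  have h0 : Q.numPaths 0 = 1 := by rw [numPaths, if_pos rfl]
  have : ∑ j : {j : Q.Vtx // j < i}, Q.n j.1 i * Q.numPaths j.1 = ∑ j, Q.n j i * Q.numPaths j := by
    rw [← Finset.sum_subtype (Finset.univ.filter (· < i)) (by simp)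
      fun j => Q.n j i * Q.numPaths j]
    refine Finset.sum_filter_of_ne fun j _ hj => ?_
    exact hQ.lt_of_pos (Nat.pos_of_ne_zero fun h => hj (by rw [h, zero_mul]))
  rw [this, Finset.sum_congr rfl fun j _ => by rw [n_eq hQ hY hi j]]
  by_cases h1 : i = 1 <;> simp [add_mul, Finset.sum_add_distrib, h1, h0]

theorem w_zero (hQ : Q.IsQuiverFlag) : Q.w 0 = 0 := by
  rw [w, numPaths, if_pos rfl, hQ.r_zero]
  simp

/-- Both recursions contain the same number of arrows from the source, which cancels. The width of
the i-th rectangle is thus `s_i - r_i`, which is positive. -/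
theorem w_sub_w_pred (hQ : Q.IsQuiverFlag) (hY : Q.IsYShaped) {i : Q.Vtx} (hi : i ≠ 0) :
    Q.w i - Q.w (Q.pred i) = Q.s i - Q.r i := by
  by_cases h1 : i = 1
  · subst h1
    rw [hQ.pred_one, w_zero hQ, w, numPaths_eq hQ hY hi, s_eq hQ hY hi]
    simp
  · rw [w, w, numPaths_eq hQ hY hi, s_eq hQ hY hi, if_pos h1, if_pos h1]
    push_cast
    ring

theorem w_pred_lt (hQ : Q.IsQuiverFlag) (hY : Q.IsYShaped) {i : Q.Vtx} (hi : i ≠ 0) :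
    Q.w (Q.pred i) < Q.w i := by
  have := w_sub_w_pred hQ hY hi
  have := hQ.r_lt i hi
  omega

theorem s'_eq (hQ : Q.IsQuiverFlag) (hY : Q.IsYShaped) {i : Q.Vtx} (hi : i ≠ 0) :
    Q.s' i = ∑ j, if j ≠ 0 ∧ j ≠ 1 ∧ Q.pred j = i then Q.r j else 0 := by
  rw [s']
  refine Finset.sum_congr rfl fun j _ => ?_
  by_cases hj : j = 0
  · subst hj
    simp [hQ.acyclic i 0 (Fin.zero_le _)]
  · rw [n_eq hQ hY hj i, if_neg hi, zero_add, ite_mul]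
    simp [hj, eq_comm]

theorem pred_injective_of_ne_one (hQ : Q.IsQuiverFlag) (hY : Q.IsYShaped) {i j : Q.Vtx}
    (hi : i ≠ 0) (hi' : i ≠ 1) (hj : j ≠ 0) (hj' : j ≠ 1) (h : Q.pred i = Q.pred j)
    (h' : Q.pred i ≠ 1) : i = j := by
  by_contra hc
  have h1 := hY.out_other _ (pred_ne_zero hQ hY hi hi') h'
  have h2 := Finset.sum_le_sum_of_subset (f := fun k => Q.n (Q.pred i) k)
    (Finset.subset_univ {i, j})
  rw [Finset.sum_pair hc, n_pred hQ hY hi hi', h, n_pred hQ hY hj hj', ← h] at h2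
  omega

/-- The set `I` consists of the non-source vertices on a path of the quiver that starts at `1`. -/
structure IsLeg (Q : DimQuiver) (I : Set Q.Vtx) : Prop where
  zero_notMem : 0 ∉ I
  one_mem : 1 ∈ I
  pred_mem : ∀ i ∈ I, i ≠ 1 → Q.pred i ∈ I
  inj : ∀ i ∈ I, i ≠ 1 → ∀ j ∈ I, j ≠ 1 → Q.pred i = Q.pred j → i = j

/-- The properties of the partition of the non-source vertices into two legs. -/
structure IsSplit (Q : DimQuiver) (S : Set Q.Vtx) : Prop where
  one_notMem : 1 ∉ S
  first : Q.IsLeg (insert 1 S)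
  second : Q.IsLeg {i | i ≠ 0 ∧ i ∉ S}

/-- Only vertex 1 can have two successors. Taking out the descendants of one of them leaves two sets
on which a vertex is determined by its predecessor. -/
theorem IsFirstLeg.isSplit (hQ : Q.IsQuiverFlag) (hY : Q.IsYShaped) {S : Set Q.Vtx}
    (hS : Q.IsFirstLeg S) : Q.IsSplit S := by
  rcases hS with ⟨h1, rfl⟩ | ⟨h1, k, hk, rfl⟩
  · refine ⟨by simp, ⟨by simp, by simp, by simp, by simp⟩, ⟨by simp, by simp, ?_, ?_⟩⟩
    · rintro i ⟨hi, -⟩ hi'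
      exact ⟨pred_ne_zero hQ hY hi hi', by simp⟩
    · rintro i ⟨hi, -⟩ hi' j ⟨hj, -⟩ hj' h
      by_cases hp : Q.pred i = 1
      · by_contra hc
        have h2 := Finset.sum_le_sum_of_subset (f := fun k => Q.n 1 k)
          (Finset.subset_univ {i, j})
        have h3 := n_pred hQ hY hi hi'
        have h4 := n_pred hQ hY hj hj'
        rw [hp] at h3
        rw [← h, hp] at h4
        rw [Finset.sum_pair hc, h3, h4] at h2
        omega
      · exact pred_injective_of_ne_one hQ hY hi hi' hj hj' h hp
  · have hk1 : (1 : Q.Vtx) < k := hQ.lt_of_pos hk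
    have hk0 : k ≠ 0 := fun h => by simp [h] at hk1
    have hmem : ∀ i, Relation.ReflTransGen (fun a b => 0 < Q.n a b) k i → 1 < i := fun i hi =>
      hk1.trans_le (hQ.le_of_reach hi)
    have hne : ∀ i, Relation.ReflTransGen (fun a b => 0 < Q.n a b) k i → i ≠ 0 ∧ i ≠ 1 := by
      intro i hi
      have := hmem i hi
      exact ⟨fun h => by simp [h] at this, this.ne'⟩
    have hpk : Q.pred k = 1 := (eq_pred hY one_ne_zero' hk).symm
    have hpred : ∀ i, Relation.ReflTransGen (fun a b => 0 < Q.n a b) k i → i = k ∨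
        Relation.ReflTransGen (fun a b => 0 < Q.n a b) k (Q.pred i) := by
      intro i hi
      rcases Relation.ReflTransGen.cases_tail hi with h | ⟨j, h2, h3⟩
      · exact Or.inl h
      · right
        rwa [← eq_pred hY (hne j h2).1 h3]
    have hone : ∀ i, Relation.ReflTransGen (fun a b => 0 < Q.n a b) k i → Q.pred i = 1 → i = k :=
      fun i hi h => (hpred i hi).resolve_right fun h' => (hne _ h').2 h
    refine ⟨fun h => (hne 1 h).2 rfl, ⟨?_, by simp, ?_, ?_⟩, ⟨by simp, ?_, ?_, ?_⟩⟩
    · rintro (h | h)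
      · simp at h
      · exact (hne 0 h).1 rfl
    · rintro i (hi | hi) hi'
      · exact absurd hi hi'
      · rcases hpred i hi with rfl | h
        · exact Or.inl hpk
        · exact Or.inr h
    · rintro i (hi | hi) hi' j (hj | hj) hj' h
      · exact absurd hi hi'
      · exact absurd hi hi'
      · exact absurd hj hj'
      · by_cases hp : Q.pred i = 1
        · rw [hone i hi hp, hone j hj (h ▸ hp)]
        · exact pred_injective_of_ne_one hQ hY (hne i hi).1 hi' (hne j hj).1 hj' h hp
    · exact ⟨one_ne_zero', fun h => (hne 1 h).2 rfl⟩
    · rintro i ⟨hi, hiS⟩ hi'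
      exact ⟨pred_ne_zero hQ hY hi hi', fun h => hiS (h.tail (hQ.n_pred_pos hi))⟩
    · rintro i ⟨hi, hiS⟩ hi' j ⟨hj, hjS⟩ hj' h
      by_cases hp : Q.pred i = 1
      · by_contra hc
        have hik : i ≠ k := fun h => hiS (h ▸ .refl)
        have hjk : j ≠ k := fun h => hjS (h ▸ .refl)
        -- Two further successors of 1 besides k would give three arrows out of 1.
        have h2 := Finset.sum_le_sum_of_subset (f := fun k => Q.n 1 k)
          (Finset.subset_univ {k, i, j})
        have h3 := n_pred hQ hY hi hi'
        have h4 := n_pred hQ hY hj hj'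
        rw [hp] at h3
        rw [← h, hp] at h4
        rw [Finset.sum_insert (by simp [hik.symm, hjk.symm]), Finset.sum_pair hc, h3, h4] at h2
        omega
      · exact pred_injective_of_ne_one hQ hY hi hi' hj hj' h hp

end DimQuiver

/-! ### The ladder diagram of one leg -/

namespace DimQuiver

variable {Q : DimQuiver} {I : Set Q.Vtx}

namespace IsLeg

theorem ne_zero (hI : Q.IsLeg I) {i : Q.Vtx} (hi : i ∈ I) : i ≠ 0 :=
  fun h => hI.zero_notMem (h ▸ hi)

theorem one_le (hI : Q.IsLeg I) {i : Q.Vtx} (hi : i ∈ I) : 1 ≤ i := by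
  rw [Fin.le_def, Fin.val_one]
  exact Nat.one_le_iff_ne_zero.2 fun h => hI.ne_zero hi (Fin.ext h)

/-- A leg is a chain in which nothing lies strictly between a vertex and its predecessor. If `pred j
< i < j`, the induction hypotheses give `pred i ≤ pred j` and `pred j ≤ pred i`, and injectivity of
the predecessor forces `i = j`. -/
theorem le_pred (hQ : Q.IsQuiverFlag) (hI : Q.IsLeg I) {j : Q.Vtx} (hj : j ∈ I) :
    ∀ i ∈ I, i < j → i ≤ Q.pred j := by
  induction j using WellFoundedLT.induction with
  | ind j ihj =>
    intro i hi
    induction i using WellFoundedLT.induction with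
    | ind i ihi =>
      intro hij
      have hj1 : j ≠ 1 := fun h => absurd (hI.one_le hi) (not_le.2 (h ▸ hij))
      by_cases h1 : i = 1
      · rw [h1]
        exact hI.one_le (hI.pred_mem j hj hj1)
      · by_contra hc
        have h2 := hQ.pred_lt (hI.ne_zero hi)
        have h3 := ihi (Q.pred i) h2 (hI.pred_mem i hi h1) (h2.trans hij)
        have h4 := ihj i hij hi (Q.pred j) (hI.pred_mem j hj hj1) (not_le.1 hc)
        exact hij.ne (hI.inj i hi h1 j hj hj1 (le_antisymm h3 h4))

variable (hQ : Q.IsQuiverFlag) (hY : Q.IsYShaped) (hI : Q.IsLeg I)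
include hQ hY hI

theorem w_lt {i j : Q.Vtx} (hi : i ∈ I) (hj : j ∈ I) (h : i < j) : Q.w i < Q.w j := by
  induction j using WellFoundedLT.induction with
  | ind j ih =>
    have hj1 : j ≠ 1 := fun e => absurd (hI.one_le hi) (not_le.2 (e ▸ h))
    have h1 := w_pred_lt hQ hY (hI.ne_zero hj)
    rcases (hI.le_pred hQ hj i hi h).eq_or_lt with h2 | h2
    · rwa [← h2] at h1
    · exact (ih _ (hQ.pred_lt (hI.ne_zero hj)) (hI.pred_mem j hj hj1) h2).trans h1

theorem w_le {i j : Q.Vtx} (hi : i ∈ I) (hj : j ∈ I) (h : i ≤ j) : Q.w i ≤ Q.w j := by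
  rcases h.eq_or_lt with rfl | h
  · exact le_rfl
  · exact (hI.w_lt hQ hY hi hj h).le

theorem w_injOn : Set.InjOn Q.w I := by
  intro i hi j hj h
  rcases lt_trichotomy i j with h1 | h1 | h1
  · exact absurd h (hI.w_lt hQ hY hi hj h1).ne
  · exact h1
  · exact absurd h (hI.w_lt hQ hY hj hi h1).ne'

theorem le_w_pred {i j : Q.Vtx} (hi : i ∈ I) (hj : j ∈ I) (h : i < j) :
    Q.w i ≤ Q.w (Q.pred j) :=
  hI.w_le hQ hY hi (hI.pred_mem j hj fun e => absurd (hI.one_le hi) (not_le.2 (e ▸ h)))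
    (hI.le_pred hQ hj i hi h)

theorem eq_of_mem_column {i j : Q.Vtx} (hi : i ∈ I) (hj : j ∈ I) {x : ℤ}
    (h1 : Q.w (Q.pred i) ≤ x) (h2 : x < Q.w i) (h3 : Q.w (Q.pred j) ≤ x) (h4 : x < Q.w j) :
    i = j := by
  rcases lt_trichotomy i j with h | h | h
  · have := hI.le_w_pred hQ hY hi hj h
    omega
  · exact h
  · have := hI.le_w_pred hQ hY hj hi h
    omega

omit hQ hY in
theorem exists_last : ∃ k ∈ I, ∀ i ∈ I, i ≤ k := by
  classical
  obtain ⟨k, hk, h⟩ := Set.exists_max_image I id (Set.toFinite I) ⟨1, hI.one_mem⟩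
  exact ⟨k, hk, h⟩

omit hY in
-- The first vertex whose rectangle ends to the right of x has a predecessor whose rectangle does
-- not.
theorem exists_column {x : ℤ} (hx : 0 ≤ x) {k : Q.Vtx} (hk : k ∈ I) (hxk : x < Q.w k) :
    ∃ i ∈ I, Q.w (Q.pred i) ≤ x ∧ x < Q.w i := by
  obtain ⟨i, ⟨hi, hi'⟩, h⟩ := Set.exists_min_image {i | i ∈ I ∧ x < Q.w i} id (Set.toFinite _)
    ⟨k, hk, hxk⟩
  refine ⟨i, hi, ?_, hi'⟩
  by_cases h1 : i = 1
  · rw [h1, hQ.pred_one, w_zero hQ]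
    exact hx
  · by_contra hc
    exact absurd (h _ ⟨hI.pred_mem i hi h1, not_le.1 hc⟩)
      (not_le.2 (hQ.pred_lt (hI.ne_zero hi)))

omit hY in
theorem exists_next {i k : Q.Vtx} (hi : i ∈ I) (hk : k ∈ I) (h : i < k) :
    ∃ j ∈ I, j ≠ 1 ∧ Q.pred j = i := by
  obtain ⟨j, ⟨hj, hij⟩, hmin⟩ := Set.exists_min_image {j | j ∈ I ∧ i < j} id (Set.toFinite _)
    ⟨k, hk, h⟩
  have hj1 : j ≠ 1 := fun e => absurd (hI.one_le hi) (not_le.2 (e ▸ hij))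
  refine ⟨j, hj, hj1, ?_⟩
  by_contra hc
  have h1 := hI.le_pred hQ hj i hi hij
  exact absurd (hmin (Q.pred j) ⟨hI.pred_mem j hj hj1, h1.lt_of_ne' hc⟩)
    (not_le.2 (hQ.pred_lt (hI.ne_zero hj)))

omit hQ hY in
/-- The last vertex of a leg. -/
def last : Q.Vtx := hI.exists_last.choose

omit hQ hY in
theorem last_mem : hI.last ∈ I := hI.exists_last.choose_spec.1

omit hQ hY in
theorem le_last {i : Q.Vtx} (hi : i ∈ I) : i ≤ hI.last := hI.exists_last.choose_spec.2 i hi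

end IsLeg

open Classical in
/-- The height of the columns of the ladder diagram of a leg. -/
def legHeight (Q : DimQuiver) (I : Set Q.Vtx) (x : ℤ) : ℤ :=
  if h : ∃ i ∈ I, Q.w (Q.pred i) ≤ x ∧ x < Q.w i then Q.r h.choose else 0

open Classical in
/-- The potential above the columns of the ladder diagram of a leg. -/
def legPot (Q : DimQuiver) (I : Set Q.Vtx) (l x : ℤ) : ℤ :=
  if h : ∃ i ∈ I, Q.w (Q.pred i) ≤ x ∧ x < Q.w i then Q.r h.choose - Q.w (Q.pred h.choose) else -l

section

variable (hQ : Q.IsQuiverFlag) (hY : Q.IsYShaped) (hI : Q.IsLeg I)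
include hQ hY hI

theorem legHeight_eq {i : Q.Vtx} (hi : i ∈ I) {x : ℤ} (h1 : Q.w (Q.pred i) ≤ x) (h2 : x < Q.w i) :
    Q.legHeight I x = Q.r i := by
  have h : ∃ i ∈ I, Q.w (Q.pred i) ≤ x ∧ x < Q.w i := ⟨i, hi, h1, h2⟩
  rw [legHeight, dif_pos h]
  obtain ⟨h3, h4, h5⟩ := h.choose_spec
  rw [hI.eq_of_mem_column hQ hY h3 hi h4 h5 h1 h2]

theorem legPot_eq {i : Q.Vtx} (hi : i ∈ I) {x : ℤ} (l : ℤ) (h1 : Q.w (Q.pred i) ≤ x)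
    (h2 : x < Q.w i) : Q.legPot I l x = Q.r i - Q.w (Q.pred i) := by
  have h : ∃ i ∈ I, Q.w (Q.pred i) ≤ x ∧ x < Q.w i := ⟨i, hi, h1, h2⟩
  rw [legPot, dif_pos h]
  obtain ⟨h3, h4, h5⟩ := h.choose_spec
  rw [hI.eq_of_mem_column hQ hY h3 hi h4 h5 h1 h2]

omit hI in
theorem w_one_pos : 0 < Q.w 1 := by
  have := w_pred_lt hQ hY (one_ne_zero' (Q := Q))
  rwa [hQ.pred_one, w_zero hQ] at this

theorem notMem_column {x : ℤ} (h : Q.w hI.last ≤ x) :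
    ¬ ∃ i ∈ I, Q.w (Q.pred i) ≤ x ∧ x < Q.w i := by
  rintro ⟨i, hi, h1, h2⟩
  have := hI.w_le hQ hY hi hI.last_mem (hI.le_last hi)
  omega

omit hY in
-- Away from the ends of the rectangles, the columns `x - 1` and x lie in the same rectangle or both
-- lie beyond the last one.
theorem mem_jump_or {x : ℤ} (hx : 0 < x) (hx' : x ∉ Q.w '' I) :
    (∃ i ∈ I, Q.w (Q.pred i) ≤ x - 1 ∧ x - 1 < Q.w i ∧ Q.w (Q.pred i) ≤ x ∧ x < Q.w i) ∨
      (Q.w hI.last ≤ x - 1 ∧ Q.w hI.last ≤ x) := by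
  by_cases h : x < Q.w hI.last
  · left
    obtain ⟨i, hi, h1, h2⟩ := hI.exists_column hQ hx.le hI.last_mem h
    refine ⟨i, hi, ?_, by omega, h1, h2⟩
    have : Q.w (Q.pred i) ≠ x := by
      rintro rfl
      by_cases h1 : i = 1
      · rw [h1, hQ.pred_one, w_zero hQ] at hx
        exact lt_irrefl _ hx
      · exact hx' ⟨_, hI.pred_mem i hi h1, rfl⟩
    omega
  · right
    have : Q.w hI.last ≠ x := fun h => hx' ⟨_, hI.last_mem, h⟩
    omega

end

/-- The shape of the ladder diagram of a leg. -/
def IsLeg.shape (hQ : Q.IsQuiverFlag) (hY : Q.IsYShaped) (hI : Q.IsLeg I) :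
    LegShape (Q.w 1) (Q.r 1) where
  H := Q.legHeight I
  G := Q.legPot I (Q.w hI.last)
  E := Q.w '' I
  len := Q.w hI.last
  pos x h1 h2 := by
    obtain ⟨i, hi, h3, h4⟩ := hI.exists_column hQ h1 hI.last_mem h2
    rw [legHeight_eq hQ hY hI hi h3 h4]
    exact_mod_cast hQ.r_pos i (hI.ne_zero hi)
  beyond x h := by
    rw [legHeight, legPot, dif_neg (notMem_column hQ hY hI h), dif_neg (notMem_column hQ hY hI h)]
    exact ⟨rfl, rfl⟩
  mem_E := by
    rintro _ ⟨i, hi, rfl⟩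
    exact ⟨hI.w_le hQ hY hI.one_mem hi (hI.one_le hi),
      hI.w_le hQ hY hi hI.last_mem (hI.le_last hi)⟩
  len_mem := Set.mem_image_of_mem _ hI.last_mem
  w_mem := Set.mem_image_of_mem _ hI.one_mem
  eq x hx hx' := by
    rcases mem_jump_or hQ hI hx hx' with ⟨i, hi, h1, h2, h3, h4⟩ | ⟨h1, h2⟩
    · rw [legHeight_eq hQ hY hI hi h1 h2, legHeight_eq hQ hY hI hi h3 h4,
        legPot_eq hQ hY hI hi _ h1 h2, legPot_eq hQ hY hI hi _ h3 h4]
      exact ⟨rfl, rfl⟩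
    · rw [legHeight, legHeight, legPot, legPot, dif_neg (notMem_column hQ hY hI h1),
        dif_neg (notMem_column hQ hY hI h2), dif_neg (notMem_column hQ hY hI h1),
        dif_neg (notMem_column hQ hY hI h2)]
      exact ⟨rfl, rfl⟩
  G_eq := by
    rintro _ ⟨i, hi, rfl⟩ h
    have h1 : i < hI.last := (hI.le_last hi).lt_of_ne fun e => by rw [e] at h; exact lt_irrefl _ h
    obtain ⟨j, hj, hj1, rfl⟩ := hI.exists_next hQ hi hI.last_mem h1
    have h2 := w_pred_lt hQ hY (hI.ne_zero hj)
    rw [legHeight_eq hQ hY hI hj le_rfl h2, legPot_eq hQ hY hI hj _ le_rfl h2]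
  first x h1 h2 := by
    have h3 : Q.w (Q.pred 1) ≤ x := by rwa [hQ.pred_one, w_zero hQ]
    rw [legHeight_eq hQ hY hI hI.one_mem h3 h2, legPot_eq hQ hY hI hI.one_mem _ h3 h2,
      hQ.pred_one, w_zero hQ]
    simp

theorem IsLeg.isShape_shape (hQ : Q.IsQuiverFlag) (hY : Q.IsYShaped) (hI : Q.IsLeg I) :
    (hI.shape hQ hY).IsShape (Q.legDiagram I) where
  mem_box x y := by
    constructor
    · rintro ⟨i, hi, h1, h2, h3, h4⟩
      have hp : 0 ≤ Q.w (Q.pred i) := by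
        by_cases hi1 : i = 1
        · rw [hi1, hQ.pred_one, w_zero hQ]
        · exact (w_one_pos hQ hY).le.trans (hI.w_le hQ hY hI.one_mem (hI.pred_mem i hi hi1)
            (hI.one_le (hI.pred_mem i hi hi1)))
      refine ⟨hp.trans h1, h3, ?_⟩
      have h5 : (hI.shape hQ hY).H x = Q.r i := legHeight_eq hQ hY hI hi h1 h2
      rw [h5]
      exact h4
    · rintro ⟨h1, h2, h3⟩
      have h4 : x < Q.w hI.last := by
        by_contra hc
        have := ((hI.shape hQ hY).beyond x (not_lt.1 hc)).1
        omega
      obtain ⟨i, hi, h5, h6⟩ := hI.exists_column hQ h1 hI.last_mem h4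
      have h7 : (hI.shape hQ hY).H x = Q.r i := legHeight_eq hQ hY hI hi h5 h6
      rw [h7] at h3
      exact ⟨i, hi, h5, h6, h2, h3⟩
  mem_mark x y := by
    have e1 : (∃ i ∈ I, (x, y) = (Q.w i, (Q.r i : ℤ))) ↔
        x ∈ (hI.shape hQ hY).E ∧ y = (hI.shape hQ hY).H (x - 1) := by
      have h1 : ∀ i ∈ I, (hI.shape hQ hY).H (Q.w i - 1) = Q.r i := by
        intro i hi
        have := w_pred_lt hQ hY (hI.ne_zero hi)
        exact legHeight_eq hQ hY hI hi (by omega) (by omega)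
      constructor
      · rintro ⟨i, hi, h⟩
        obtain ⟨rfl, rfl⟩ := Prod.mk.inj h
        exact ⟨⟨i, hi, rfl⟩, (h1 i hi).symm⟩
      · rintro ⟨⟨i, hi, rfl⟩, rfl⟩
        exact ⟨i, hi, by rw [h1 i hi]⟩
    have e2 : (∃ i ∈ I, i ≠ 1 ∧ (x, y) = (Q.w (Q.pred i), ((min (Q.r (Q.pred i)) (Q.r i) : ℕ) : ℤ))) ↔
        x ∈ (hI.shape hQ hY).E ∧ x < (hI.shape hQ hY).len ∧
          y = min ((hI.shape hQ hY).H (x - 1)) ((hI.shape hQ hY).H x) := by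
      have h1 : ∀ i ∈ I, (hI.shape hQ hY).H (Q.w i - 1) = Q.r i := by
        intro i hi
        have := w_pred_lt hQ hY (hI.ne_zero hi)
        exact legHeight_eq hQ hY hI hi (by omega) (by omega)
      have h2 : ∀ i ∈ I, (hI.shape hQ hY).H (Q.w (Q.pred i)) = Q.r i := by
        intro i hi
        have := w_pred_lt hQ hY (hI.ne_zero hi)
        exact legHeight_eq hQ hY hI hi (by omega) (by omega)
      constructor
      · rintro ⟨i, hi, hi1, h⟩
        obtain ⟨rfl, rfl⟩ := Prod.mk.inj h
        have hp := hI.pred_mem i hi hi1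
        refine ⟨⟨_, hp, rfl⟩, ?_, ?_⟩
        · exact (w_pred_lt hQ hY (hI.ne_zero hi)).trans_le
            (hI.w_le hQ hY hi hI.last_mem (hI.le_last hi))
        · rw [h1 _ hp, h2 i hi]
          push_cast
          rfl
      · rintro ⟨⟨j, hj, rfl⟩, h, rfl⟩
        have h3 : j < hI.last := (hI.le_last hj).lt_of_ne fun e => by
          rw [e] at h; exact lt_irrefl _ h
        obtain ⟨i, hi, hi1, rfl⟩ := hI.exists_next hQ hj hI.last_mem h3
        refine ⟨i, hi, hi1, ?_⟩
        rw [h1 _ hj, h2 i hi]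
        push_cast
        rfl
    rw [← e1, ← e2]
    have hb : ∀ p, (∃ i ∈ I, p ∈ Q.block i) ↔ p ∈ (Q.legDiagram I).box := fun p => Iff.rfl
    simp only [legDiagram, Set.mem_ofPred_eq] at hb ⊢
    simp

end DimQuiver

/-! ### Jumps of the potentials are the Fano coefficients -/

namespace DimQuiver

variable {Q : DimQuiver} {I S : Set Q.Vtx}

open Classical in
/-- The dimension at the vertex that follows `i` on the leg `I`, or zero if `i` is the last
vertex. -/
def nextDim (Q : DimQuiver) (I : Set Q.Vtx) (i : Q.Vtx) : ℤ :=
  ∑ j, if j ∈ I ∧ j ≠ 1 ∧ Q.pred j = i then (Q.r j : ℤ) else 0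

section Leg

variable (hQ : Q.IsQuiverFlag) (hY : Q.IsYShaped) (hI : Q.IsLeg I)
include hQ hY hI

theorem legPot_sub_one {i : Q.Vtx} (hi : i ∈ I) (l : ℤ) :
    Q.legPot I l (Q.w i - 1) = Q.r i - Q.w (Q.pred i) := by
  have := w_pred_lt hQ hY (hI.ne_zero hi)
  exact legPot_eq hQ hY hI hi l (by omega) (by omega)

theorem legHeight_sub_one {i : Q.Vtx} (hi : i ∈ I) : Q.legHeight I (Q.w i - 1) = Q.r i := by
  have := w_pred_lt hQ hY (hI.ne_zero hi)
  exact legHeight_eq hQ hY hI hi (by omega) (by omega)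

/-- At `w_i` the next rectangle begins. After the last vertex the potential is minus the length of
the leg, consistent with a next dimension of zero. -/
theorem legPot_w {i : Q.Vtx} (hi : i ∈ I) :
    Q.legPot I (Q.w hI.last) (Q.w i) = Q.nextDim I i - Q.w i := by
  classical
  rcases (hI.le_last hi).eq_or_lt with h | h
  · have h1 : Q.nextDim I i = 0 := by
      refine Finset.sum_eq_zero fun j _ => if_neg ?_
      rintro ⟨h1, -, h3⟩
      have h4 := hI.le_last h1
      rw [← h, ← h3] at h4
      exact absurd h4 (not_le.2 (hQ.pred_lt (hI.ne_zero h1)))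
    rw [legPot, dif_neg (notMem_column hQ hY hI (by rw [h])), h1, h]
    simp
  · obtain ⟨j, hj, hj1, rfl⟩ := hI.exists_next hQ hi hI.last_mem h
    have h1 : Q.nextDim I (Q.pred j) = Q.r j := by
      rw [nextDim, Finset.sum_eq_single j]
      · rw [if_pos ⟨hj, hj1, rfl⟩]
      · intro k _ hk
        refine if_neg ?_
        rintro ⟨h1, h2, h3⟩
        exact hk (hI.inj k h1 h2 j hj hj1 h3)
      · simp
    rw [legPot_eq hQ hY hI hj _ le_rfl (w_pred_lt hQ hY (hI.ne_zero hj)), h1]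

open Classical in
-- Write `s_i = w_i - w_(pred i) + r_i`. The differences telescope to the length of the leg, and
-- each `r_j` except `r_1` cancels against the next dimension at the predecessor of j.
theorem sum_s_sub_nextDim :
    ∑ i with i ∈ I, ((Q.s i : ℤ) - Q.nextDim I i) = Q.r 1 + Q.w hI.last := by
  have h1 : ∑ i with i ∈ I, Q.nextDim I i = ∑ j with j ∈ I ∧ j ≠ 1, (Q.r j : ℤ) := by
    simp only [nextDim]
    rw [Finset.sum_comm, Finset.sum_filter]
    refine Finset.sum_congr rfl fun j _ => ?_
    split_ifs with h
    · rw [Finset.sum_eq_single (Q.pred j)]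
      · rw [if_pos ⟨h.1, h.2, rfl⟩]
      · intro k _ hk
        exact if_neg fun h' => hk h'.2.2.symm
      · intro h'
        exact absurd (Finset.mem_filter.2 ⟨Finset.mem_univ _, hI.pred_mem j h.1 h.2⟩) h'
    · exact Finset.sum_eq_zero fun k _ => if_neg fun h' => h ⟨h'.1, h'.2.1⟩
  have h2 : ∑ j with j ∈ I ∧ j ≠ 1, Q.w (Q.pred j) = ∑ i with i ∈ I ∧ i ≠ hI.last, Q.w i := by
    refine Finset.sum_bij (fun j _ => Q.pred j) ?_ ?_ ?_ fun _ _ => rfl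
    · intro j hj
      simp only [Finset.mem_filter, Finset.mem_univ, true_and] at hj ⊢
      refine ⟨hI.pred_mem j hj.1 hj.2, fun h => ?_⟩
      have := hI.le_last hj.1
      rw [← h] at this
      exact absurd this (not_le.2 (hQ.pred_lt (hI.ne_zero hj.1)))
    · intro j hj k hk h
      simp only [Finset.mem_filter, Finset.mem_univ, true_and] at hj hk
      exact hI.inj j hj.1 hj.2 k hk.1 hk.2 h
    · intro i hi
      simp only [Finset.mem_filter, Finset.mem_univ, true_and] at hi
      obtain ⟨j, hj, hj1, rfl⟩ := hI.exists_next hQ hi.1 hI.last_mem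
        ((hI.le_last hi.1).lt_of_ne hi.2)
      exact ⟨j, by simp [hj, hj1], rfl⟩
  have h3 : ∀ (k : Q.Vtx) (_ : k ∈ I) (f : Q.Vtx → ℤ),
      ∑ i with i ∈ I, f i = f k + ∑ i with i ∈ I ∧ i ≠ k, f i := by
    intro k hk f
    rw [← Finset.add_sum_erase _ f (Finset.mem_filter.2 ⟨Finset.mem_univ k, hk⟩)]
    congr 1
    refine Finset.sum_congr ?_ fun _ _ => rfl
    ext i
    simp [and_comm]
  have h4 : ∀ i ∈ Finset.univ.filter (· ∈ I), (Q.s i : ℤ) - Q.nextDim I i =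
      Q.w i - Q.w (Q.pred i) + Q.r i - Q.nextDim I i := by
    intro i hi
    rw [w_sub_w_pred hQ hY (hI.ne_zero (Finset.mem_filter.1 hi).2)]
    ring
  rw [Finset.sum_congr rfl h4, Finset.sum_sub_distrib, Finset.sum_add_distrib,
    Finset.sum_sub_distrib, h1, h3 1 hI.one_mem fun i => (Q.r i : ℤ),
    h3 1 hI.one_mem fun i => Q.w (Q.pred i), h2, h3 _ hI.last_mem Q.w, hQ.pred_one, w_zero hQ]
  ring

end Leg

theorem IsSplit.ne_zero (hS : Q.IsSplit S) {i : Q.Vtx} (h : i ∈ S) : i ≠ 0 :=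
  fun h0 => hS.first.zero_notMem (Or.inr (h0 ▸ h))

theorem IsSplit.ne_one (hS : Q.IsSplit S) {i : Q.Vtx} (h : i ∈ S) : i ≠ 1 :=
  fun h0 => hS.one_notMem (h0 ▸ h)

theorem IsSplit.c_of_mem (hQ : Q.IsQuiverFlag) (hY : Q.IsYShaped) (hS : Q.IsSplit S) {i : Q.Vtx}
    (hi : i ∈ S) : Q.c i = Q.s i - Q.nextDim (insert 1 S) i := by
  classical
  rw [c, s'_eq hQ hY (hS.ne_zero hi), nextDim]
  push_cast
  congr 1
  refine Finset.sum_congr rfl fun j _ => ?_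
  suffices e : (j ≠ 0 ∧ j ≠ 1 ∧ Q.pred j = i) ↔ (j ∈ insert 1 S ∧ j ≠ 1 ∧ Q.pred j = i) by
    by_cases h : j ≠ 0 ∧ j ≠ 1 ∧ Q.pred j = i
    · rw [if_pos h, if_pos (e.1 h)]
    · rw [if_neg h, if_neg (mt e.2 h)]
  constructor
  · rintro ⟨h0, h1, rfl⟩
    refine ⟨Or.inr ?_, h1, rfl⟩
    by_contra hc
    exact (hS.second.pred_mem j ⟨h0, hc⟩ h1).2 hi
  · rintro ⟨h0, h1, rfl⟩
    exact ⟨hS.first.ne_zero h0, h1, rfl⟩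

theorem IsSplit.c_of_notMem (hQ : Q.IsQuiverFlag) (hY : Q.IsYShaped) (hS : Q.IsSplit S) {i : Q.Vtx}
    (h0 : i ≠ 0) (h1 : i ≠ 1) (hi : i ∉ S) :
    Q.c i = Q.s i - Q.nextDim {i | i ≠ 0 ∧ i ∉ S} i := by
  classical
  rw [c, s'_eq hQ hY h0, nextDim]
  push_cast
  congr 1
  refine Finset.sum_congr rfl fun j _ => ?_
  suffices e : (j ≠ 0 ∧ j ≠ 1 ∧ Q.pred j = i) ↔ (j ∈ {i | i ≠ 0 ∧ i ∉ S} ∧ j ≠ 1 ∧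
      Q.pred j = i) by
    by_cases h : j ≠ 0 ∧ j ≠ 1 ∧ Q.pred j = i
    · rw [if_pos h, if_pos (e.1 h)]
    · rw [if_neg h, if_neg (mt e.2 h)]
  constructor
  · rintro ⟨h3, h2, rfl⟩
    refine ⟨⟨h3, fun hc => ?_⟩, h2, rfl⟩
    rcases hS.first.pred_mem j (Or.inr hc) h2 with h | h
    · exact h1 h
    · exact hi h
  · rintro ⟨h3, h2, rfl⟩
    exact ⟨h3.1, h2, rfl⟩

/-- Vertex 1 belongs to both legs and has a successor on each, when these exist. -/
theorem IsSplit.c_one (hQ : Q.IsQuiverFlag) (hY : Q.IsYShaped) (hS : Q.IsSplit S) :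
    Q.c 1 = Q.s 1 - Q.nextDim (insert 1 S) 1 - Q.nextDim {i | i ≠ 0 ∧ i ∉ S} 1 := by
  rw [c, s'_eq hQ hY one_ne_zero', nextDim, nextDim, sub_sub, ← Finset.sum_add_distrib]
  push_cast
  congr 1
  refine Finset.sum_congr rfl fun j _ => ?_
  by_cases hj : j ∈ S
  · simp [hj, hS.ne_zero hj]
  · by_cases h1 : j = 1 <;> simp [hj, h1]

theorem finite_box_ladder (Q : DimQuiver) (S : Set Q.Vtx) : (Q.ladder S).box.Finite := by
  refine (Q.finite_box_legDiagram _).union ?_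
  refine (Q.finite_box_legDiagram (insert 1 S)).preimage (f := fun b => _ - b - (1, 1)) ?_
  intro a _ b _ h
  simpa using h

theorem finite_mark_ladder (Q : DimQuiver) (S : Set Q.Vtx) : (Q.ladder S).mark.Finite := by
  refine (Q.finite_mark_legDiagram _).union ?_
  refine (Q.finite_mark_legDiagram (insert 1 S)).preimage (f := fun b => _ - b) ?_
  intro a _ b _ h
  simpa using h

/-- The profile of the ladder diagram. -/
def IsSplit.profile (hQ : Q.IsQuiverFlag) (hY : Q.IsYShaped) (hS : Q.IsSplit S) : Profile :=
  LegShape.profile (w_one_pos hQ hY) (Int.natCast_pos.2 (hQ.r_pos 1 one_ne_zero'))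
    (hS.second.shape hQ hY) (hS.first.shape hQ hY)

theorem IsSplit.isShape (hQ : Q.IsQuiverFlag) (hY : Q.IsYShaped) (hS : Q.IsSplit S) :
    (hS.profile hQ hY).IsShape (Q.ladder S) :=
  LegShape.isShape_union _ _ (hS.second.isShape_shape hQ hY) (hS.first.isShape_shape hQ hY)

theorem IsSplit.isGood (hQ : Q.IsQuiverFlag) (hY : Q.IsYShaped) (hS : Q.IsSplit S) :
    (Q.ladder S).IsGood :=
  (hS.isShape hQ hY).isGood (Q.finite_box_ladder S)

section Values

variable (hQ : Q.IsQuiverFlag) (hY : Q.IsYShaped) (hS : Q.IsSplit S)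
include hQ hY hS

theorem profile_hi_of_nonneg {x : ℤ} (hx : 0 ≤ x) :
    (hS.profile hQ hY).hi x = Q.legHeight {i | i ≠ 0 ∧ i ∉ S} x := by
  have := (hS.second.shape hQ hY).first x hx
  change (if x < Q.w 1 then (Q.r 1 : ℤ) else _) = _
  split_ifs with h
  · exact (this h).1.symm
  · rfl

theorem profile_lo_of_lt {x : ℤ} (hx : x < Q.w 1) :
    (hS.profile hQ hY).lo x = Q.r 1 - Q.legHeight (insert 1 S) (Q.w 1 - 1 - x) := by
  have := (hS.first.shape hQ hY).first (Q.w 1 - 1 - x) (by omega)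
  change (if 0 ≤ x then 0 else _) = _
  split_ifs with h
  · have h1 : Q.legHeight (insert 1 S) (Q.w 1 - 1 - x) = Q.r 1 := (this (by omega)).1
    omega
  · rfl

theorem profile_up_of_le {x : ℤ} (hx : Q.w 1 ≤ x) : (hS.profile hQ hY).up x =
    Q.legPot {i | i ≠ 0 ∧ i ∉ S} (Q.w hS.second.last) x :=
  if_neg (not_lt.2 hx)

theorem profile_up_of_lt {x : ℤ} (hx : x < Q.w 1) : (hS.profile hQ hY).up x =
    Q.r 1 + Q.w hS.first.last - Q.w 1 :=
  if_pos hx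

theorem profile_dn_of_nonneg {x : ℤ} (hx : 0 ≤ x) : (hS.profile hQ hY).dn x =
    - Q.w hS.second.last :=
  if_pos hx

theorem profile_dn_of_neg {x : ℤ} (hx : x < 0) : (hS.profile hQ hY).dn x =
    Q.r 1 - Q.w 1 - Q.legPot (insert 1 S) (Q.w hS.first.last) (Q.w 1 - 1 - x) :=
  if_neg (not_le.2 hx)

/-- The jump is `(r_i - w_(pred i)) - (next - w_i)`, where next is the dimension following i on the
leg; this is `s_i - next = c_i`. -/
theorem up_jump {i : Q.Vtx} (h0 : i ≠ 0) (h1 : i ≠ 1) (hi : i ∉ S) :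
    (hS.profile hQ hY).up (Q.w i - 1) - (hS.profile hQ hY).up (Q.w i) = Q.c i := by
  have hI := hS.second
  have hi' : i ∈ {i | i ≠ 0 ∧ i ∉ S} := ⟨h0, hi⟩
  have h2 := hI.w_lt hQ hY hI.one_mem hi' ((hI.one_le hi').lt_of_ne' h1)
  rw [profile_up_of_le hQ hY hS (by omega), profile_up_of_le hQ hY hS h2.le,
    legPot_sub_one hQ hY hI hi', legPot_w hQ hY hI hi', hS.c_of_notMem hQ hY h0 h1 hi]
  have := w_sub_w_pred hQ hY h0
  omega

theorem dn_jump {i : Q.Vtx} (hi : i ∈ S) :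
    (hS.profile hQ hY).dn (Q.w 1 - Q.w i - 1) - (hS.profile hQ hY).dn (Q.w 1 - Q.w i) = Q.c i := by
  have hI := hS.first
  have hi' : i ∈ insert 1 S := Or.inr hi
  have h2 := hI.w_lt hQ hY hI.one_mem hi' ((hI.one_le hi').lt_of_ne' (hS.ne_one hi))
  rw [profile_dn_of_neg hQ hY hS (by omega), profile_dn_of_neg hQ hY hS (by omega),
    show Q.w 1 - 1 - (Q.w 1 - Q.w i - 1) = Q.w i by ring,
    show Q.w 1 - 1 - (Q.w 1 - Q.w i) = Q.w i - 1 by ring,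
    legPot_sub_one hQ hY hI hi', legPot_w hQ hY hI hi', hS.c_of_mem hQ hY hi]
  have := w_sub_w_pred hQ hY (hS.ne_zero hi)
  omega

open Classical in
theorem sum_c_first : ∑ i with i ∈ S, Q.c i =
    Q.r 1 + Q.w hS.first.last - (Q.s 1 - Q.nextDim (insert 1 S) 1) := by
  have h := sum_s_sub_nextDim hQ hY hS.first
  rw [Finset.sum_congr (s₂ := insert 1 (Finset.univ.filter (· ∈ S))) (by ext; simp)
    fun _ _ => rfl, Finset.sum_insert (by simp [hS.one_notMem])] at h
  rw [Finset.sum_congr rfl fun i hi => hS.c_of_mem hQ hY (Finset.mem_filter.1 hi).2]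
  omega

open Classical in
theorem sum_c_second : ∑ i with i ≠ 0 ∧ i ≠ 1 ∧ i ∉ S, Q.c i =
    Q.r 1 + Q.w hS.second.last - (Q.s 1 - Q.nextDim {i | i ≠ 0 ∧ i ∉ S} 1) := by
  have h := sum_s_sub_nextDim hQ hY hS.second
  have e : ∀ i, (i ≠ 0 ∧ i ∉ S) ↔ (i = 1 ∨ (i ≠ 0 ∧ i ≠ 1 ∧ i ∉ S)) := by
    intro i
    by_cases h1 : i = 1
    · simp [h1, hS.one_notMem]
    · simp [h1]
  rw [Finset.sum_congr (s₂ := insert 1 (Finset.univ.filter fun i => i ≠ 0 ∧ i ≠ 1 ∧ i ∉ S))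
    (by ext i; simpa using e i) fun _ _ => rfl, Finset.sum_insert (by simp)] at h
  rw [Finset.sum_congr rfl fun i hi => hS.c_of_notMem hQ hY (Finset.mem_filter.1 hi).2.1
    (Finset.mem_filter.1 hi).2.2.1 (Finset.mem_filter.1 hi).2.2.2]
  omega

open Classical in
-- All paths of the rotated leg, as well as that of vertex 1, end at `O₁`. Telescoping along the
-- rotated leg identifies the constant to the left of `w_1` with the sum of their coefficients.
theorem up_jump_one : (hS.profile hQ hY).up (Q.w 1 - 1) - (hS.profile hQ hY).up (Q.w 1) =
    Q.c 1 + ∑ i with i ∈ S, Q.c i := by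
  rw [profile_up_of_le hQ hY hS le_rfl, profile_up_of_lt hQ hY hS (by omega),
    legPot_w hQ hY hS.second hS.second.one_mem, sum_c_first hQ hY hS, hS.c_one hQ hY]
  omega

open Classical in
theorem dn_jump_one : (hS.profile hQ hY).dn (-1) - (hS.profile hQ hY).dn 0 =
    Q.c 1 + ∑ i with i ≠ 0 ∧ i ≠ 1 ∧ i ∉ S, Q.c i := by
  rw [profile_dn_of_nonneg hQ hY hS le_rfl, profile_dn_of_neg hQ hY hS (by omega),
    show Q.w 1 - 1 - -1 = Q.w 1 by ring,
    legPot_w hQ hY hS.first hS.first.one_mem, sum_c_second hQ hY hS, hS.c_one hQ hY]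
  omega

end Values

end DimQuiver

/-! ### The sum of all weights in terms of the paths -/

namespace DimQuiver

variable {Q : DimQuiver} {S : Set Q.Vtx}

theorem finsum_eq_sum_image {ι κ : Type*} [DecidableEq κ] (F : κ → ℤ) (s : Finset ι) (v : ι → κ)
    (hv : Set.InjOn v s) (hF : F.support ⊆ v '' s) :
    F.support.Finite ∧ ∑ᶠ p, F p = ∑ i ∈ s, F (v i) := by
  refine ⟨(s.finite_toSet.image v).subset hF, ?_⟩
  rw [finsum_eq_sum_of_support_subset (s := s.image v) F (by simpa using hF),
    Finset.sum_image hv]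

open Classical in
/-- The coordinates of the external vertex `v_i`. -/
def extPoint (Q : DimQuiver) (S : Set Q.Vtx) (i : Q.Vtx) : ℤ × ℤ :=
  if i ∈ S then (Q.w 1 - Q.w i, (Q.r 1 : ℤ) - Q.r i) else (Q.w i, (Q.r i : ℤ))

theorem ext_val (i : Q.NonSource) : (Q.ext S i).1 = Q.extPoint S i.1 := by
  by_cases h : i.1 ∈ S
  · have e : Q.ext S i = _ := dif_pos h
    exact (congrArg Subtype.val e).trans (if_pos h).symm
  · have e : Q.ext S i = _ := dif_neg h
    exact (congrArg Subtype.val e).trans (if_neg h).symm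

open Classical in
-- Replace the coefficient 1 of each arrow by the flow on its essential step and sum by parts. The
-- divergence is `c_i` at external vertices of the second leg and `-c_i` at those of the first; at
-- `O₁` and `O₂` it balances them.
theorem IsSplit.sum_arrow (hQ : Q.IsQuiverFlag) (hY : Q.IsYShaped) (hS : Q.IsSplit S)
    (h : ℤ × ℤ → ℤ) :
    ∑ a : (Q.ladder S).Arrow, (h a.right.1 - h a.left.1) =
      ∑ i : Q.NonSource, Q.c i.1 * (h (Q.pathEnd S i).1 - h (Q.pathStart S i).1) := by
  have hsh := hS.isShape hQ hY
  have hG := hS.isGood hQ hY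
  set π := hS.profile hQ hY with hπ
  have h1 : ∑ a : (Q.ladder S).Arrow, (h a.right.1 - h a.left.1) =
      ∑ᶠ p, Diagram.divergence π.flow p * h p := by
    rw [← hG.sum_ess π.flow (hsh.step_of_flow) (hsh.divergence_flow)]
    refine Finset.sum_congr rfl fun a _ => ?_
    rw [hsh.flow_eq_one (hG.isEss_ess a).isEssential, one_mul]
  set A : Finset Q.Vtx := Finset.univ.filter fun i => i ≠ 0 ∧ i ≠ 1 ∧ i ∉ S with hA
  set B : Finset Q.Vtx := Finset.univ.filter fun i => i ∈ S with hB
  have mA : ∀ i ∈ insert 1 A, i ∈ {i | i ≠ 0 ∧ i ∉ S} := by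
    intro i hi
    rcases Finset.mem_insert.1 hi with rfl | hi
    · exact hS.second.one_mem
    · exact ⟨(Finset.mem_filter.1 hi).2.1, (Finset.mem_filter.1 hi).2.2.2⟩
  have mB : ∀ i ∈ insert 1 B, i ∈ insert 1 S := by
    intro i hi
    rcases Finset.mem_insert.1 hi with rfl | hi
    · exact hS.first.one_mem
    · exact Or.inr (Finset.mem_filter.1 hi).2
  have hhi : ∀ i ∈ {i | i ≠ 0 ∧ i ∉ S}, π.hi (Q.w i - 1) = Q.r i := by
    intro i hi
    have := hS.second.w_le hQ hY hS.second.one_mem hi (hS.second.one_le hi)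
    have h0 := w_one_pos hQ hY
    rw [profile_hi_of_nonneg hQ hY hS (by omega), legHeight_sub_one hQ hY hS.second hi]
  have hlo : ∀ i ∈ insert 1 S, π.lo (Q.w 1 - Q.w i) = Q.r 1 - Q.r i := by
    intro i hi
    have := hS.first.w_le hQ hY hS.first.one_mem hi (hS.first.one_le hi)
    have h0 := w_one_pos hQ hY
    rw [profile_lo_of_lt hQ hY hS (by omega),
      show Q.w 1 - 1 - (Q.w 1 - Q.w i) = Q.w i - 1 by ring,
      legHeight_sub_one hQ hY hS.first hi]
  -- On the upper boundary the divergence is supported at the external vertices of the second leg,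
  -- including `v_1 = O₁`.
  obtain ⟨f1, e1⟩ := finsum_eq_sum_image
    (fun p : ℤ × ℤ => (if p.2 = π.hi (p.1 - 1) then π.up (p.1 - 1) - π.up p.1 else 0) * h p)
    (insert 1 A) (fun i => (Q.w i, (Q.r i : ℤ)))
    (fun i hi j hj e => hS.second.w_injOn hQ hY (mA i hi) (mA j hj) (Prod.mk.inj e).1) (by
      rintro ⟨x, y⟩ hp
      have hy : y = π.hi (x - 1) := by
        by_contra hc
        simp [hc] at hp
      have hx : x ∈ π.EU := by
        by_contra hc
        simp [π.up_eq x hc] at hp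
      obtain ⟨i, hi, rfl⟩ := hx
      refine ⟨i, ?_, Prod.ext rfl (by rw [hy, hhi i hi])⟩
      by_cases h1 : i = 1
      · simp [h1]
      · simp [hA, hi.1, hi.2, h1])
  -- On the lower boundary it is supported at the external vertices of the first leg and at `O₂`,
  -- which is the image of `(w_1, r_1)` under the rotation.
  obtain ⟨f2, e2⟩ := finsum_eq_sum_image
    (fun p : ℤ × ℤ => (if p.2 = π.lo p.1 then π.dn (p.1 - 1) - π.dn p.1 else 0) * h p)
    (insert 1 B) (fun i => (Q.w 1 - Q.w i, (Q.r 1 : ℤ) - Q.r i))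
    (fun i hi j hj e => hS.first.w_injOn hQ hY (mB i hi) (mB j hj)
      (sub_right_injective (Prod.mk.inj e).1)) (by
      rintro ⟨x, y⟩ hp
      have hy : y = π.lo x := by
        by_contra hc
        simp [hc] at hp
      have hx : x ∈ π.EL := by
        by_contra hc
        simp [π.dn_eq x hc] at hp
      obtain ⟨i, hi, hx⟩ := hx
      obtain rfl : x = Q.w 1 - Q.w i := by rw [hx]; ring
      refine ⟨i, ?_, Prod.ext rfl (by rw [hy, hlo i hi])⟩
      rcases hi with rfl | hi
      · simp
      · simp [hB, hi])
  have h2 : ∑ᶠ p, Diagram.divergence π.flow p * h p =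
      ∑ i ∈ insert 1 A, (π.up (Q.w i - 1) - π.up (Q.w i)) * h (Q.w i, (Q.r i : ℤ)) -
      ∑ i ∈ insert 1 B, (π.dn (Q.w 1 - Q.w i - 1) - π.dn (Q.w 1 - Q.w i)) *
        h (Q.w 1 - Q.w i, (Q.r 1 : ℤ) - Q.r i) := by
    rw [Finset.sum_congr rfl fun i hi => ?_, ← e1, Finset.sum_congr rfl fun i hi => ?_, ← e2,
      ← finsum_sub_distrib f1 f2]
    · refine finsum_congr fun p => ?_
      rw [← sub_mul, ← Profile.divergence_flow]
    · dsimp only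
      rw [if_pos (hlo i (mB i hi)).symm]
    · dsimp only
      rw [if_pos (hhi i (mA i hi)).symm]
  have h3 : ∑ i : Q.NonSource, Q.c i.1 * (h (Q.pathEnd S i).1 - h (Q.pathStart S i).1) =
      ∑ i ∈ insert 1 (A ∪ B), Q.c i * (if i ∈ S then
        h (Q.w 1, (Q.r 1 : ℤ)) - h (Q.w 1 - Q.w i, (Q.r 1 : ℤ) - Q.r i)
        else h (Q.w i, (Q.r i : ℤ)) - h (0, 0)) := by
    rw [Finset.sum_subtype (insert 1 (A ∪ B)) (p := fun i => i ≠ 0)]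
    · refine Finset.sum_congr rfl fun i _ => ?_
      rw [pathEnd, pathStart]
      split_ifs with hi
      · rw [ext_val, extPoint, if_pos hi]
        rfl
      · rw [ext_val, extPoint, if_neg hi]
        rfl
    · intro i
      simp only [hA, hB, Finset.mem_insert, Finset.mem_union, Finset.mem_filter, Finset.mem_univ,
        true_and]
      constructor
      · rintro (rfl | h | h)
        · exact one_ne_zero'
        · exact h.1
        · exact hS.ne_zero h
      · intro h
        tauto
  have hAB : Disjoint A B := by
    rw [Finset.disjoint_left]
    intro i hi hi'
    exact (Finset.mem_filter.1 hi).2.2.2 (Finset.mem_filter.1 hi').2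
  have h1A : 1 ∉ A := by simp [hA]
  have h1B : 1 ∉ B := by simp [hB, hS.one_notMem]
  have sA : ∑ i ∈ A, (π.up (Q.w i - 1) - π.up (Q.w i)) * h (Q.w i, (Q.r i : ℤ)) =
      ∑ i ∈ A, Q.c i * h (Q.w i, (Q.r i : ℤ)) := by
    refine Finset.sum_congr rfl fun i hi => ?_
    have hi := (Finset.mem_filter.1 hi).2
    rw [up_jump hQ hY hS hi.1 hi.2.1 hi.2.2]
  have sB : ∑ i ∈ B, (π.dn (Q.w 1 - Q.w i - 1) - π.dn (Q.w 1 - Q.w i)) *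
        h (Q.w 1 - Q.w i, (Q.r 1 : ℤ) - Q.r i) =
      ∑ i ∈ B, Q.c i * h (Q.w 1 - Q.w i, (Q.r 1 : ℤ) - Q.r i) := by
    refine Finset.sum_congr rfl fun i hi => ?_
    rw [dn_jump hQ hY hS (Finset.mem_filter.1 hi).2]
  rw [h1, h2, h3, Finset.sum_insert h1A, Finset.sum_insert h1B, Finset.sum_insert (by simp [h1A, h1B]),
    Finset.sum_union hAB, sA, sB, up_jump_one hQ hY hS, sub_self, zero_sub, dn_jump_one hQ hY hS,
    sub_self, if_neg hS.one_notMem]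
  have tA : ∑ i ∈ A, Q.c i * (if i ∈ S then
        h (Q.w 1, (Q.r 1 : ℤ)) - h (Q.w 1 - Q.w i, (Q.r 1 : ℤ) - Q.r i)
        else h (Q.w i, (Q.r i : ℤ)) - h (0, 0)) =
      ∑ i ∈ A, Q.c i * h (Q.w i, (Q.r i : ℤ)) - (∑ i ∈ A, Q.c i) * h (0, 0) := by
    rw [Finset.sum_mul, ← Finset.sum_sub_distrib]
    refine Finset.sum_congr rfl fun i hi => ?_
    rw [if_neg (Finset.mem_filter.1 hi).2.2.2]
    ring
  have tB : ∑ i ∈ B, Q.c i * (if i ∈ S then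
        h (Q.w 1, (Q.r 1 : ℤ)) - h (Q.w 1 - Q.w i, (Q.r 1 : ℤ) - Q.r i)
        else h (Q.w i, (Q.r i : ℤ)) - h (0, 0)) =
      (∑ i ∈ B, Q.c i) * h (Q.w 1, (Q.r 1 : ℤ)) -
        ∑ i ∈ B, Q.c i * h (Q.w 1 - Q.w i, (Q.r 1 : ℤ) - Q.r i) := by
    rw [Finset.sum_mul, ← Finset.sum_sub_distrib]
    refine Finset.sum_congr rfl fun i hi => ?_
    rw [if_pos (Finset.mem_filter.1 hi).2]
    ring
  rw [tA, tB]
  ring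

end DimQuiver

/-! ### Reachability in the support of a flow, and crossing paths -/

namespace Diagram

variable {D : Diagram}

theorem Step.le {p q : ℤ × ℤ} (h : D.Step p q) : p ≤ q := by
  rcases h with ⟨rfl, _⟩ | ⟨rfl, _⟩ <;> simp [Prod.le_def]

theorem isChain_points (a : D.Arrow) : (points a).IsChain D.Step := a.hom.2.1

theorem le_of_isChain {l : List (ℤ × ℤ)} {y : ℤ × ℤ} (h : (l ++ [y]).IsChain D.Step) :
    ∀ z ∈ l ++ [y], z ≤ y := by
  induction l with
  | nil => simp
  | cons x l ih =>
    rw [List.cons_append, List.isChain_cons] at h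
    intro z hz
    rcases List.mem_cons.1 hz with rfl | hz
    · obtain ⟨t, ht⟩ : ∃ t, t ∈ (l ++ [y]).head? := by cases l <;> simp
      exact (h.1 t ht).le.trans (ih h.2 t (List.mem_of_mem_head? ht))
    · exact ih h.2 z hz

theorem exists_step_of_isChain {l : List (ℤ × ℤ)} {y : ℤ × ℤ} (h : (l ++ [y]).IsChain D.Step) :
    ∀ z ∈ l ++ [y], z = y ∨ ∃ t ∈ l ++ [y], D.Step z t := by
  induction l with
  | nil => simp
  | cons x l ih =>
    rw [List.cons_append, List.isChain_cons] at h
    intro z hz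
    rcases List.mem_cons.1 hz with rfl | hz
    · obtain ⟨t, ht⟩ : ∃ t, t ∈ (l ++ [y]).head? := by cases l <;> simp
      exact Or.inr ⟨t, List.mem_cons_of_mem _ (List.mem_of_mem_head? ht), h.1 t ht⟩
    · rcases ih h.2 z hz with h' | ⟨t, ht, ht'⟩
      · exact Or.inl h'
      · exact Or.inr ⟨t, List.mem_cons_of_mem _ ht, ht'⟩

theorem forall_of_isChain {P : ℤ × ℤ → Prop} {l : List (ℤ × ℤ)} (h : l.IsChain D.Step)
    (hP : ∀ p ∈ l, ∀ q ∈ l, D.Step p q → P p → P q) (h0 : ∀ x ∈ l.head?, P x) :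
    ∀ z ∈ l, P z := by
  induction l with
  | nil => simp
  | cons x l ih =>
    rw [List.isChain_cons] at h
    intro z hz
    rcases List.mem_cons.1 hz with rfl | hz
    · exact h0 _ rfl
    · refine ih h.2 (fun p hp q hq => hP p (List.mem_cons_of_mem _ hp) q
        (List.mem_cons_of_mem _ hq)) (fun t ht => ?_) z hz
      exact hP x List.mem_cons_self t (List.mem_cons_of_mem _ (List.mem_of_mem_head? ht))
        (h.1 t ht) (h0 x rfl)

theorem le_right {a : D.Arrow} {z : ℤ × ℤ} (h : z ∈ points a) : z ≤ a.right.1 := by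
  have h1 := isChain_points a
  rw [points, ← List.cons_append] at h h1
  exact le_of_isChain h1 z h

theorem right_mem_points (a : D.Arrow) : a.right.1 ∈ points a := by simp [points]

theorem left_mem_points (a : D.Arrow) : a.left.1 ∈ points a := by simp [points]

theorem eq_right_or_exists_step {a : D.Arrow} {z : ℤ × ℤ} (h : z ∈ points a) :
    z = a.right.1 ∨ ∃ t ∈ points a, D.Step z t := by
  have h1 := isChain_points a
  rw [points, ← List.cons_append] at h h1 ⊢
  exact exists_step_of_isChain h1 z h

/-- Two arrows with a common point have a common end point. -/
theorem IsGood.exists_common (hD : D.IsGood) {a b : D.Arrow} {z : ℤ × ℤ} (ha : z ∈ points a)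
    (hb : z ∈ points b) : ∃ x : D.Vertex, (x = a.left ∨ x = a.right) ∧ (x = b.left ∨ x = b.right) := by
  have key : ∀ {a : D.Arrow}, z ∈ points a → (z ∈ D.mark → z = a.left.1 ∨ z = a.right.1) ∧
      (z ∉ D.mark → z ∈ a.hom.1) := by
    intro a ha
    simp only [points, List.mem_cons, List.mem_append, List.not_mem_nil, or_false] at ha
    constructor
    · intro hz
      have : z ∉ a.hom.1 := fun h => a.hom.2.2 z h hz
      tauto
    · intro hz
      have h1 : z ≠ a.left.1 := fun h => hz (h ▸ a.left.2)
      have h2 : z ≠ a.right.1 := fun h => hz (h ▸ a.right.2)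
      tauto
  by_cases hz : z ∈ D.mark
  · exact ⟨⟨z, hz⟩, ((key ha).1 hz).imp Subtype.ext Subtype.ext,
      ((key hb).1 hz).imp Subtype.ext Subtype.ext⟩
  · rcases hD.left_eq_or_right_eq ((key ha).2 hz) ((key hb).2 hz) with h | h
    · exact ⟨a.left, Or.inl rfl, Or.inl h⟩
    · exact ⟨a.right, Or.inr rfl, Or.inr h⟩

/-- The vertex `y` can be reached from `x` along arrows in the support of `u`. -/
def Reach (u : D.Arrow → ℕ) : D.Vertex → D.Vertex → Prop :=
  Relation.ReflTransGen fun x y => ∃ a : D.Arrow, 0 < u a ∧ a.left = x ∧ a.right = y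

theorem Reach.le {u : D.Arrow → ℕ} {x y : D.Vertex} (h : Reach u x y) : x.1 ≤ y.1 := by
  induction h with
  | refl => exact le_rfl
  | tail _ h ih =>
    obtain ⟨a, -, rfl, rfl⟩ := h
    exact ih.trans (le_right (left_mem_points a))

/-- The point `z` lies on an arrow on a path from `x` to `y`. -/
def Between (u : D.Arrow → ℕ) (x y : D.Vertex) (z : ℤ × ℤ) : Prop :=
  ∃ a : D.Arrow, 0 < u a ∧ Reach u x a.left ∧ Reach u a.right y ∧ z ∈ points a

theorem Reach.of_arrow {u : D.Arrow → ℕ} {a : D.Arrow} (h : 0 < u a) : Reach u a.left a.right :=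
  Relation.ReflTransGen.single ⟨a, h, rfl, rfl⟩

/-- Arrows may meet at an unmarked point, but then they share an end point, so paths can be switched
there. -/
theorem IsGood.exists_common_of_between (hD : D.IsGood) {u : D.Arrow → ℕ} {x y x' y' : D.Vertex}
    {z : ℤ × ℤ} (h : Between u x y z) (h' : Between u x' y' z) : Reach u x y' ∧ Reach u x' y := by
  obtain ⟨a, ha, h1, h2, h3⟩ := h
  obtain ⟨b, hb, k1, k2, k3⟩ := h'
  obtain ⟨t, ht, ht'⟩ := hD.exists_common h3 k3
  have e1 : Reach u x t ∧ Reach u t y := by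
    rcases ht with rfl | rfl
    · exact ⟨h1, (Reach.of_arrow ha).trans h2⟩
    · exact ⟨h1.trans (Reach.of_arrow ha), h2⟩
  have e2 : Reach u x' t ∧ Reach u t y' := by
    rcases ht' with rfl | rfl
    · exact ⟨k1, (Reach.of_arrow hb).trans k2⟩
    · exact ⟨k1.trans (Reach.of_arrow hb), k2⟩
  exact ⟨e1.1.trans e2.2, e2.1.trans e1.2⟩

theorem Between.le {u : D.Arrow → ℕ} {x y : D.Vertex} {z : ℤ × ℤ} (h : Between u x y z) :
    z ≤ y.1 := by
  obtain ⟨a, -, -, h2, h3⟩ := h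
  exact (le_right h3).trans h2.le

theorem Between.eq_or_exists_step {u : D.Arrow → ℕ} {x y : D.Vertex} {z : ℤ × ℤ}
    (h : Between u x y z) : z = y.1 ∨ ∃ t, D.Step z t ∧ Between u x y t := by
  obtain ⟨a, ha, h1, h2, h3⟩ := h
  rcases eq_right_or_exists_step h3 with rfl | ⟨t, ht, ht'⟩
  · rcases Relation.ReflTransGen.cases_head h2 with h | ⟨v, ⟨b, hb, hb1, rfl⟩, h5⟩
    · exact Or.inl (by rw [h])
    · right
      have h6 : a.right.1 ∈ points b := hb1 ▸ left_mem_points b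
      have h7 : Reach u x b.left := hb1 ▸ h1.trans (Reach.of_arrow ha)
      rcases eq_right_or_exists_step h6 with h | ⟨t, ht, ht'⟩
      · exfalso
        have h8 := isChain_points b
        have h9 : b.left.1 = b.right.1 := by rw [hb1, h]
        rw [points, List.isChain_cons] at h8
        obtain ⟨t, ht⟩ : ∃ t, t ∈ (b.hom.1 ++ [b.right.1]).head? := by cases b.hom.1 <;> simp
        have h10 := h8.1 t ht
        have h11 : t ≤ b.right.1 := le_right (List.mem_cons_of_mem _ (List.mem_of_mem_head? ht))
        have h12 := h10.lt
        rw [h9] at h12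
        rw [Prod.le_def] at h11
        omega
      · exact ⟨t, ht', b, hb, h7, h5, ht⟩
  · exact Or.inr ⟨t, ht', a, ha, h1, h2, ht⟩

/-- The crossing lemma: a path which starts on the left of a second path and ends on its right
meets the second path. -/
theorem IsGood.reach_of_crossing (hD : D.IsGood) {u : D.Arrow → ℕ} {x y o o' : D.Vertex}
    (h : Reach u x y) (h' : Reach u o o') (ho : o ≠ o')
    (h1 : x.1.1 + x.1.2 ≤ o.1.1 + o.1.2) (h2 : x.1.1 < o.1.1)
    (h3 : o'.1.1 + o'.1.2 ≤ y.1.1 + y.1.2) (h4 : o'.1.1 < y.1.1)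
    (h5 : ∀ p q, D.Step p q → q.1 + q.2 = o.1.1 + o.1.2 → q.1 ≤ o.1.1)
    (h6 : ∀ p q, D.Step p q → p.1 + p.2 = o'.1.1 + o'.1.2 → o'.1.1 ≤ p.1) :
    Reach u x o' ∧ Reach u o y := by
  by_contra hc
  have hdisj : ∀ z, Between u x y z → ¬ Between u o o' z := fun z hz hz' =>
    hc (hD.exists_common_of_between hz hz')
  -- S says that p comes before the antidiagonal of o, or lies strictly to the left of the point of
  -- the second path on its own antidiagonal. If the paths never meet, S persists along the first
  -- path, but it fails at y.
  set S : ℤ × ℤ → Prop := fun p => p.1 + p.2 < o.1.1 + o.1.2 ∨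
    ∃ b, Between u o o' b ∧ b.1 + b.2 = p.1 + p.2 ∧ p.1 < b.1 with hS
  have ho1 : Between u o o' o.1 := by
    rcases Relation.ReflTransGen.cases_head h' with e | ⟨v, ⟨b, hb, rfl, rfl⟩, k⟩
    · exact absurd e ho
    · exact ⟨b, hb, .refl, k, left_mem_points b⟩
  have hstep : ∀ p q, D.Step p q → Between u x y q → S p → S q := by
    rintro p q hpq hq (hp | ⟨b, hb, hb1, hb2⟩)
    · have hl := hpq.level
      rcases (show q.1 + q.2 ≤ o.1.1 + o.1.2 by omega).lt_or_eq with h | h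
      · exact Or.inl h
      -- On the antidiagonal of o no step ends to the right of o, so q is on the left of o or equal
      -- to it.
      · have h7 := h5 p q hpq h
        refine Or.inr ⟨o.1, ho1, h.symm, h7.lt_of_ne fun e => ?_⟩
        exact hdisj q hq ((Prod.ext e (by omega) : q = o.1) ▸ ho1)
    · rcases hb.eq_or_exists_step with rfl | ⟨t, ht, ht'⟩
      -- The second path ends here, but no step starts to the left of o' on its antidiagonal.
      · have := h6 p q hpq hb1.symm
        omega
      · have l1 := hpq.level
        have l2 := ht.level
        have l3 := (Prod.le_def.1 ht.le).1
        have l4 : q.1 ≤ p.1 + 1 := by rcases hpq with ⟨rfl, -⟩ | ⟨rfl, -⟩ <;> simp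
        refine Or.inr ⟨t, ht', by omega, (show q.1 ≤ t.1 by omega).lt_of_ne fun e => ?_⟩
        exact hdisj q hq ((Prod.ext e (by omega) : q = t) ▸ ht')
  have hx : S x.1 := by
    rcases h1.lt_or_eq with h | h
    · exact Or.inl h
    · exact Or.inr ⟨o.1, ho1, h.symm, h2⟩
  have hwalk : ∀ z, Reach u x z → Reach u z y → S z.1 := by
    intro z hz
    induction hz with
    | refl => exact fun _ => hx
    | tail hz ha ih =>
      obtain ⟨a, ha, rfl, rfl⟩ := ha
      intro hy
      refine forall_of_isChain (P := S) (isChain_points a) ?_ ?_ _ (right_mem_points a)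
      · exact fun p _ q hq hpq => hstep p q hpq ⟨a, ha, hz, hy, hq⟩
      · intro t ht
        simp only [points, List.head?_cons, Option.mem_def, Option.some.injEq] at ht
        exact ht ▸ ih ((Reach.of_arrow ha).trans hy)
  have hoo := Prod.le_def.1 h'.le
  rcases hwalk y h .refl with h7 | ⟨b, hb, hb1, hb2⟩
  · omega
  · have := Prod.le_def.1 hb.le
    omega

end Diagram

/-! ### Every semi-invariant flow contains the required paths -/

namespace DimQuiver

variable {Q : DimQuiver} {S : Set Q.Vtx}

/-- The coordinates of `(w_i, r_i)` add up to the number of paths to i. This monotonicity places the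
external vertices beyond the antidiagonals of `O₁` and `O₂`, as the crossing lemma requires. -/
theorem numPaths_one_le (hQ : Q.IsQuiverFlag) (hY : Q.IsYShaped) {i : Q.Vtx} (hi : i ≠ 0) :
    Q.numPaths 1 ≤ Q.numPaths i := by
  induction i using WellFoundedLT.induction with
  | ind i ih =>
    by_cases h1 : i = 1
    · rw [h1]
    · have h2 := ih _ (hQ.pred_lt hi) (pred_ne_zero hQ hY hi h1)
      rw [numPaths_eq hQ hY hi, if_pos h1]
      omega

theorem extPoint_of_notMem {i : Q.Vtx} (h : i ∉ S) : Q.extPoint S i = (Q.w i, (Q.r i : ℤ)) :=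
  if_neg h

theorem extPoint_of_mem {i : Q.Vtx} (h : i ∈ S) :
    Q.extPoint S i = (Q.w 1 - Q.w i, (Q.r 1 : ℤ) - Q.r i) :=
  if_pos h

theorem pathStart_of_mem {i : Q.NonSource} (h : i.1 ∈ S) : Q.pathStart S i = Q.ext S i := if_pos h

theorem pathStart_of_notMem {i : Q.NonSource} (h : i.1 ∉ S) : Q.pathStart S i = Q.O₂ S := if_neg h

theorem pathEnd_of_mem {i : Q.NonSource} (h : i.1 ∈ S) : Q.pathEnd S i = Q.O₁ S := if_pos h

theorem pathEnd_of_notMem {i : Q.NonSource} (h : i.1 ∉ S) : Q.pathEnd S i = Q.ext S i := if_neg h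

theorem ext_one (h : (1 : Q.Vtx) ∉ S) : Q.ext S ⟨1, one_ne_zero'⟩ = Q.O₁ S := by
  apply Subtype.ext
  rw [ext_val, extPoint_of_notMem h]
  rfl

section

variable (hQ : Q.IsQuiverFlag) (hY : Q.IsYShaped) (hS : Q.IsSplit S)
include hQ hY hS

theorem le_of_box {x y : ℤ} (h : (x, y) ∈ (Q.ladder S).box) :
    (0 ≤ x → 0 ≤ y) ∧ (x < Q.w 1 → y < Q.r 1) := by
  rw [(hS.isShape hQ hY).mem_box] at h
  constructor
  · intro hx
    have : (hS.profile hQ hY).lo x = 0 := if_pos hx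
    omega
  · intro hx
    have : (hS.profile hQ hY).hi x = Q.r 1 := if_pos hx
    omega

theorem step_bounds {p q : ℤ × ℤ} (h : (Q.ladder S).Step p q) :
    (0 < q.1 → 0 ≤ q.2) ∧ (p.1 < Q.w 1 → p.2 ≤ Q.r 1) := by
  obtain ⟨x, y⟩ := p
  obtain ⟨x', y'⟩ := q
  rcases Diagram.step_iff.1 h with ⟨rfl, rfl, h | h⟩ | ⟨rfl, rfl, h | h⟩ <;>
  · have := le_of_box hQ hY hS h
    dsimp only
    omega

theorem ext_of_mem {i : Q.NonSource} (h : i.1 ∈ S) :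
    (Q.ext S i).1.1 < 0 ∧ (Q.ext S i).1.1 + (Q.ext S i).1.2 ≤ 0 := by
  rw [ext_val, extPoint_of_mem h]
  have h1 := hS.first.w_lt hQ hY hS.first.one_mem (Or.inr h)
    ((hS.first.one_le (Or.inr h)).lt_of_ne' (hS.ne_one h))
  have h2 := numPaths_one_le hQ hY i.2
  have e1 : Q.w 1 = Q.numPaths 1 - Q.r 1 := rfl
  have e2 : Q.w i.1 = Q.numPaths i.1 - Q.r i.1 := rfl
  dsimp only
  omega

theorem ext_of_notMem {i : Q.NonSource} (h : i.1 ∉ S) (h1 : i.1 ≠ 1) :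
    Q.w 1 < (Q.ext S i).1.1 ∧ Q.w 1 + Q.r 1 ≤ (Q.ext S i).1.1 + (Q.ext S i).1.2 := by
  rw [ext_val, extPoint_of_notMem h]
  have hi : i.1 ∈ {i | i ≠ 0 ∧ i ∉ S} := ⟨i.2, h⟩
  have h3 := hS.second.w_lt hQ hY hS.second.one_mem hi
    ((hS.second.one_le hi).lt_of_ne' h1)
  have h2 := numPaths_one_le hQ hY i.2
  have e1 : Q.w 1 = Q.numPaths 1 - Q.r 1 := rfl
  have e2 : Q.w i.1 = Q.numPaths i.1 - Q.r i.1 := rfl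
  dsimp only
  omega

end

open Classical in
/-- The value on `U` of the boundary of a flow that is supported on `u` is bounded by what leaves
`U`. -/
theorem sum_cut_nonneg (u : (Q.ladder S).Arrow → ℕ) {n : ℕ} (hn : 0 < n)
    (hu : ∀ h : ℤ × ℤ → ℤ, ∑ a, (u a : ℤ) * (h a.right.1 - h a.left.1) =
      n * ∑ i : Q.NonSource, Q.c i.1 * (h (Q.pathEnd S i).1 - h (Q.pathStart S i).1))
    (U : Set (Q.ladder S).Vertex) (hU : ∀ a, 0 < u a → a.left ∈ U → a.right ∈ U) :
    0 ≤ ∑ i : Q.NonSource, Q.c i.1 *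
      ((if Q.pathEnd S i ∈ U then 1 else 0) - (if Q.pathStart S i ∈ U then 1 else 0)) := by
  have h1 := hu fun p => if p ∈ Subtype.val '' U then 1 else 0
  have h2 : ∀ v : (Q.ladder S).Vertex, v.1 ∈ Subtype.val '' U ↔ v ∈ U := fun v =>
    Subtype.val_injective.mem_set_image
  simp only [h2] at h1
  have h3 : (0 : ℤ) ≤ n * ∑ i : Q.NonSource, Q.c i.1 *
      ((if Q.pathEnd S i ∈ U then 1 else 0) - (if Q.pathStart S i ∈ U then 1 else 0)) := by
    rw [← h1]
    refine Finset.sum_nonneg fun a _ => ?_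
    rcases Nat.eq_zero_or_pos (u a) with h | h
    · simp [h]
    · refine mul_nonneg (Int.natCast_nonneg _) ?_
      have := hU a h
      split_ifs <;> simp_all
  exact nonneg_of_mul_nonneg_right h3 (by exact_mod_cast hn)

section Reach

variable (hQ : Q.IsQuiverFlag) (hY : Q.IsYShaped) (hS : Q.IsSplit S) (hF : Q.IsFano)
  (u : (Q.ladder S).Arrow → ℕ) {n : ℕ} (hn : 0 < n)
  (hu : ∀ h : ℤ × ℤ → ℤ, ∑ a, (u a : ℤ) * (h a.right.1 - h a.left.1) =
    n * ∑ i : Q.NonSource, Q.c i.1 * (h (Q.pathEnd S i).1 - h (Q.pathStart S i).1))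
include hF hn hu

open Classical in
/-- If no path starts in the forward closed set `U` and ends outside of it in a positive way, then
the end points of each path are both in `U` or both outside. -/
theorem mem_iff_of_closed (U : Set (Q.ladder S).Vertex)
    (hU : ∀ a, 0 < u a → a.left ∈ U → a.right ∈ U)
    (h : ∀ i, Q.pathEnd S i ∈ U → Q.pathStart S i ∈ U) (i : Q.NonSource)
    (hi : Q.pathStart S i ∈ U) : Q.pathEnd S i ∈ U := by
  by_contra hc
  have h1 := sum_cut_nonneg u hn hu U hU
  -- Flow can only enter U, so the sum is nonnegative; every term is nonpositive by assumption, and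
  -- the i-th would be negative because `c_i > 0`.
  refine absurd h1 (not_le.2 (Finset.sum_neg' (fun j _ => ?_) ⟨i, Finset.mem_univ _, ?_⟩))
  · refine mul_nonpos_of_nonneg_of_nonpos (hF j.1 j.2).le ?_
    have := h j
    split_ifs <;> simp_all
  · rw [if_neg hc, if_pos hi]
    have := hF i.1 i.2
    linarith

include hS

/-- Cut along the set reachable from `O₂`. If it missed `O₁`, any path ending in it would belong to
the second leg and start at `O₂`; the cut argument for the path of vertex 1 then puts `O₁` into the
set after all. -/
theorem reach_O₂_O₁ : Diagram.Reach u (Q.O₂ S) (Q.O₁ S) := by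
  by_contra hc
  have h1 : (1 : Q.Vtx) ∉ S := hS.one_notMem
  refine hc ?_
  have := mem_iff_of_closed hF u hn hu {v | Diagram.Reach u (Q.O₂ S) v} ?_ ?_
    ⟨1, one_ne_zero'⟩ ?_
  · rwa [pathEnd_of_notMem h1, ext_one h1] at this
  · exact fun a ha h => Relation.ReflTransGen.trans h (Diagram.Reach.of_arrow ha)
  · intro i hi
    by_cases h : i.1 ∈ S
    · rw [pathEnd_of_mem h] at hi
      exact absurd hi hc
    · rw [pathStart_of_notMem h]
      exact .refl
  · rw [pathStart_of_notMem h1]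
    exact .refl

/-- Cut along everything reachable from some start; it contains all starts and hence all ends. -/
theorem reach_ext_of_notMem {i : Q.NonSource} (hi : i.1 ∉ S) :
    Diagram.Reach u (Q.O₂ S) (Q.ext S i) ∨
      ∃ j : Q.NonSource, j.1 ∈ S ∧ Diagram.Reach u (Q.ext S j) (Q.ext S i) := by
  have hO := reach_O₂_O₁ hS hF u hn hu
  have := mem_iff_of_closed hF u hn hu {v | Diagram.Reach u (Q.O₂ S) v ∨
    ∃ j : Q.NonSource, j.1 ∈ S ∧ Diagram.Reach u (Q.ext S j) v} ?_ ?_ i ?_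
  · rwa [pathEnd_of_notMem hi] at this
  · rintro a ha (h | ⟨j, hj, h⟩)
    · exact Or.inl (Relation.ReflTransGen.trans h (Diagram.Reach.of_arrow ha))
    · exact Or.inr ⟨j, hj, Relation.ReflTransGen.trans h (Diagram.Reach.of_arrow ha)⟩
  · intro j _
    by_cases h : j.1 ∈ S
    · rw [pathStart_of_mem h]
      exact Or.inr ⟨j, h, .refl⟩
    · rw [pathStart_of_notMem h]
      exact Or.inl .refl
  · rw [pathStart_of_notMem hi]
    exact Or.inl .refl

/-- Cut along everything from which no end can be reached; it contains no end, hence no start. -/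
theorem reach_ext_of_mem {j : Q.NonSource} (hj : j.1 ∈ S) :
    Diagram.Reach u (Q.ext S j) (Q.O₁ S) ∨
      ∃ i : Q.NonSource, i.1 ∉ S ∧ Diagram.Reach u (Q.ext S j) (Q.ext S i) := by
  have hO := reach_O₂_O₁ hS hF u hn hu
  by_contra hc
  have := mem_iff_of_closed hF u hn hu {v | ¬ (Diagram.Reach u v (Q.O₁ S) ∨
    ∃ i : Q.NonSource, i.1 ∉ S ∧ Diagram.Reach u v (Q.ext S i))} ?_ ?_ j ?_
  · rw [pathEnd_of_mem hj] at this
    exact this (Or.inl .refl)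
  · rintro a ha h h'
    refine h (h'.imp (fun h' => ?_) ?_)
    · exact Relation.ReflTransGen.trans (Diagram.Reach.of_arrow ha) h'
    · rintro ⟨i, hi, h'⟩
      exact ⟨i, hi, Relation.ReflTransGen.trans (Diagram.Reach.of_arrow ha) h'⟩
  · intro i hi
    by_cases h : i.1 ∈ S
    · rw [pathEnd_of_mem h] at hi
      exact absurd (Or.inl .refl) hi
    · rw [pathEnd_of_notMem h] at hi
      exact absurd (Or.inr ⟨i, h, .refl⟩) hi
  · rw [pathStart_of_mem hj]
    exact hc

include hQ hY

/-- A flow path from an external vertex of the first leg to one of the second passes from the left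
of the path from `O₂` to `O₁` to its right. It meets that path, and switching there repairs both
ends. -/
theorem reach_crossing {i j : Q.NonSource} (hi : i.1 ∉ S) (hj : j.1 ∈ S)
    (h : Diagram.Reach u (Q.ext S j) (Q.ext S i)) :
    Diagram.Reach u (Q.ext S j) (Q.O₁ S) ∧ Diagram.Reach u (Q.O₂ S) (Q.ext S i) := by
  have hO := reach_O₂_O₁ hS hF u hn hu
  have hw := w_one_pos hQ hY
  by_cases h1 : i.1 = 1
  · have e : Q.ext S i = Q.O₁ S := by
      rw [← ext_one hS.one_notMem]
      congr 1
      exact Subtype.ext h1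
    exact ⟨e ▸ h, e ▸ hO⟩
  have e2 : (Q.O₂ S).1 = (0, 0) := rfl
  have e1 : (Q.O₁ S).1 = (Q.w 1, (Q.r 1 : ℤ)) := rfl
  have hj' := ext_of_mem hQ hY hS hj
  have hi' := ext_of_notMem hQ hY hS hi h1
  refine (hS.isGood hQ hY).reach_of_crossing h hO ?_ ?_ ?_ ?_ ?_ ?_ ?_
  · intro e
    rw [e, e1] at e2
    have := congrArg Prod.fst e2
    dsimp only at this
    omega
  · rw [e2]
    simpa using hj'.2
  · rw [e2]
    exact hj'.1
  · rw [e1]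
    exact hi'.2
  · rw [e1]
    exact hi'.1
  · intro p q hpq hq
    rw [e2] at hq ⊢
    have := (step_bounds hQ hY hS hpq).1
    dsimp only at hq ⊢
    omega
  · intro p q hpq hq
    rw [e1] at hq ⊢
    have := (step_bounds hQ hY hS hpq).2
    dsimp only at hq ⊢
    omega

theorem reach_path (i : Q.NonSource) :
    Diagram.Reach u (Q.pathStart S i) (Q.pathEnd S i) := by
  by_cases hi : i.1 ∈ S
  · rw [pathStart_of_mem hi, pathEnd_of_mem hi]
    rcases reach_ext_of_mem hS hF u hn hu hi with h | ⟨j, hj, h⟩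
    · exact h
    · exact (reach_crossing hQ hY hS hF u hn hu hj hi h).1
  · rw [pathStart_of_notMem hi, pathEnd_of_notMem hi]
    rcases reach_ext_of_notMem hS hF u hn hu hi with h | ⟨j, hj, h⟩
    · exact h
    · exact (reach_crossing hQ hY hS hF u hn hu hi hj h).2

end Reach

end DimQuiver

/-! ### Multiplicities of arrows in paths -/

namespace Diagram

variable {D : Diagram}

open Classical in
/-- The number of times an arrow occurs in a path. -/
def pathCount {x : D.Vertex} : {y : D.Vertex} → Quiver.Path x y → D.Arrow → ℤ
  | _, .nil, _ => 0
  | _, .cons p a, b => pathCount p b + if b = ⟨_, _, a⟩ then 1 else 0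

theorem sum_pathCount [Fintype D.Arrow] {x y : D.Vertex} (p : Quiver.Path x y)
    (h : ℤ × ℤ → ℤ) : ∑ a, pathCount p a * (h a.right.1 - h a.left.1) = h y.1 - h x.1 := by
  induction p with
  | nil => simp [pathCount]
  | cons p a ih =>
    simp only [pathCount, add_mul, Finset.sum_add_distrib, ih]
    rw [Finset.sum_eq_single ⟨_, _, a⟩, if_pos rfl]
    · ring
    · intro b _ hb
      rw [if_neg hb, zero_mul]
    · simp

theorem Reach.exists_path {u : D.Arrow → ℕ} {x y : D.Vertex} (h : Reach u x y) :
    ∃ p : Quiver.Path x y, ∀ a, u a = 0 → pathCount p a = 0 := by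
  induction h with
  | refl => exact ⟨.nil, fun _ _ => rfl⟩
  | tail _ h ih =>
    obtain ⟨p, hp⟩ := ih
    obtain ⟨⟨v, w, a⟩, ha, rfl, rfl⟩ := h
    refine ⟨p.cons a, fun b hb => ?_⟩
    rw [pathCount, hp b hb, if_neg, add_zero]
    rintro rfl
    exact ha.ne' hb

end Diagram

/-! ### Path divisors as combinations of toric divisors -/

namespace DimQuiver

variable {Q : DimQuiver} {S : Set Q.Vtx}

theorem pathDivisor_eq {x y : (Q.ladder S).Vertex} (p : Quiver.Path x y) :
    Q.pathDivisor S p = ∑ a, Diagram.pathCount p a • Q.arrowDivisor S a := by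
  induction p with
  | nil => simp [pathDivisor, Diagram.pathCount]
  | cons p a ih =>
    simp only [pathDivisor, Diagram.pathCount, add_smul, Finset.sum_add_distrib, ih]
    congr 1
    rw [Finset.sum_eq_single (⟨_, _, a⟩ : (Q.ladder S).Arrow), if_pos rfl, one_smul]
    · intro b _ hb
      rw [if_neg hb, zero_smul]
    · simp

open Classical in
-- Testing with the indicator function of a vertex reads off one coordinate of the sum of weights.
theorem mem_relLattice_weight {m : (Q.ladder S).Arrow → ℤ}
    (h : ∀ h : ℤ × ℤ → ℤ, ∑ a, m a * (h a.right.1 - h a.left.1) = 0) :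
    m ∈ relLattice (Q.weight S) := by
  rw [mem_relLattice]
  ext v
  rw [Finset.sum_apply, Pi.zero_apply, ← h fun p => if v.1.1 = p then 1 else 0]
  refine Finset.sum_congr rfl fun a _ => ?_
  have e : ∀ x : (Q.ladder S).Vertex, v.1 = x ↔ v.1.1 = x.1 := fun x =>
    ⟨fun h => h ▸ rfl, Subtype.ext⟩
  simp only [Pi.smul_apply, weight, smul_eq_mul, e]

open Classical in
/-- Pairing of a character with a function on the vertices. -/
theorem sum_mul_weight (h : ℤ × ℤ → ℤ) (a : (Q.ladder S).Arrow) [Fintype (Q.ladder S).Vertex] :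
    ∑ v : {v : (Q.ladder S).Vertex // v ≠ Q.O₂ S}, (h v.1.1 - h (Q.O₂ S).1) * Q.weight S a v =
      h a.right.1 - h a.left.1 := by
  have key : ∀ x : (Q.ladder S).Vertex,
      ∑ v : {v : (Q.ladder S).Vertex // v ≠ Q.O₂ S}, (h v.1.1 - h (Q.O₂ S).1) *
        (if v.1 = x then 1 else 0) = h x.1 - h (Q.O₂ S).1 := by
    intro x
    by_cases hx : x = Q.O₂ S
    · rw [Finset.sum_eq_zero, hx, sub_self]
      intro v _
      rw [if_neg fun h => v.2 (h.trans hx), mul_zero]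
    · rw [Finset.sum_eq_single ⟨x, hx⟩, if_pos rfl, mul_one]
      · intro v _ hv
        rw [if_neg fun h => hv (Subtype.ext h), mul_zero]
      · simp
  simp only [weight, mul_sub, Finset.sum_sub_distrib, key]
  ring

/-- Pairing with h turns the weight equation of a monomial of degree n into the statement that its
exponents have n times the boundary of the flow equal to 1 on all arrows. -/
theorem sum_of_mem_semiInvariants (hQ : Q.IsQuiverFlag) (hY : Q.IsYShaped) (hS : Q.IsSplit S)
    (s : Mon (Q.weight S)) (h : ℤ × ℤ → ℤ) :
    ∑ a, (s.1.1 a : ℤ) * (h a.right.1 - h a.left.1) =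
      s.1.2 * ∑ i : Q.NonSource, Q.c i.1 * (h (Q.pathEnd S i).1 - h (Q.pathStart S i).1) := by
  classical
  have : Finite (Q.ladder S).Vertex := (Q.finite_mark_ladder S).to_subtype
  have := Fintype.ofFinite (Q.ladder S).Vertex
  have h1 := congrArg (fun f : Q.CharLattice S =>
    ∑ v : {v : (Q.ladder S).Vertex // v ≠ Q.O₂ S}, (h v.1.1 - h (Q.O₂ S).1) * f v)
    (mem_semiInvariants.1 s.2)
  have key : ∀ k : (Q.ladder S).Arrow → ℕ,
      ∑ v : {v : (Q.ladder S).Vertex // v ≠ Q.O₂ S}, (h v.1.1 - h (Q.O₂ S).1) *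
        (∑ a, k a • Q.weight S a) v = ∑ a, (k a : ℤ) * (h a.right.1 - h a.left.1) := by
    intro k
    simp only [Finset.sum_apply, Finset.mul_sum]
    rw [Finset.sum_comm]
    refine Finset.sum_congr rfl fun a _ => ?_
    rw [← sum_mul_weight h a, Finset.mul_sum]
    refine Finset.sum_congr rfl fun v _ => ?_
    simp
    ring
  rw [← hS.sum_arrow hQ hY, Finset.mul_sum, ← key, ← key fun _ => s.1.2]
  have e : s.1.2 • totalWeight (Q.weight S) = ∑ a, s.1.2 • Q.weight S a := Finset.smul_sum
  rw [← e]
  exact h1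

theorem exists_relLattice_ne (hQ : Q.IsQuiverFlag) (hY : Q.IsYShaped) (hS : Q.IsSplit S)
    (a b : (Q.ladder S).Arrow) (hab : a ≠ b) : ∃ m ∈ relLattice (Q.weight S), m a ≠ m b := by
  have hG := hS.isGood hQ hY
  obtain ⟨β, hβ, h⟩ := hG.exists_loop_ne (hG.isEss_ess a).isEssential (hG.isEss_ess b).isEssential
    fun h => hab (hG.ess_injective h)
  exact ⟨fun a => Diagram.loop β (hG.ess a), mem_relLattice_weight (hG.sum_loop hβ), h⟩

theorem exists_relLattice_eq_one (hQ : Q.IsQuiverFlag) (hY : Q.IsYShaped) (hS : Q.IsSplit S)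
    (a : (Q.ladder S).Arrow) : ∃ m ∈ relLattice (Q.weight S), m a = 1 := by
  have hG := hS.isGood hQ hY
  obtain ⟨β, hβ, h⟩ := (hG.isEss_ess a).isEssential.exists_loop
  have h1 := mem_relLattice_weight (hG.sum_loop hβ)
  rcases h with h | h
  · exact ⟨_, h1, h⟩
  · exact ⟨_, neg_mem h1, by simp [h]⟩

theorem exists_path_of_mem (hQ : Q.IsQuiverFlag) (hY : Q.IsYShaped) (hS : Q.IsSplit S)
    (hF : Q.IsFano) (s : Mon (Q.weight S)) (hs : 0 < s.1.2) (i : Q.NonSource) :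
    ∃ p : Q.LadderPath S i, ∀ a, s.1.1 a = 0 → Diagram.pathCount p a = 0 :=
  (reach_path hQ hY hS hF (fun a => s.1.1 a) hs (sum_of_mem_semiInvariants hQ hY hS s)
    i).exists_path

theorem nonempty_ladderPath (hQ : Q.IsQuiverFlag) (hY : Q.IsYShaped) (hS : Q.IsSplit S)
    (hF : Q.IsFano) (i : Q.NonSource) : Nonempty (Q.LadderPath S i) := by
  have h := reach_path hQ hY hS hF (fun _ => 1) one_pos (fun h => by
    simpa using hS.sum_arrow hQ hY h) i
  exact ⟨h.exists_path.choose⟩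

theorem sum_sum_pathCount (k : Q.NonSource → ℤ) (p : ∀ i, Q.LadderPath S i) (h : ℤ × ℤ → ℤ) :
    ∑ a, (∑ i, k i * Diagram.pathCount (p i) a) * (h a.right.1 - h a.left.1) =
      ∑ i, k i * (h (Q.pathEnd S i).1 - h (Q.pathStart S i).1) := by
  simp only [Finset.sum_mul]
  rw [Finset.sum_comm]
  refine Finset.sum_congr rfl fun i _ => ?_
  rw [← Diagram.sum_pathCount (p i) h, Finset.mul_sum]
  exact Finset.sum_congr rfl fun a _ => mul_assoc _ _ _

/-- For each monomial of positive degree replace all paths by paths with the same ends in its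
support. The difference lies in the character lattice, and the new paths contribute nothing at the
arrows where the exponent is zero. -/
theorem isCartier_sum_pathCount (hQ : Q.IsQuiverFlag) (hY : Q.IsYShaped) (hS : Q.IsSplit S)
    (hF : Q.IsFano) (k : Q.NonSource → ℤ) (p : ∀ i, Q.LadderPath S i) :
    IsCartier (GX (Q.weight S)) (∑ a, (∑ i, k i * Diagram.pathCount (p i) a) •
      coordDivisor (Q.weight S) (totalWeight (Q.weight S)) a) := by
  refine isCartier_of_forall_monomial (exists_relLattice_ne hQ hY hS)
    (exists_relLattice_eq_one hQ hY hS) fun s hs => ?_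
  choose p' hp' using exists_path_of_mem hQ hY hS hF s hs
  refine ⟨fun a => ∑ i, k i * Diagram.pathCount (p i) a - ∑ i, k i * Diagram.pathCount (p' i) a,
    mem_relLattice_weight fun h => ?_, fun a ha => ?_⟩
  · have h1 := sum_sum_pathCount k p h
    have h2 := sum_sum_pathCount k p' h
    rw [Finset.sum_congr rfl fun a _ => sub_mul _ _ _, Finset.sum_sub_distrib, h1, h2, sub_self]
  · dsimp only
    rw [Finset.sum_eq_zero (f := fun i => k i * Diagram.pathCount (p' i) a), sub_zero]
    intro i _
    rw [hp' i a ha, mul_zero]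

theorem sum_smul_pathDivisor (k : Q.NonSource → ℤ) (p : ∀ i, Q.LadderPath S i) :
    ∑ i, k i • Q.pathDivisor S (p i) =
      ∑ a, (∑ i, k i * Diagram.pathCount (p i) a) • Q.arrowDivisor S a := by
  simp only [pathDivisor_eq, Finset.smul_sum, Finset.sum_smul, mul_smul]
  rw [Finset.sum_comm]

theorem isCartier_sum_pathDivisor (hQ : Q.IsQuiverFlag) (hY : Q.IsYShaped) (hS : Q.IsSplit S)
    (hF : Q.IsFano) (k : Q.NonSource → ℤ) (p : ∀ i, Q.LadderPath S i) :
    IsCartier (GX (Q.weight S)) (∑ i, k i • Q.pathDivisor S (p i)) := by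
  have e := sum_smul_pathDivisor k p
  exact (congrArg (IsCartier (GX (Q.weight S))) e).mpr (isCartier_sum_pathCount hQ hY hS hF k p)

/-- The combination `∑ c_i Π_i` has the same boundary as the sum of all arrows, so `m = 1 - ∑ c_i
Π_i` is a character, and `∑ (m_a - 1) D_a` is the divisor in question. -/
theorem isCanonicalDivisor_sum_pathDivisor (hQ : Q.IsQuiverFlag) (hY : Q.IsYShaped)
    (hS : Q.IsSplit S) (p : ∀ i, Q.LadderPath S i) :
    IsCanonicalDivisor (GXToSpec (Q.weight S))
      (-∑ i : Q.NonSource, Q.c i.1 • Q.pathDivisor S (p i)) := by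
  have hm : (fun a => 1 - ∑ i : Q.NonSource, Q.c i.1 * Diagram.pathCount (p i) a) ∈
      relLattice (Q.weight S) := by
    refine mem_relLattice_weight fun h => ?_
    have h1 := sum_sum_pathCount (fun i => Q.c i.1) p h
    rw [Finset.sum_congr rfl fun a _ => sub_mul _ _ _, Finset.sum_sub_distrib, h1,
      ← hS.sum_arrow hQ hY]
    simp
  have h := isCanonicalDivisor_of_mem (exists_relLattice_ne hQ hY hS)
    (exists_relLattice_eq_one hQ hY hS) ⟨_, hm⟩
  have e : -∑ i : Q.NonSource, Q.c i.1 • Q.pathDivisor S (p i) =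
      ∑ a, ((1 - ∑ i : Q.NonSource, Q.c i.1 * Diagram.pathCount (p i) a) - 1) •
        Q.arrowDivisor S a := by
    rw [sum_smul_pathDivisor, ← Finset.sum_neg_distrib]
    refine Finset.sum_congr rfl fun a _ => ?_
    rw [← neg_smul]
    congr 1
    ring
  exact (congrArg (IsCanonicalDivisor (GXToSpec (Q.weight S))) e).mpr h

end DimQuiver

end LadderToric

end

/-! ### The proposition -/

theorem mainTheorem6 (Q : LadderToric.DimQuiver) (hQ : Q.IsQuiverFlag) (hY : Q.IsYShaped)
    (hF : Q.IsFano) (S : Set Q.Vtx) (hS : Q.IsFirstLeg S) :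
    ∃ (_ : AlgebraicGeometry.IsIntegral (Q.X S))
      (_ : AlgebraicGeometry.IsLocallyNoetherian (Q.X S)),
      (∀ i : Q.NonSource, Nonempty (Q.LadderPath S i)) ∧
      (∀ (i : Q.NonSource) (p : Q.LadderPath S i),
        LadderToric.IsCartier (Q.X S) (Q.pathDivisor S p)) ∧
      (∀ p : (i : Q.NonSource) → Q.LadderPath S i,
        LadderToric.IsCanonicalDivisor (Q.XToSpec S)
          (-∑ i : Q.NonSource, Q.c i.1 • Q.pathDivisor S (p i))) ∧
      LadderToric.IsGorenstein (Q.XToSpec S) := by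
  open LadderToric LadderToric.DimQuiver in
  have hs := hS.isSplit hQ hY
  have i1 : AlgebraicGeometry.IsIntegral (Q.X S) :=
    inferInstanceAs (AlgebraicGeometry.IsIntegral (GX (Q.weight S)))
  have i2 : AlgebraicGeometry.IsLocallyNoetherian (Q.X S) :=
    inferInstanceAs (AlgebraicGeometry.IsLocallyNoetherian (GX (Q.weight S)))
  have hpath := nonempty_ladderPath hQ hY hs hF
  have hcar : ∀ (k : Q.NonSource → ℤ) (p : ∀ i, Q.LadderPath S i) (d : Q.X S → ℤ),
      ∑ i, k i • Q.pathDivisor S (p i) = d → IsCartier (Q.X S) d := by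
    rintro k p _ rfl
    exact isCartier_sum_pathDivisor hQ hY hs hF k p
  have hcan : ∀ p : ∀ i, Q.LadderPath S i, IsCanonicalDivisor (Q.XToSpec S)
      (-∑ i : Q.NonSource, Q.c i.1 • Q.pathDivisor S (p i)) :=
    isCanonicalDivisor_sum_pathDivisor hQ hY hs
  refine ⟨i1, i2, hpath, fun i p => ?_, hcan,
    ⟨isIntegrallyClosed_stalk (D := Q.weight S), _, hcan fun i => (hpath i).some, ?_⟩⟩
  · classical
    -- A single path divisor is a combination with one nonzero coefficient; the other paths are
    -- irrelevant and chosen arbitrarily.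
    refine hcar (Pi.single i 1) (Function.update (fun i => (hpath i).some) i p) _ ?_
    rw [Finset.sum_eq_single i]
    · simp
    · intro j _ hj
      simp [hj]
    · simp
  · refine hcar (fun i => -Q.c i.1) (fun i => (hpath i).some) _ ?_
    simp only [neg_smul, Finset.sum_neg_distrib]
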